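/- Let $X$ be a connected finite CW complex with base point $x_0$, let $G=\pi_1(X,x_0)$, and let $H=G_{\mathrm{ab}}=H_1(X;\mathbb Z)$. For an abelian group $A$ and a character $\chi\in\mathrm{Hom}(A;\mathbb R)$, the initial form $\mathrm{in}_\chi(f)$ of a nonzero $f=\sum a_h h\in\mathbb Z[A]$ is the sum of the terms $a_h h$ for which $\chi(h)$ is minimal among all $h$ with $a_h\neq 0$. For an ideal $I\subseteq\mathbb Z[A]$ let $\mathrm{in}_\chi(I)$ be the ideal generated by all $\mathrm{in}_\chi(f)$ with $0\neq f\in I$, and put $$\mathrm{Trop}_{\mathbb Z}(I)=\{\chi\in\mathrm{Hom}(A;\mathbb R)\mid \mathrm{in}_\chi(I)\neq\mathbb Z[A]\}.$$ For an epimorphism $\nu\colon G\twoheadrightarrow H'$ onto an abelian group $H'$, let $X^\nu\to X$ be the connected regular covering with deck transformation group $H'$ corresponding to $\nu$. Its cellular chain complex $C_*(X^\nu;\mathbb Z)$, for the lifted cell structure, is a complex of finitely generated free $\mathbb Z[H']$-modules, and $H_i(X^\nu;\mathbb Z)$ denotes its homology, a $\mathbb Z[H']$-module via deck transformations; $\mathrm{Ann}$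 denotes the annihilator ideal in $\mathbb Z[H']$. Let $X^H$ be the maximal abelian cover of $X$ (the case $\nu\colon G\to H$). Write $c_j$ for the rank of the free $\mathbb Z[H]$-module $C_j(X^H;\mathbb Z)$, and $d_j\colon C_j(X^H;\mathbb Z)\to C_{j-1}(X^H;\mathbb Z)$ for the differential (with $d_0=0$). The $j$-th jump ideal $\mathcal J^j(X;\mathbb Z)\subseteq\mathbb Z[H]$ is the ideal generated by the $c_j\times c_j$ minors of $d_{j+1}\oplus d_j$, and $\mathcal J^{\leqslant k}(X;\mathbb Z)=\bigcap_{0\leqslant j\leqslant k}\mathcal J^j(X;\mathbb Z)$. **Proposition.** 1. Let $\nu\colon G\twoheadrightarrow H'$ be an epimorphism onto an abelian group with $\mathrm{rank}_{\mathbb Z}H'\geqslant 1$, and let $i\geqslant 0$. Then $H_i(X^\nu;\mathbb Z)$ is a finitely generated $\mathbb Z[H']$-module, and it is finitely generated over $\mathbb Z$ if and only if $\mathrm{Trop}_{\mathbb Z}(\mathrm{Ann}(H_i(X^\nu;\mathbb Z)))\subseteq\{0\}$. 2. Let $k\geqslant 0$. If $\mathrm{Trop}_{\mathbb Z}(\mathcal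 J^{\leqslant k}(X;\mathbb Z))\subseteq\{0\}$, then for every epimorphism $\nu\colon G\twoheadrightarrow H'$ onto an abelian group with $\mathrm{rank}_{\mathbb Z}H'\geqslant 1$ and every $0\leqslant i\leqslant k$, the group $H_i(X^\nu;\mathbb Z)$ is finitely generated over $\mathbb Z$. -/

import Mathlib

open CategoryTheory Topology Set

universe u v w z

noncomputable section

namespace AbCover

/-! ### Tropical varieties over a ring -/

section Trop

variable {R : Type u} [CommRing R] {H : Type v} [CommGroup H]

/-- The initial form `in_χ(f)` of `f = ∑ a_h h` in the group ring `R[H]`: the sum of all the terms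
`a_h h` of `f` for which `χ(h)` is minimal among the `χ(h')` with `a_{h'} ≠ 0`. -/
def initialForm (χ : Additive H →+ ℝ) (f : MonoidAlgebra R H) : MonoidAlgebra R H :=
  open Classical in
  MonoidAlgebra.ofCoeff (f.coeff.filter
    (fun h => ∀ h' ∈ f.coeff.support, χ (Additive.ofMul h) ≤ χ (Additive.ofMul h')))

/-- The initial ideal `in_χ(I)`, generated by the initial forms of the elements of `I`. -/
def initialIdeal (χ : Additive H →+ ℝ) (I : Ideal (MonoidAlgebra R H)) :
    Ideal (MonoidAlgebra R H) :=
  Ideal.span (initialForm χ '' (I : Set (MonoidAlgebra R H)))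

/-- The tropical variety over `R` of an ideal `I` of `R[H]`, a subset of `Hom(H, ℝ)`. -/
def tropVariety (I : Ideal (MonoidAlgebra R H)) : Set (Additive H →+ ℝ) :=
  {χ | initialIdeal χ I ≠ ⊤}

end Trop

/-! ### Jump ideals of a chain complex of finitely generated free modules -/

section Jump

variable {R : Type u} [CommRing R]

/-- The ideal generated by the `r × r` minors of the matrix of a linear map `f` between finitely
generated free modules.  The ideal does not depend on the bases in which the matrix is written;
here we take the minors of the matrices of `f` in all bases. -/
def minorsIdeal {M N : Type v} [AddCommGroup M] [Module R M] [AddCommGroup N] [Module R N]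
    (r : ℕ) (f : M →ₗ[R] N) : Ideal R :=
  Ideal.span {x | ∃ (m n : ℕ) (b : Module.Basis (Fin m) R M) (c : Module.Basis (Fin n) R N)
    (p : Fin r → Fin n) (q : Fin r → Fin m),
    x = ((LinearMap.toMatrix b c f).submatrix p q).det}

/-- The `i`-th jump ideal `I_{c_i}(∂ ⊕ ∂')` where `∂ : C_{i+1} → C_i` and `∂' : C_i → C_{i-1}` are
the differentials and `c_i` is the rank of `C_i`.  (For `i = 0`, the second differential is the
zero map `K.d 0 0`, which contributes only zero rows and columns.) -/
def jumpIdeal (K : ChainComplex (ModuleCat.{v} R) ℕ) (i : ℕ) : Ideal R :=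
  minorsIdeal (Module.finrank R (K.X i)) (LinearMap.prodMap (K.d (i + 1) i).hom (K.d i (i - 1)).hom)

/-- The intersection of the `j`-th jump ideals over `0 ≤ j ≤ k`. -/
def jumpIdealLE (K : ChainComplex (ModuleCat.{v} R) ℕ) (k : ℕ) : Ideal R :=
  ⨅ (j : ℕ) (_ : j ≤ k), jumpIdeal K j

end Jump

/-! ### Singular chains of a space with a group action -/

section Singular

/-- Singular `n`-simplices of `Y`. -/
abbrev SingSimplex (Y : Type v) [TopologicalSpace Y] (n : ℕ) : Type v :=
  C(stdSimplex ℝ (Fin (n + 1)), Y)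

/-- The `i`-th face of a singular simplex. -/
def face {Y : Type v} [TopologicalSpace Y] {n : ℕ} (i : Fin (n + 2)) (σ : SingSimplex Y (n + 1)) :
    SingSimplex Y n :=
  σ.comp ⟨stdSimplex.map i.succAbove, stdSimplex.continuous_map _⟩

variable (H : Type w) [CommGroup H] (Y : Type v) [TopologicalSpace Y] [MulAction H Y]
  [ContinuousConstSMul H Y]

/-- The action of `H` on the free abelian group on the singular `n`-simplices of `Y`. -/
def singRep (n : ℕ) : Representation ℤ H (SingSimplex Y n →₀ ℤ) where
  toFun h := Finsupp.lmapDomain ℤ ℤ (fun σ => h • σ)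
  map_one' := by
    ext σ : 1
    ext : 1
    simp
  map_mul' g h := by
    ext σ : 1
    ext : 1
    simp [mul_smul]

/-- The singular `n`-chains of `Y`, as a module over `ℤ[H]`. -/
abbrev SingChain (n : ℕ) : Type v := (singRep H Y n).asModule

variable {Y} in
/-- The singular simplex `σ`, as a singular chain. -/
def singOf {n : ℕ} (σ : SingSimplex Y n) : SingChain H Y n :=
  (singRep H Y n).asModuleEquiv.symm (Finsupp.single σ 1)

/-- The singular boundary `σ ↦ ∑ i, (-1)^i (face i σ)`, as a map of abelian groups. -/
def singBdryInt (n : ℕ) : (SingSimplex Y (n + 1) →₀ ℤ) →ₗ[ℤ] (SingSimplex Y n →₀ ℤ) :=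
  Finsupp.linearCombination ℤ
    (fun σ => ∑ i : Fin (n + 2), (-1 : ℤ) ^ (i : ℕ) • Finsupp.single (face i σ) (1 : ℤ))

/-- The singular boundary commutes with the action. -/
def singBdryHom (n : ℕ) : (singRep H Y (n + 1)).IntertwiningMap (singRep H Y n) where
  toLinearMap := singBdryInt Y n
  isIntertwining' g := by
    ext σ : 1
    ext : 1
    simp only [singBdryInt, singRep, MonoidHom.coe_mk, OneHom.coe_mk, LinearMap.comp_apply,
      Finsupp.lsingle_apply, Finsupp.lmapDomain_apply, Finsupp.mapDomain_single,
      Finsupp.linearCombination_single, one_smul]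
    rw [← Finsupp.lmapDomain_apply (M := ℤ) (R := ℤ), map_sum]
    refine Finset.sum_congr rfl fun i _ => ?_
    rw [map_smul, Finsupp.lmapDomain_apply, Finsupp.mapDomain_single]
    rfl

/-- The singular boundary as a `ℤ[H]`-linear map. -/
def singBdry (n : ℕ) : SingChain H Y (n + 1) →ₗ[MonoidAlgebra ℤ H] SingChain H Y n :=
  Representation.IntertwiningMap.equivLinearMapAsModule _ _ (singBdryHom H Y n)

theorem succAbove_succAbove_of_le {n : ℕ} {i j : Fin (n + 2)} (h : i ≤ j) (k : Fin (n + 1)) :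
    j.succ.succAbove (i.succAbove k) = i.castSucc.succAbove (j.succAbove k) := by
  rw [Fin.le_def] at h
  ext
  simp only [Fin.succAbove, Fin.lt_def]
  split_ifs <;> simp_all <;> omega

theorem face_face {n : ℕ} {i j : Fin (n + 2)} (h : i ≤ j) (σ : SingSimplex Y (n + 2)) :
    face i (face j.succ σ) = face j (face i.castSucc σ) := by
  ext x
  simp only [face, ContinuousMap.comp_apply, ContinuousMap.coe_mk, stdSimplex.map_comp_apply]
  congr 2
  funext k
  exact succAbove_succAbove_of_le h k

theorem singBdryInt_comp (n : ℕ) : singBdryInt Y n ∘ₗ singBdryInt Y (n + 1) = 0 := by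
  ext σ : 1
  ext : 1
  simp only [singBdryInt, LinearMap.comp_apply, Finsupp.lsingle_apply,
    Finsupp.linearCombination_single, one_mul, map_sum, map_smul, LinearMap.zero_apply,
    Finset.smul_sum, smul_smul]
  rw [← Fintype.sum_prod_type' (fun (j : Fin (n + 3)) (i : Fin (n + 2)) =>
    ((-1 : ℤ) ^ (j : ℕ) * (-1) ^ (i : ℕ)) • Finsupp.single (face i (face j σ)) (1 : ℤ))]
  rw [← Finset.sum_filter_add_sum_filter_not _
    (fun p : Fin (n + 3) × Fin (n + 2) => (p.1 : ℕ) ≤ (p.2 : ℕ)), ← eq_neg_iff_add_eq_zero,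
    ← Finset.sum_neg_distrib]
  refine Finset.sum_bij
    (fun p hp => (p.2.succ, p.1.castLT (lt_of_le_of_lt (Finset.mem_filter.1 hp).2 p.2.2)))
    ?_ ?_ ?_ ?_
  · rintro ⟨j, i⟩ hp
    simp at hp ⊢
    omega
  · rintro ⟨j, i⟩ hp ⟨j', i'⟩ hp' h
    simp only [Prod.mk.injEq, Fin.ext_iff, Fin.val_castLT, Fin.val_succ] at h ⊢
    omega
  · rintro ⟨j, i⟩ hp
    simp at hp
    have hj : j ≠ 0 := by
      rintro rfl
      simp at hp
    refine ⟨(i.castSucc, j.pred hj), ?_, ?_⟩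
    · simp
      omega
    · simp
  · rintro ⟨j, i⟩ hp
    have h2 : (j : ℕ) ≤ (i : ℕ) := (Finset.mem_filter.1 hp).2
    obtain ⟨j', rfl⟩ : ∃ j' : Fin (n + 2), j = j'.castSucc :=
      ⟨j.castLT (lt_of_le_of_lt h2 i.2), by simp⟩
    have h3 : j' ≤ i := Fin.le_def.2 h2
    simp only [Fin.castLT_castSucc, face_face Y h3, Fin.val_castSucc, Fin.val_succ]
    rw [← neg_smul]
    congr 1
    ring

theorem singBdry_singBdry (n : ℕ) (c : SingChain H Y (n + 2)) :
    singBdry H Y n (singBdry H Y (n + 1) c) = 0 :=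
  LinearMap.congr_fun (singBdryInt_comp Y n) c

variable {Y}

/-- The singular chains of the (invariant) subset `S`, as a submodule of those of `Y`. -/
def chainsIn (S : Set Y) (n : ℕ) : Submodule (MonoidAlgebra ℤ H) (SingChain H Y n) :=
  Submodule.span _ {c | ∃ σ : SingSimplex Y n, range σ ⊆ S ∧ c = singOf H σ}

/-- The relative `n`-cycles of the pair `(S, T)`. -/
def relCycles (S T : Set Y) : (n : ℕ) → Submodule (MonoidAlgebra ℤ H) (SingChain H Y n)
  | 0 => chainsIn H S 0
  | n + 1 => chainsIn H S (n + 1) ⊓ (chainsIn H T n).comap (singBdry H Y n)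

/-- The relative `n`-boundaries of the pair `(S, T)`. -/
def relBoundaries (S T : Set Y) (n : ℕ) : Submodule (MonoidAlgebra ℤ H) (SingChain H Y n) :=
  (chainsIn H S (n + 1)).map (singBdry H Y n) ⊔ chainsIn H T n

/-- The relative singular homology `H_n(S, T; ℤ)` of a pair `T ⊆ S` of invariant subsets of `Y`, as
a module over `ℤ[H]`: relative cycles modulo relative boundaries. -/
abbrev RelHomology (S T : Set Y) (n : ℕ) : Type v :=
  relCycles H S T n ⧸ (relBoundaries H S T n).submoduleOf (relCycles H S T n)

end Singular

/-! ### The cellular chain complex -/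

section Cellular

variable (H : Type w) [CommGroup H] {Y : Type v} [TopologicalSpace Y] [MulAction H Y]
  [ContinuousConstSMul H Y] (F : ℕ → Set Y)

theorem singBdry_mem_relCycles (n : ℕ) {S T U : Set Y} {c : SingChain H Y (n + 1)}
    (hc : c ∈ relCycles H S T (n + 1)) : singBdry H Y n c ∈ relCycles H T U n := by
  cases n with
  | zero => exact hc.2
  | succ n =>
    refine ⟨hc.2, ?_⟩
    simp [singBdry_singBdry]

/-- The boundary on relative cycles. -/
def cycleBdry (S T U : Set Y) (n : ℕ) :
    relCycles H S T (n + 1) →ₗ[MonoidAlgebra ℤ H] relCycles H T U n :=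
  (singBdry H Y n).restrict fun _ hc => singBdry_mem_relCycles H n hc

theorem cycleBdry_boundaries (S T U : Set Y) (n : ℕ) :
    (relBoundaries H S T (n + 1)).submoduleOf (relCycles H S T (n + 1)) ≤
      ((relBoundaries H T U n).submoduleOf (relCycles H T U n)).comap (cycleBdry H S T U n) := by
  rintro ⟨c, hc⟩ hb
  obtain ⟨x, hx, y, hy, rfl⟩ := Submodule.mem_sup.1 (show c ∈ relBoundaries H S T (n + 1) from hb)
  obtain ⟨z, -, rfl⟩ := hx
  show singBdry H Y n (singBdry H Y (n + 1) z + y) ∈ relBoundaries H T U n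
  rw [map_add, singBdry_singBdry, zero_add]
  exact Submodule.mem_sup_left ⟨y, hy, rfl⟩

/-- The connecting map `H_{n+1}(S, T) → H_n(T, U)` of a triple, `[c] ↦ [∂ c]`. -/
def relBdry (S T U : Set Y) (n : ℕ) :
    RelHomology H S T (n + 1) →ₗ[MonoidAlgebra ℤ H] RelHomology H T U n :=
  Submodule.mapQ _ _ (cycleBdry H S T U n) (cycleBdry_boundaries H S T U n)

theorem relBdry_comp (S T U V : Set Y) (n : ℕ) :
    relBdry H T U V n ∘ₗ relBdry H S T U (n + 1) = 0 := by
  refine Submodule.linearMap_qext _ ?_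
  ext ⟨c, hc⟩ : 1
  have : cycleBdry H T U V n (cycleBdry H S T U (n + 1) ⟨c, hc⟩) = 0 :=
    Subtype.ext (singBdry_singBdry H Y n c)
  simp [relBdry, this]

/-- The cellular chain complex of a space `Y` filtered by invariant subsets `F 0 ⊆ F 1 ⊆ ⋯`, where
`F n` stands for the `(n-1)`-skeleton: the complex of `ℤ[H]`-modules with
`C_n = H_n(F (n + 1), F n; ℤ)` and the differentials `[c] ↦ [∂ c]`. -/
def filtrationComplex : ChainComplex (ModuleCat.{v} (MonoidAlgebra ℤ H)) ℕ :=
  ChainComplex.of (fun n => ModuleCat.of _ (RelHomology H (F (n + 1)) (F n) n))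
    (fun n => ModuleCat.ofHom (relBdry H (F (n + 2)) (F (n + 1)) (F n) n))
    (fun n => by
      rw [← ModuleCat.ofHom_comp]
      exact congrArg ModuleCat.ofHom
        (relBdry_comp H (F (n + 3)) (F (n + 2)) (F (n + 1)) (F n) n))

end Cellular

/-! ### Abelian covers -/

section Cover

variable {X : Type u} [TopologicalSpace X]

/-- The connected regular covering `X^ν → X` that corresponds to a homomorphism `ν : π₁(X, x₀) → H`
onto an abelian group: `Y` is path-connected, `H` acts on `Y` as the group of deck transformations
of `proj`, and the lift to `Y` of a loop `γ` at `x₀` that starts at the base point `base` ends at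
`ν(γ) • base`. -/
structure AbelianCover (x₀ : X) {H : Type w} [CommGroup H] (ν : FundamentalGroup X x₀ →* H)
    (Y : Type v) [TopologicalSpace Y] [MulAction H Y] where
  /-- the covering projection -/
  proj : Y → X
  isCover : IsQuotientCoveringMap proj H
  pathConnected : PathConnectedSpace Y
  /-- the base point, above `x₀` -/
  base : proj ⁻¹' {x₀}
  monodromy_base (γ : FundamentalGroup X x₀) :
    (isCover.isCoveringMap.monodromy γ base : Y) = ν γ • (base : Y)

variable [T2Space X] [CWComplex (univ : Set X)] {x₀ : X} {H : Type w} [CommGroup H]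
  {ν : FundamentalGroup X x₀ →* H} {Y : Type v} [TopologicalSpace Y] [MulAction H Y]
  [ContinuousConstSMul H Y]

/-- The cellular chain complex `C_*(X^ν; ℤ)` of the cover of a CW complex, as a complex of
`ℤ[H]`-modules; the `n`-skeleton of `X^ν` is the preimage of the `n`-skeleton of `X`, the union of
the cells of dimension `< n + 1`. -/
def AbelianCover.cellularComplex (c : AbelianCover x₀ ν Y) :
    ChainComplex (ModuleCat.{v} (MonoidAlgebra ℤ H)) ℕ :=
  filtrationComplex H (fun n => c.proj ⁻¹' (CWComplex.skeletonLT (univ : Set X) (n : ℕ∞) : Set X))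

/-- The homology `H_i(X^ν; ℤ)`, as a module over `ℤ[H]` by deck transformations. -/
abbrev AbelianCover.homology (c : AbelianCover x₀ ν Y) (i : ℕ) :
    ModuleCat.{v} (MonoidAlgebra ℤ H) :=
  c.cellularComplex.homology i

end Cover

end AbCover

end

open AbCover

/-! Topology. The cellular complex is defined by relative singular homology, so it must first be
shown that H_n of two consecutive skeleta of an abelian cover is free over the group ring, with one
lift of each n-cell as a basis. Generation (`RelCells.span`): subdivide a relative cycle until each
simplex lies in an open cell or misses the cores of all cells, and collapse collars of the cells.
What remains are relative cycles of (Δⁿ, ∂Δⁿ), which are homologous to multiples of the identity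
simplex by a straight-line homotopy to a Sperner labelling (`simplex_cycle_mem`). Independence
(`RelCells.indep`): the signed count of fully labelled small simplices in one cell vanishes on
boundaries and on the smaller skeleton, and detects that cell only. `EquivCells.basis` puts this
into equivariant form. A compactness argument shows that the deck group is finitely generated, so
its group ring is noetherian and the homology is finitely generated over it.

Part 1. The initial ideal of I at χ is the whole ring iff I contains some 1 + g in which all terms
of g have positive χ-degree (`initialIdeal_eq_top_iff`). If M is finitely generated over ℤ and χ(h)
< 0, then h satisfies a monic polynomial on M; dividing by the leading power of h gives such an
element of Ann M. Conversely, choose a surjection from ℤⁿ onto the group. For each nonzero v in ℝⁿ,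
multiplication by 1 on M can be rewritten as a combination of translations by lattice vectors k with
v · k > 0. By compactness of the sphere finitely many relations suffice. With v pointing from a
towards the origin, they rewrite the translate by a distant a through translates by shorter vectors,
so finitely many translates of the generators span M over ℤ (`finite_of_tropVariety_annihilator`).

Part 2. Every ν factors through the abelianization by some φ, and in suitable lifted bases the
differentials of X^ν are the φ-images of those of the maximal abelian cover
(`AbelianCover.repr_push`). Let A, B be consecutive differentials of X^ν. All determinants det(AP +
QB) annihilate the homology, by Cayley–Hamilton for the null-homotopic map AP + QB. A maximal minor
of A ⊕ B outside a prime p forces split exactness over the fraction field at p, and clearing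
denominators puts some det(AP + QB) outside p as well. Hence jump ideals map into the radical of the
annihilator (`AbelianCover.jumpIdeal_le`). An element 1 + g of a jump ideal thus has an image some
power of which lies in the annihilator; this power again has the form 1 + g', and Part 1 applies. -/

noncomputable section
namespace AbCover

/-! ### Ordered chains -/

section Ordered

variable {V W V' W' : Type*}

/-- The ordered chains on `n` vertices in `V`. -/
abbrev OChain (V : Type*) (n : ℕ) : Type _ := (Fin n → V) →₀ ℤ

/-- The ordered simplex with vertices `w`, as a chain. -/
abbrev oOf {n : ℕ} (w : Fin n → V) : OChain V n := Finsupp.single w 1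

/-- The (augmented) boundary of ordered chains. -/
def oBdry (V : Type*) (n : ℕ) : OChain V (n + 1) →ₗ[ℤ] OChain V n :=
  Finsupp.linearCombination ℤ
    (fun w => ∑ i : Fin (n + 1), (-1 : ℤ) ^ (i : ℕ) • oOf (w ∘ i.succAbove))

/-- The cone with apex `p`. -/
def oCone (p : V) (n : ℕ) : OChain V n →ₗ[ℤ] OChain V (n + 1) :=
  Finsupp.lmapDomain ℤ ℤ (fun w => (Fin.cons p w : Fin (n + 1) → V))

/-- The map of ordered chains induced by a map of vertices. -/
def oMap (f : V → W) (n : ℕ) : OChain V n →ₗ[ℤ] OChain W n :=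
  Finsupp.lmapDomain ℤ ℤ (fun w => f ∘ w)

theorem oBdry_of {n : ℕ} (w : Fin (n + 1) → V) :
    oBdry V n (oOf w) = ∑ i : Fin (n + 1), (-1 : ℤ) ^ (i : ℕ) • oOf (w ∘ i.succAbove) := by
  simp [oBdry]

@[simp] theorem oCone_of (p : V) {n : ℕ} (w : Fin n → V) :
    oCone p n (oOf w) = oOf (Fin.cons p w : Fin (n + 1) → V) := by
  simp [oCone]

@[simp] theorem oMap_of (f : V → W) {n : ℕ} (w : Fin n → V) :
    oMap f n (oOf w) = oOf (f ∘ w) := by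
  simp [oMap]

theorem ochain_hom_ext {n : ℕ} {M : Type*} [AddCommGroup M] {f g : OChain V n →ₗ[ℤ] M}
    (h : ∀ w, f (oOf w) = g (oOf w)) : f = g := by
  ext w : 1
  ext : 1
  exact h w

theorem ochain_induction {n : ℕ} {M : Type*} [AddCommGroup M] (f g : OChain V n →ₗ[ℤ] M)
    (h : ∀ w, f (oOf w) = g (oOf w)) (c : OChain V n) : f c = g c :=
  LinearMap.congr_fun (ochain_hom_ext h) c

/-- Deleting the apex returns the chain, and deleting another vertex cones a face with the opposite
sign. This contraction of the augmented complex produces all the chain homotopies on ordered chains.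
-/
theorem oBdry_cone (p : V) (n : ℕ) (c : OChain V (n + 1)) :
    oBdry V (n + 1) (oCone p (n + 1) c) = c - oCone p n (oBdry V n c) := by
  refine ochain_induction (oBdry V (n + 1) ∘ₗ oCone p (n + 1))
    (LinearMap.id - oCone p n ∘ₗ oBdry V n) (fun w => ?_) c
  simp only [LinearMap.comp_apply, LinearMap.sub_apply, LinearMap.id_apply, oCone_of, oBdry_of,
    map_sum, map_smul]
  rw [Fin.sum_univ_succ, sub_eq_add_neg, ← Finset.sum_neg_distrib]
  congr 1
  · simp only [Fin.val_zero, pow_zero, one_smul]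
    congr 1
  · refine Finset.sum_congr rfl fun i _ => ?_
    rw [Fin.val_succ, pow_succ, mul_neg_one, neg_smul]
    congr 3
    funext k
    refine Fin.cases ?_ (fun k => ?_) k <;> simp

theorem oBdry_cone_zero (p : V) (c : OChain V 0) : oBdry V 0 (oCone p 0 c) = c := by
  refine ochain_induction (oBdry V 0 ∘ₗ oCone p 0) LinearMap.id (fun w => ?_) c
  simp only [LinearMap.comp_apply, LinearMap.id_apply, oCone_of, oBdry_of]
  simp

/-- An ordered simplex is the cone from its first vertex on the others, so the cone formula gives
the induction step without a double sum. -/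
theorem oBdry_oBdry (n : ℕ) (c : OChain V (n + 2)) : oBdry V n (oBdry V (n + 1) c) = 0 := by
  induction n with
  | zero =>
    refine ochain_induction (oBdry V 0 ∘ₗ oBdry V 1) 0 (fun w => ?_) c
    rw [← Fin.cons_self_tail w, ← oCone_of]
    simp only [LinearMap.comp_apply, oBdry_cone, map_sub, oBdry_cone_zero, sub_self,
      LinearMap.zero_apply]
  | succ n ih =>
    refine ochain_induction (oBdry V (n + 1) ∘ₗ oBdry V (n + 2)) 0 (fun w => ?_) c
    rw [← Fin.cons_self_tail w, ← oCone_of]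
    simp only [LinearMap.comp_apply, oBdry_cone, map_sub, ih, map_zero, sub_zero, sub_self,
      LinearMap.zero_apply]

theorem oBdry_oMap (f : V → W) (n : ℕ) (c : OChain V (n + 1)) :
    oBdry W n (oMap f (n + 1) c) = oMap f n (oBdry V n c) := by
  refine ochain_induction (oBdry W n ∘ₗ oMap f (n + 1)) (oMap f n ∘ₗ oBdry V n) (fun w => ?_) c
  simp only [LinearMap.comp_apply, oMap_of, oBdry_of, map_sum, map_smul]
  rfl

theorem oCone_oMap (f : V → W) (p : V) (n : ℕ) (c : OChain V n) :
    oMap f (n + 1) (oCone p n c) = oCone (f p) n (oMap f n c) := by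
  refine ochain_induction (oMap f (n + 1) ∘ₗ oCone p n) (oCone (f p) n ∘ₗ oMap f n)
    (fun w => ?_) c
  simp only [LinearMap.comp_apply, oMap_of, oCone_of]
  congr 1
  funext k
  refine Fin.cases ?_ (fun k => ?_) k <;> simp

theorem oMap_zero_eq (f g : V → W) (c : OChain V 0) : oMap f 0 c = oMap g 0 c := by
  refine ochain_induction (oMap f 0) (oMap g 0) (fun w => ?_) c
  simp only [oMap_of]
  congr 1
  exact Subsingleton.elim _ _

/-- A chain homotopy between two maps of ordered chains, built by coning. -/
def oHtpy (f g : ∀ n, OChain V n →ₗ[ℤ] OChain W n) (p : ∀ n, (Fin (n + 1) → V) → W) :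
    ∀ n, OChain V n →ₗ[ℤ] OChain W (n + 1)
  | 0 => 0
  | n + 1 => Finsupp.linearCombination ℤ (fun w => oCone (p n w) (n + 1)
      (f (n + 1) (oOf w) - g (n + 1) (oOf w) - oHtpy f g p n (oBdry V n (oOf w))))

/-- The chain that `oHtpy` cones off is a cycle by induction, so the correction term in `oBdry_cone`
vanishes. The apexes are arbitrary; apart from being chain maps, `f` and `g` need only agree on the
empty simplex. -/
theorem oBdry_oHtpy (f g : ∀ n, OChain V n →ₗ[ℤ] OChain W n) (p : ∀ n, (Fin (n + 1) → V) → W)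
    (hf : ∀ n c, oBdry W n (f (n + 1) c) = f n (oBdry V n c))
    (hg : ∀ n c, oBdry W n (g (n + 1) c) = g n (oBdry V n c))
    (h0 : ∀ c, f 0 c = g 0 c) (n : ℕ) (c : OChain V (n + 1)) :
    oBdry W (n + 1) (oHtpy f g p (n + 1) c) =
      f (n + 1) c - g (n + 1) c - oHtpy f g p n (oBdry V n c) := by
  induction n with
  | zero =>
    refine ochain_induction (oBdry W 1 ∘ₗ oHtpy f g p 1)
      (f 1 - g 1 - oHtpy f g p 0 ∘ₗ oBdry V 0) (fun w => ?_) c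
    simp only [LinearMap.comp_apply, oHtpy, Finsupp.linearCombination_single, one_smul,
      LinearMap.sub_apply, oBdry_cone, map_sub, hf, hg, h0]
    simp
  | succ n ih =>
    refine ochain_induction (oBdry W (n + 2) ∘ₗ oHtpy f g p (n + 2))
      (f (n + 2) - g (n + 2) - oHtpy f g p (n + 1) ∘ₗ oBdry V (n + 1)) (fun w => ?_) c
    rw [LinearMap.comp_apply, oHtpy]
    simp only [Finsupp.linearCombination_single, one_smul,
      LinearMap.sub_apply, LinearMap.comp_apply, oBdry_cone, map_sub, hf, hg, ih, oBdry_oBdry,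
      map_zero, sub_zero]
    abel

/-- Coning commutes with maps of vertices, so natural apexes give a natural homotopy. This lets
homotopies on standard simplices fit together along faces into operators on singular chains. -/
theorem oMap_oHtpy {f g : ∀ n, OChain V n →ₗ[ℤ] OChain W n} {p : ∀ n, (Fin (n + 1) → V) → W}
    {f' g' : ∀ n, OChain V' n →ₗ[ℤ] OChain W' n} {p' : ∀ n, (Fin (n + 1) → V') → W'}
    (α : V → V') (β : W → W')
    (hf : ∀ n c, oMap β n (f n c) = f' n (oMap α n c))
    (hg : ∀ n c, oMap β n (g n c) = g' n (oMap α n c))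
    (hp : ∀ n w, β (p n w) = p' n (α ∘ w)) (n : ℕ) (c : OChain V n) :
    oMap β (n + 1) (oHtpy f g p n c) = oHtpy f' g' p' n (oMap α n c) := by
  induction n with
  | zero => simp [oHtpy]
  | succ n ih =>
    refine ochain_induction (oMap β (n + 2) ∘ₗ oHtpy f g p (n + 1))
      (oHtpy f' g' p' (n + 1) ∘ₗ oMap α (n + 1)) (fun w => ?_) c
    simp only [LinearMap.comp_apply, oHtpy, Finsupp.linearCombination_single, one_smul,
      oMap_of, oCone_oMap, map_sub, hf, hg, hp, ih, ← oBdry_oMap]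

/-- Subdivision of ordered chains, for a choice `b` of the barycenters. -/
def oSd (b : ∀ n, (Fin (n + 1) → V) → V) : ∀ n, OChain V n →ₗ[ℤ] OChain V n
  | 0 => LinearMap.id
  | n + 1 => Finsupp.linearCombination ℤ
      (fun w => oCone (b n w) n (oSd b n (oBdry V n (oOf w))))

theorem oSd_of (b : ∀ n, (Fin (n + 1) → V) → V) {n : ℕ} (w : Fin (n + 1) → V) :
    oSd b (n + 1) (oOf w) = oCone (b n w) n (oSd b n (oBdry V n (oOf w))) := by
  simp [oSd]

theorem oBdry_oSd (b : ∀ n, (Fin (n + 1) → V) → V) (n : ℕ) (c : OChain V (n + 1)) :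
    oBdry V n (oSd b (n + 1) c) = oSd b n (oBdry V n c) := by
  induction n with
  | zero =>
    refine ochain_induction (oBdry V 0 ∘ₗ oSd b 1) (oSd b 0 ∘ₗ oBdry V 0) (fun w => ?_) c
    rw [LinearMap.comp_apply, oSd_of, oBdry_cone_zero, LinearMap.comp_apply]
  | succ n ih =>
    refine ochain_induction (oBdry V (n + 1) ∘ₗ oSd b (n + 2))
      (oSd b (n + 1) ∘ₗ oBdry V (n + 1)) (fun w => ?_) c
    rw [LinearMap.comp_apply, oSd_of, oBdry_cone, ih, oBdry_oBdry, map_zero, map_zero, sub_zero,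
      LinearMap.comp_apply]

theorem oMap_oSd {b : ∀ n, (Fin (n + 1) → V) → V} {b' : ∀ n, (Fin (n + 1) → W) → W} (α : V → W)
    (hb : ∀ n w, α (b n w) = b' n (α ∘ w)) (n : ℕ) (c : OChain V n) :
    oMap α n (oSd b n c) = oSd b' n (oMap α n c) := by
  induction n with
  | zero => rfl
  | succ n ih =>
    refine ochain_induction (oMap α (n + 1) ∘ₗ oSd b (n + 1))
      (oSd b' (n + 1) ∘ₗ oMap α (n + 1)) (fun w => ?_) c
    simp only [LinearMap.comp_apply, oSd_of, oMap_of, oCone_oMap, hb, ih, ← oBdry_oMap]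

/-- Iterated subdivision. -/
def oSdPow (b : ∀ n, (Fin (n + 1) → V) → V) (k : ℕ) (n : ℕ) : OChain V n →ₗ[ℤ] OChain V n :=
  (oSd b n) ^ k

theorem oBdry_oSdPow (b : ∀ n, (Fin (n + 1) → V) → V) (k n : ℕ) (c : OChain V (n + 1)) :
    oBdry V n (oSdPow b k (n + 1) c) = oSdPow b k n (oBdry V n c) := by
  induction k with
  | zero => rfl
  | succ k ih =>
    simp only [oSdPow] at ih
    simp only [oSdPow, pow_succ', Module.End.mul_apply, oBdry_oSd, ih]

theorem oMap_oSdPow {b : ∀ n, (Fin (n + 1) → V) → V} {b' : ∀ n, (Fin (n + 1) → W) → W} (α : V → W)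
    (hb : ∀ n w, α (b n w) = b' n (α ∘ w)) (k n : ℕ) (c : OChain V n) :
    oMap α n (oSdPow b k n c) = oSdPow b' k n (oMap α n c) := by
  induction k with
  | zero => rfl
  | succ k ih =>
    simp only [oSdPow] at ih
    simp only [oSdPow, pow_succ', Module.End.mul_apply, oMap_oSd α hb, ih]

theorem oSdPow_zero_eq (b : ∀ n, (Fin (n + 1) → V) → V) (k : ℕ) (c : OChain V 0) :
    oSdPow b k 0 c = c := by
  simp only [oSdPow, oSd]
  rw [show (LinearMap.id : OChain V 0 →ₗ[ℤ] OChain V 0) = 1 from rfl, one_pow]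
  rfl

end Ordered

/-! ### Affine simplices -/

/-- The standard `n`-simplex. -/
abbrev Simp (n : ℕ) : Type := stdSimplex ℝ (Fin (n + 1))

/-- The inclusion of the `i`-th face. -/
def faceMap {n : ℕ} (i : Fin (n + 2)) : C(Simp n, Simp (n + 1)) :=
  ⟨stdSimplex.map i.succAbove, stdSimplex.continuous_map _⟩

/-- Spaces with affine simplices on any finite sequence of vertices. -/
class HasAff (V : Type*) [TopologicalSpace V] where
  /-- the affine simplex with vertices `w` -/
  aff {n : ℕ} (w : Fin (n + 1) → V) : C(Simp n, V)
  aff_face {n : ℕ} (i : Fin (n + 2)) (w : Fin (n + 2) → V) :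
    (aff w).comp (faceMap i) = aff (w ∘ i.succAbove)

open HasAff

section Affine

theorem sum_map_mul {m n : ℕ} (f : Fin m → Fin n) (t : stdSimplex ℝ (Fin m)) (c : Fin n → ℝ) :
    ∑ j, stdSimplex.map f t j * c j = ∑ i, t i * c (f i) := by
  simp only [stdSimplex.map_coe, FunOnFinite.linearMap_apply_apply, Finset.sum_mul]
  rw [← Finset.sum_fiberwise Finset.univ f]
  refine Finset.sum_congr rfl fun j _ => Finset.sum_congr rfl fun i hi => ?_
  rw [(Finset.mem_filter.1 hi).2]

instance (m : ℕ) : HasAff (stdSimplex ℝ (Fin m)) where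
  aff w := 
    { toFun := fun t => ⟨fun j => ∑ i, t i * w i j, by
        refine ⟨fun j => Finset.sum_nonneg fun i _ => mul_nonneg (t.2.1 i) ((w i).2.1 j), ?_⟩
        rw [Finset.sum_comm]
        have : ∀ i, ∑ j, t i * w i j = t i := fun i => by
          rw [← Finset.mul_sum, stdSimplex.sum_eq_one, mul_one]
        simp only [this, stdSimplex.sum_eq_one]⟩
      continuous_toFun := by
        refine Continuous.subtype_mk (continuous_pi fun j => continuous_finsetSum _ fun i _ => ?_) _
        exact ((continuous_apply i).comp continuous_subtype_val).mul continuous_const }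
  aff_face i w := by
    ext t j
    exact sum_map_mul _ _ _

/-- The product of a simplex with `Simp 1` needs affine simplices for the triangulation of prisms.
-/
instance (V W : Type*) [TopologicalSpace V] [TopologicalSpace W] [HasAff V] [HasAff W] :
    HasAff (V × W) where
  aff w := (aff (fun i => (w i).1)).prodMk (aff (fun i => (w i).2))
  aff_face i w := by
    have h1 := HasAff.aff_face i (fun k => (w k).1)
    have h2 := HasAff.aff_face i (fun k => (w k).2)
    ext1 t
    exact Prod.ext (DFunLike.congr_fun h1 t) (DFunLike.congr_fun h2 t)

theorem aff_apply {m n : ℕ} (w : Fin (n + 1) → stdSimplex ℝ (Fin m)) (t : Simp n) (j : Fin m) :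
    aff w t j = ∑ i, t i * w i j := rfl

/-- The vertices of the standard simplex. -/
def vtx (n : ℕ) : Fin (n + 1) → Simp n := fun i => stdSimplex.vertex i

theorem aff_vtx_apply (n : ℕ) (t : Simp n) : aff (vtx n) t = t := by
  ext j
  change ∑ i, t i * (stdSimplex.vertex i : Simp n) j = t j
  rw [Finset.sum_eq_single j]
  · simp [stdSimplex.vertex_coe]
  · intro i _ hi
    simp [stdSimplex.vertex_coe, hi.symm]
  · simp

theorem aff_vtx (n : ℕ) : aff (vtx n) = ContinuousMap.id _ :=
  ContinuousMap.ext (aff_vtx_apply n)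

theorem aff_apply_vtx {m n : ℕ} (w : Fin (n + 1) → stdSimplex ℝ (Fin m)) (i : Fin (n + 1)) :
    aff w (vtx n i) = w i := by
  ext j
  change ∑ k, (stdSimplex.vertex i : Simp n) k * w k j = w i j
  rw [Finset.sum_eq_single i]
  · simp [stdSimplex.vertex_coe]
  · intro k _ hk
    simp [stdSimplex.vertex_coe, hk]
  · simp

theorem faceMap_vtx {n : ℕ} (i : Fin (n + 2)) : faceMap i ∘ vtx n = vtx (n + 1) ∘ i.succAbove := by
  funext k
  exact stdSimplex.map_vertex _ _

theorem faceMap_eq {n : ℕ} (i : Fin (n + 2)) : faceMap i = aff (vtx (n + 1) ∘ i.succAbove) := by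
  rw [← HasAff.aff_face, aff_vtx, ContinuousMap.id_comp]

/-- Affine simplices in the standard simplex compose. -/
theorem aff_aff {l m n : ℕ} (w : Fin (n + 1) → stdSimplex ℝ (Fin m))
    (v : Fin (l + 1) → Simp n) :
    (aff w).comp (aff v) = aff (aff w ∘ v) := by
  ext t j
  change ∑ i, (∑ k, t k * v k i) * w i j = ∑ k, t k * (∑ i, v k i * w i j)
  simp only [Finset.sum_mul, Finset.mul_sum]
  rw [Finset.sum_comm]
  simp only [mul_assoc]

theorem faceMap_aff {l n : ℕ} (i : Fin (n + 2)) (v : Fin (l + 1) → Simp n) :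
    (faceMap i).comp (aff v) = aff (faceMap i ∘ v) := by
  rw [faceMap_eq, aff_aff]

end Affine

/-! ### Realization of ordered chains -/

section Realization

variable {V W : Type*} [TopologicalSpace V] [HasAff V] [TopologicalSpace W] [HasAff W]
  {Y Y' : Type*} [TopologicalSpace Y] [TopologicalSpace Y']

/-- Integral singular chains. -/
abbrev SChain (Y : Type*) [TopologicalSpace Y] (n : ℕ) : Type _ := SingSimplex Y n →₀ ℤ

/-- A singular simplex as a chain. -/
abbrev sOf {n : ℕ} (σ : SingSimplex Y n) : SChain Y n := Finsupp.single σ 1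

theorem schain_induction {n : ℕ} {M : Type*} [AddCommGroup M] (f g : SChain Y n →ₗ[ℤ] M)
    (h : ∀ σ, f (sOf σ) = g (sOf σ)) (c : SChain Y n) : f c = g c := by
  have : f = g := by
    ext σ : 1
    ext : 1
    exact h σ
  rw [this]

theorem singBdryInt_of {n : ℕ} (σ : SingSimplex Y (n + 1)) :
    singBdryInt Y n (sOf σ) = ∑ i : Fin (n + 2), (-1 : ℤ) ^ (i : ℕ) • sOf (face i σ) := by
  simp [singBdryInt]

/-- The map on singular chains induced by a continuous map. -/
def sMap (f : C(Y, Y')) (n : ℕ) : SChain Y n →ₗ[ℤ] SChain Y' n :=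
  Finsupp.lmapDomain ℤ ℤ (fun σ => f.comp σ)

@[simp] theorem sMap_of (f : C(Y, Y')) {n : ℕ} (σ : SingSimplex Y n) :
    sMap f n (sOf σ) = sOf (f.comp σ) := by
  simp [sMap]

theorem face_comp (f : C(Y, Y')) {n : ℕ} (i : Fin (n + 2)) (σ : SingSimplex Y (n + 1)) :
    face i (f.comp σ) = f.comp (face i σ) := rfl

theorem face_eq {n : ℕ} (i : Fin (n + 2)) (σ : SingSimplex Y (n + 1)) :
    face i σ = σ.comp (faceMap i) := rfl

theorem singBdryInt_sMap (f : C(Y, Y')) (n : ℕ) (c : SChain Y (n + 1)) :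
    singBdryInt Y' n (sMap f (n + 1) c) = sMap f n (singBdryInt Y n c) := by
  refine schain_induction (singBdryInt Y' n ∘ₗ sMap f (n + 1)) (sMap f n ∘ₗ singBdryInt Y n)
    (fun σ => ?_) c
  simp only [LinearMap.comp_apply, sMap_of, singBdryInt_of, map_sum, map_smul, face_comp]

/-- The singular chain obtained from an ordered chain in `V` by a map `g` from `V`. -/
def oReal (g : C(V, Y)) (n : ℕ) : OChain V (n + 1) →ₗ[ℤ] SChain Y n :=
  Finsupp.lmapDomain ℤ ℤ (fun w => g.comp (aff w))

@[simp] theorem oReal_of (g : C(V, Y)) {n : ℕ} (w : Fin (n + 1) → V) :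
    oReal g n (oOf w) = sOf (g.comp (aff w)) := by
  simp [oReal]

/-- Since restricting an affine simplex to a face deletes a vertex, identities between ordered
chains carry over to singular chains. -/
theorem singBdryInt_oReal (g : C(V, Y)) (n : ℕ) (c : OChain V (n + 2)) :
    singBdryInt Y n (oReal g (n + 1) c) = oReal g n (oBdry V (n + 1) c) := by
  refine ochain_induction (singBdryInt Y n ∘ₗ oReal g (n + 1)) (oReal g n ∘ₗ oBdry V (n + 1))
    (fun w => ?_) c
  simp only [LinearMap.comp_apply, oReal_of, singBdryInt_of, oBdry_of, map_sum, map_smul,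
    face_eq, ContinuousMap.comp_assoc, HasAff.aff_face]

theorem oReal_comp (g : C(W, Y)) (φ : C(V, W))
    (hφ : ∀ {n : ℕ} (w : Fin (n + 1) → V), φ.comp (aff w) = aff (φ ∘ w)) (n : ℕ)
    (c : OChain V (n + 1)) : oReal (g.comp φ) n c = oReal g n (oMap φ (n + 1) c) := by
  refine ochain_induction (oReal (g.comp φ) n) (oReal g n ∘ₗ oMap φ (n + 1)) (fun w => ?_) c
  simp only [LinearMap.comp_apply, oReal_of, oMap_of, ContinuousMap.comp_assoc, hφ]

/-- The chains all of whose simplices satisfy `Q`. -/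
abbrev supp {n : ℕ} (Q : Set (SingSimplex Y n)) : Submodule ℤ (SChain Y n) :=
  Finsupp.supported ℤ ℤ Q

theorem supp_induction {n : ℕ} {M : Type*} [AddCommGroup M] {Q : Set (SingSimplex Y n)}
    (f : SChain Y n →ₗ[ℤ] M) (N : Submodule ℤ M) (h : ∀ σ ∈ Q, f (sOf σ) ∈ N) {c : SChain Y n}
    (hc : c ∈ supp Q) : f c ∈ N := by
  rw [supp, Finsupp.supported_eq_span_single] at hc
  have : Submodule.span ℤ ((fun i => Finsupp.single i (1 : ℤ)) '' Q) ≤ N.comap f := by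
    rw [Submodule.span_le]
    rintro _ ⟨σ, hσ, rfl⟩
    exact h σ hσ
  exact this hc

theorem sOf_mem_supp {n : ℕ} {Q : Set (SingSimplex Y n)} {σ : SingSimplex Y n} (h : σ ∈ Q) :
    sOf σ ∈ supp Q := Finsupp.single_mem_supported ℤ _ h

theorem oReal_mem_supp (g : C(V, Y)) {n : ℕ} {Q : Set (SingSimplex Y n)}
    {c : OChain V (n + 1)} (h : ∀ w ∈ c.support, g.comp (aff w) ∈ Q) : oReal g n c ∈ supp Q := by
  rw [← Finsupp.sum_single c, Finsupp.sum, map_sum]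
  refine Submodule.sum_mem _ fun w hw => ?_
  rw [← mul_one (c w), ← smul_eq_mul, ← Finsupp.smul_single, map_smul]
  refine Submodule.smul_mem _ _ ?_
  rw [oReal_of]
  exact sOf_mem_supp (h w hw)

/-- The simplices in the subset `S`. -/
def simpIn (S : Set Y) (n : ℕ) : Set (SingSimplex Y n) := {σ | range σ ⊆ S}

theorem mem_simpIn {S : Set Y} {n : ℕ} {σ : SingSimplex Y n} : σ ∈ simpIn S n ↔ ∀ x, σ x ∈ S := by
  simp [simpIn, range_subset_iff]

theorem singBdryInt_mem_supp {n : ℕ} {Q : Set (SingSimplex Y (n + 1))}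
    {Q' : Set (SingSimplex Y n)} (h : ∀ σ ∈ Q, ∀ i, face i σ ∈ Q') {c : SChain Y (n + 1)}
    (hc : c ∈ supp Q) : singBdryInt Y n c ∈ supp Q' := by
  refine supp_induction _ _ (fun σ hσ => ?_) hc
  rw [singBdryInt_of]
  exact Submodule.sum_mem _ fun i _ => Submodule.smul_mem _ _ (sOf_mem_supp (h σ hσ i))

theorem sMap_mem_supp (f : C(Y, Y')) {n : ℕ} {Q : Set (SingSimplex Y n)}
    {Q' : Set (SingSimplex Y' n)} (h : ∀ σ ∈ Q, f.comp σ ∈ Q') {c : SChain Y n}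
    (hc : c ∈ supp Q) : sMap f n c ∈ supp Q' := by
  refine supp_induction _ _ (fun σ hσ => ?_) hc
  rw [sMap_of]
  exact sOf_mem_supp (h σ hσ)

end Realization

/-! ### Subdivision of singular chains -/

section Subdivision

variable {Y Y' : Type*} [TopologicalSpace Y] [TopologicalSpace Y']

/-- The barycenter of vertices in a standard simplex. -/
def bary {m : ℕ} (n : ℕ) (w : Fin (n + 1) → stdSimplex ℝ (Fin m)) : stdSimplex ℝ (Fin m) :=
  aff w stdSimplex.barycenter

theorem faceMap_bary {m : ℕ} (i : Fin (m + 2)) (n : ℕ) (w : Fin (n + 1) → Simp m) :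
    faceMap i (bary n w) = bary n (faceMap i ∘ w) :=
  DFunLike.congr_fun (faceMap_aff i w) _

/-- Iterated barycentric subdivision of singular chains. -/
def sSd (Y : Type*) [TopologicalSpace Y] (k n : ℕ) : SChain Y n →ₗ[ℤ] SChain Y n :=
  Finsupp.linearCombination ℤ (fun σ => oReal σ n (oSdPow bary k (n + 1) (oOf (vtx n))))

theorem sSd_of (k : ℕ) {n : ℕ} (σ : SingSimplex Y n) :
    sSd Y k n (sOf σ) = oReal σ n (oSdPow bary k (n + 1) (oOf (vtx n))) := by
  simp [sSd]

/-- The chain homotopy between iterated subdivision and the identity. -/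
def sSdHtpy (Y : Type*) [TopologicalSpace Y] (k n : ℕ) : SChain Y n →ₗ[ℤ] SChain Y (n + 1) :=
  Finsupp.linearCombination ℤ (fun σ => oReal σ (n + 1)
    (oHtpy (oSdPow bary k) (fun _ => LinearMap.id) bary (n + 1) (oOf (vtx n))))

theorem sSdHtpy_of (k : ℕ) {n : ℕ} (σ : SingSimplex Y n) :
    sSdHtpy Y k n (sOf σ) = oReal σ (n + 1)
      (oHtpy (oSdPow bary k) (fun _ => LinearMap.id) bary (n + 1) (oOf (vtx n))) := by
  simp [sSdHtpy]

theorem oBdry_vtx (n : ℕ) : oBdry (Simp (n + 1)) (n + 1) (oOf (vtx (n + 1))) =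
    ∑ i : Fin (n + 2), (-1 : ℤ) ^ (i : ℕ) • oMap (faceMap i) (n + 1) (oOf (vtx n)) := by
  simp only [oBdry_of, oMap_of, faceMap_vtx]

theorem singBdryInt_sSd (k n : ℕ) (c : SChain Y (n + 1)) :
    singBdryInt Y n (sSd Y k (n + 1) c) = sSd Y k n (singBdryInt Y n c) := by
  refine schain_induction (singBdryInt Y n ∘ₗ sSd Y k (n + 1)) (sSd Y k n ∘ₗ singBdryInt Y n)
    (fun σ => ?_) c
  simp only [LinearMap.comp_apply, sSd_of, singBdryInt_of, map_sum, map_smul, singBdryInt_oReal,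
    oBdry_oSdPow, oBdry_vtx, face_eq]
  refine Finset.sum_congr rfl fun i _ => ?_
  rw [oReal_comp _ _ (faceMap_aff i), oMap_oSdPow _ (faceMap_bary i)]

/-- The homotopy of the universal simplex is transported along each singular simplex; naturality
under `faceMap` identifies its boundary part with the operator applied to the faces. -/
theorem singBdryInt_sSdHtpy (k n : ℕ) (c : SChain Y (n + 1)) :
    singBdryInt Y (n + 1) (sSdHtpy Y k (n + 1) c) =
      sSd Y k (n + 1) c - c - sSdHtpy Y k n (singBdryInt Y n c) := by
  refine schain_induction (singBdryInt Y (n + 1) ∘ₗ sSdHtpy Y k (n + 1))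
    (sSd Y k (n + 1) - LinearMap.id - sSdHtpy Y k n ∘ₗ singBdryInt Y n) (fun σ => ?_) c
  simp only [LinearMap.comp_apply, LinearMap.sub_apply, LinearMap.id_apply, sSdHtpy_of, sSd_of,
    singBdryInt_of, map_sum, map_smul, singBdryInt_oReal]
  rw [oBdry_oHtpy _ _ _ (oBdry_oSdPow _ k) (fun _ _ => rfl) (oSdPow_zero_eq _ k)]
  rw [map_sub, map_sub, oBdry_vtx]
  congr 1
  · congr 1
    rw [LinearMap.id_apply, oReal_of, aff_vtx, ContinuousMap.comp_id]
  · simp only [map_sum, map_smul, face_eq]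
    refine Finset.sum_congr rfl fun i _ => ?_
    rw [oReal_comp _ _ (faceMap_aff i)]
    congr 2
    refine (oMap_oHtpy _ _ (oMap_oSdPow _ (faceMap_bary i) k) (fun _ _ => rfl)
      (faceMap_bary i) _ _).symm

theorem sSd_mem_supp (k : ℕ) {n : ℕ} {S : Set Y} {c : SChain Y n} (hc : c ∈ supp (simpIn S n)) :
    sSd Y k n c ∈ supp (simpIn S n) := by
  refine supp_induction _ _ (fun σ hσ => ?_) hc
  rw [sSd_of]
  refine oReal_mem_supp _ fun w _ => ?_
  rw [mem_simpIn] at hσ ⊢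
  exact fun x => hσ _

theorem sSdHtpy_mem_supp (k : ℕ) {n : ℕ} {S : Set Y} {c : SChain Y n}
    (hc : c ∈ supp (simpIn S n)) : sSdHtpy Y k n c ∈ supp (simpIn S (n + 1)) := by
  refine supp_induction _ _ (fun σ hσ => ?_) hc
  rw [sSdHtpy_of]
  refine oReal_mem_supp _ fun w _ => ?_
  rw [mem_simpIn] at hσ ⊢
  exact fun x => hσ _

end Subdivision

/-! ### The prism operator -/

section Prism

variable {Y : Type*} [TopologicalSpace Y]

/-- The two ends of the standard `1`-simplex, which parametrizes homotopies. -/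
abbrev endpt (i : Fin 2) : Simp 1 := stdSimplex.vertex i

/-- The inclusion of the two ends of the cylinder. -/
def cylEnd (X : Type*) [TopologicalSpace X] (i : Fin 2) : C(X, X × Simp 1) :=
  (ContinuousMap.id X).prodMk (ContinuousMap.const X (endpt i))

theorem aff_const {m n : ℕ} (x : stdSimplex ℝ (Fin m)) :
    aff (fun _ : Fin (n + 1) => x) = ContinuousMap.const _ x := by
  ext t j
  change ∑ i, t i * x j = x j
  rw [← Finset.sum_mul, stdSimplex.sum_eq_one, one_mul]

theorem cylEnd_aff {m n : ℕ} (i : Fin 2) (w : Fin (n + 1) → Simp m) :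
    (cylEnd (Simp m) i).comp (aff w) = aff (cylEnd (Simp m) i ∘ w) := by
  ext1 t
  refine Prod.ext rfl ?_
  exact (DFunLike.congr_fun (aff_const (n := n) (endpt i)) t).symm

/-- The ordered chain that triangulates a prism. -/
def oPrism (m : ℕ) (n : ℕ) : OChain (Simp m) n →ₗ[ℤ] OChain (Simp m × Simp 1) (n + 1) :=
  oHtpy (oMap (cylEnd _ 1)) (oMap (cylEnd _ 0)) (fun _ w => cylEnd _ 0 (w 0)) n

/-- The prism operator of a family of homotopies, one for each simplex. -/
def sPrism (G : ∀ n, SingSimplex Y n → C(Simp n × Simp 1, Y)) (n : ℕ) :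
    SChain Y n →ₗ[ℤ] SChain Y (n + 1) :=
  Finsupp.linearCombination ℤ (fun σ => oReal (G n σ) (n + 1) (oPrism n (n + 1) (oOf (vtx n))))

theorem sPrism_of (G : ∀ n, SingSimplex Y n → C(Simp n × Simp 1, Y)) {n : ℕ}
    (σ : SingSimplex Y n) :
    sPrism G n (sOf σ) = oReal (G n σ) (n + 1) (oPrism n (n + 1) (oOf (vtx n))) := by
  simp [sPrism]

/-- The end of a family of homotopies, as a map on chains. -/
def sEnd (G : ∀ n, SingSimplex Y n → C(Simp n × Simp 1, Y)) (i : Fin 2) (n : ℕ) :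
    SChain Y n →ₗ[ℤ] SChain Y n :=
  Finsupp.lmapDomain ℤ ℤ (fun σ => (G n σ).comp (cylEnd _ i))

@[simp] theorem sEnd_of (G : ∀ n, SingSimplex Y n → C(Simp n × Simp 1, Y)) (i : Fin 2) {n : ℕ}
    (σ : SingSimplex Y n) : sEnd G i n (sOf σ) = sOf ((G n σ).comp (cylEnd _ i)) := by
  simp [sEnd]

theorem prodMap_aff {m n : ℕ} (i : Fin (m + 2)) (w : Fin (n + 1) → Simp m × Simp 1) :
    ((faceMap i).prodMap (ContinuousMap.id (Simp 1))).comp (aff w) =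
      aff ((faceMap i).prodMap (ContinuousMap.id (Simp 1)) ∘ w) := by
  ext1 t
  refine Prod.ext ?_ rfl
  exact DFunLike.congr_fun (faceMap_aff i (fun k => (w k).1)) t

/-- The homotopies may be chosen simplex by simplex as long as `hG` matches them on faces; no
homotopy of the whole space is required. `labelHtpy` depends on this freedom. -/
theorem singBdryInt_sPrism (G : ∀ n, SingSimplex Y n → C(Simp n × Simp 1, Y))
    (hG : ∀ n i σ, G n (face i σ) = (G (n + 1) σ).comp ((faceMap i).prodMap (ContinuousMap.id _)))
    (n : ℕ) (c : SChain Y (n + 1)) :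
    singBdryInt Y (n + 1) (sPrism G (n + 1) c) =
      sEnd G 1 (n + 1) c - sEnd G 0 (n + 1) c - sPrism G n (singBdryInt Y n c) := by
  refine schain_induction (singBdryInt Y (n + 1) ∘ₗ sPrism G (n + 1))
    (sEnd G 1 (n + 1) - sEnd G 0 (n + 1) - sPrism G n ∘ₗ singBdryInt Y n) (fun σ => ?_) c
  simp only [LinearMap.comp_apply, LinearMap.sub_apply, sPrism_of, sEnd_of,
    singBdryInt_of, map_sum, map_smul, singBdryInt_oReal]
  have hz : ∀ c : OChain (Simp (n + 1)) 0,
      oMap (cylEnd (Simp (n + 1)) 1) 0 c = oMap (cylEnd (Simp (n + 1)) 0) 0 c :=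
    oMap_zero_eq _ _
  rw [oPrism, oBdry_oHtpy _ _ _ (oBdry_oMap _) (oBdry_oMap _) hz]
  rw [map_sub, map_sub, oBdry_vtx]
  congr 1
  · congr 1
    · rw [← oReal_comp _ _ (cylEnd_aff 1), oReal_of, aff_vtx, ContinuousMap.comp_id]
    · rw [← oReal_comp _ _ (cylEnd_aff 0), oReal_of, aff_vtx, ContinuousMap.comp_id]
  · simp only [map_sum, map_smul, hG]
    refine Finset.sum_congr rfl fun i _ => ?_
    rw [oReal_comp _ _ (prodMap_aff i), oPrism]
    congr 2
    refine (oMap_oHtpy _ _ (fun n c => ?_) (fun n c => ?_) (fun _ _ => rfl) _ _).symm <;>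
    · refine ochain_induction (oMap _ n ∘ₗ oMap _ n) (oMap _ n ∘ₗ oMap _ n) (fun w => ?_) c
      simp only [LinearMap.comp_apply, oMap_of]
      rfl

theorem sPrism_mem_supp (G : ∀ n, SingSimplex Y n → C(Simp n × Simp 1, Y)) {n : ℕ} {S : Set Y}
    {Q : Set (SingSimplex Y n)} (h : ∀ σ ∈ Q, ∀ x, G n σ x ∈ S) {c : SChain Y n}
    (hc : c ∈ supp Q) : sPrism G n c ∈ supp (simpIn S (n + 1)) := by
  refine supp_induction _ _ (fun σ hσ => ?_) hc
  rw [sPrism_of]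
  refine oReal_mem_supp _ fun w _ => ?_
  rw [mem_simpIn]
  exact fun x => h σ hσ _

end Prism

end AbCover
end

noncomputable section
namespace AbCover
open HasAff

/-! ### Small simplices -/

section Small

variable {m : ℕ}

theorem dist_aff_le {n : ℕ} (w : Fin (n + 1) → stdSimplex ℝ (Fin m)) (t : Simp n)
    (x : stdSimplex ℝ (Fin m)) {r : ℝ} (hr : 0 ≤ r) (h : ∀ i, dist (w i) x ≤ r) :
    dist (aff w t) x ≤ r := by
  rw [Subtype.dist_eq, dist_pi_le_iff hr]
  intro j
  have hx : x.1 j = ∑ i, t i * x.1 j := by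
    rw [← Finset.sum_mul, stdSimplex.sum_eq_one, one_mul]
  change |(∑ i, t i * (w i).1 j) - x.1 j| ≤ r
  rw [hx, ← Finset.sum_sub_distrib]
  refine (Finset.abs_sum_le_sum_abs _ _).trans ?_
  calc ∑ i, |t i * (w i).1 j - t i * x.1 j| ≤ ∑ i, t i * r := by
        refine Finset.sum_le_sum fun i _ => ?_
        rw [← mul_sub, abs_mul, abs_of_nonneg (stdSimplex.zero_le t i)]
        refine mul_le_mul_of_nonneg_left ?_ (stdSimplex.zero_le t i)
        exact (dist_le_pi_dist (w i).1 x.1 j).trans (h i)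
    _ = r := by rw [← Finset.sum_mul, stdSimplex.sum_eq_one, one_mul]

/-- The `k`-th vertex cancels in the difference from the barycenter, leaving `n` of the `n + 1`
equal weights: this is the contraction factor. -/
theorem dist_bary_le {n : ℕ} (w : Fin (n + 1) → stdSimplex ℝ (Fin m)) {d : ℝ} (hd : 0 ≤ d)
    (h : ∀ i j, dist (w i) (w j) ≤ d) (k : Fin (n + 1)) :
    dist (w k) (bary n w) ≤ n / (n + 1) * d := by
  have hn : (0 : ℝ) < n + 1 := by positivity
  rw [Subtype.dist_eq, dist_pi_le_iff (by positivity)]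
  intro j
  change |(w k).1 j - ∑ i, (stdSimplex.barycenter : Simp n) i * (w i).1 j| ≤ _
  have hb : ∀ i, (stdSimplex.barycenter : Simp n) i = 1 / (n + 1) := fun i => by
    simp [stdSimplex.barycenter, DFunLike.coe]
  have hx : (w k).1 j = ∑ i : Fin (n + 1), (1 / ((n : ℝ) + 1)) * (w k).1 j := by
    rw [Finset.sum_const, Finset.card_univ, Fintype.card_fin, nsmul_eq_mul]
    push_cast
    field_simp
  rw [hx, ← Finset.sum_sub_distrib, ← Finset.add_sum_erase _ _ (Finset.mem_univ k)]
  simp only [hb, sub_self, zero_add]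
  refine (Finset.abs_sum_le_sum_abs _ _).trans ?_
  calc ∑ i ∈ Finset.univ.erase k, |1 / ((n : ℝ) + 1) * (w k).1 j - 1 / ((n : ℝ) + 1) * (w i).1 j|
      ≤ ∑ i ∈ Finset.univ.erase k, 1 / ((n : ℝ) + 1) * d := by
        refine Finset.sum_le_sum fun i _ => ?_
        rw [← mul_sub, abs_mul, abs_of_nonneg (by positivity)]
        refine mul_le_mul_of_nonneg_left ?_ (by positivity)
        exact (dist_le_pi_dist (w k).1 (w i).1 j).trans (h k i)
    _ = n / (n + 1) * d := by
        rw [Finset.sum_const, Finset.card_erase_of_mem (Finset.mem_univ k), Finset.card_univ,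
          Fintype.card_fin, nsmul_eq_mul, Nat.add_sub_cancel]
        ring

theorem osupp_induction {V : Type*} {n : ℕ} {M : Type*} [AddCommGroup M] {Q : Set (Fin n → V)}
    (f : OChain V n →ₗ[ℤ] M) (N : Submodule ℤ M) (h : ∀ w ∈ Q, f (oOf w) ∈ N) {c : OChain V n}
    (hc : c ∈ Finsupp.supported ℤ ℤ Q) : f c ∈ N := by
  rw [Finsupp.supported_eq_span_single] at hc
  have : Submodule.span ℤ ((fun i => Finsupp.single i (1 : ℤ)) '' Q) ≤ N.comap f := by
    rw [Submodule.span_le]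
    rintro _ ⟨σ, hσ, rfl⟩
    exact h σ hσ
  exact this hc

theorem oSd_near {n : ℕ} (w : Fin n → stdSimplex ℝ (Fin m)) (x : stdSimplex ℝ (Fin m)) {r : ℝ}
    (hr : 0 ≤ r) (h : ∀ i, dist (w i) x ≤ r) :
    oSd bary n (oOf w) ∈ Finsupp.supported ℤ ℤ {u | ∀ i, dist (u i) x ≤ r} := by
  induction n with
  | zero => exact Finsupp.single_mem_supported ℤ _ fun i => i.elim0
  | succ n ih =>
    rw [oSd_of, oBdry_of, map_sum]
    simp only [map_smul, map_sum]
    refine Submodule.sum_mem _ fun i _ => Submodule.smul_mem _ _ ?_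
    refine osupp_induction _ _ (fun u hu => ?_) (ih (w ∘ i.succAbove) fun _ => h _)
    rw [oCone_of]
    refine Finsupp.single_mem_supported ℤ _ fun k => ?_
    refine Fin.cases ?_ (fun k => ?_) k
    · exact dist_aff_le w _ x hr h
    · exact hu k

/-- A simplex of the subdivision joins a barycenter to a simplex of a subdivided face. `oSd_near`
bounds the distances to the barycenter, induction the others, and n/(n + 1) increases with n. -/
theorem oSd_mesh {n : ℕ} (w : Fin (n + 1) → stdSimplex ℝ (Fin m)) {d : ℝ}
    (hd : 0 ≤ d) (h : ∀ i j, dist (w i) (w j) ≤ d) :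
    oSd bary (n + 1) (oOf w) ∈
      Finsupp.supported ℤ ℤ {u | ∀ i j, dist (u i) (u j) ≤ n / (n + 1) * d} := by
  induction n with
  | zero =>
    rw [Finsupp.mem_supported]
    intro u _ i j
    rw [(Subsingleton.elim (α := Fin 1) i j : i = j), dist_self]
    positivity
  | succ n ih =>
    rw [oSd_of, oBdry_of, map_sum]
    simp only [map_smul, map_sum]
    refine Submodule.sum_mem _ fun i _ => Submodule.smul_mem _ _ ?_
    have h1 := ih (w ∘ i.succAbove) fun _ _ => h _ _
    have hb := dist_bary_le w hd h
    have h2 := oSd_near (w ∘ i.succAbove) (bary (n + 1) w) (by positivity) fun k => hb _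
    have h3 := Finsupp.supported_inter (R := ℤ) (M := ℤ) {u : Fin (n + 1) → stdSimplex ℝ (Fin m) |
      ∀ i j, dist (u i) (u j) ≤ n / (n + 1) * d} {u | ∀ i, dist (u i) (bary (n + 1) w) ≤
        ((n + 1 : ℕ) : ℝ) / ((n + 1 : ℕ) + 1) * d} ▸ Submodule.mem_inf.2 ⟨h1, h2⟩
    refine osupp_induction _ _ (fun u hu => ?_) h3
    rw [oCone_of]
    have hle : (n : ℝ) / (n + 1) * d ≤ ((n + 1 : ℕ) : ℝ) / ((n + 1 : ℕ) + 1) * d := by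
      refine mul_le_mul_of_nonneg_right ?_ hd
      rw [div_le_div_iff₀ (by positivity) (by positivity)]
      push_cast
      nlinarith
    refine Finsupp.single_mem_supported ℤ _ fun k l => ?_
    refine Fin.cases ?_ (fun k => ?_) k <;> refine Fin.cases ?_ (fun l => ?_) l
    · simp only [Fin.cons_zero, dist_self]
      positivity
    · simp only [Fin.cons_zero, Fin.cons_succ]
      rw [dist_comm]
      exact hu.2 l
    · simp only [Fin.cons_zero, Fin.cons_succ]
      exact hu.2 k
    · simp only [Fin.cons_succ]
      exact (hu.1 k l).trans hle

theorem oSdPow_mesh (k : ℕ) {n : ℕ} (w : Fin (n + 1) → stdSimplex ℝ (Fin m)) {d : ℝ}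
    (hd : 0 ≤ d) (h : ∀ i j, dist (w i) (w j) ≤ d) :
    oSdPow bary k (n + 1) (oOf w) ∈
      Finsupp.supported ℤ ℤ {u | ∀ i j, dist (u i) (u j) ≤ (n / (n + 1)) ^ k * d} := by
  induction k with
  | zero =>
    refine Finsupp.single_mem_supported ℤ _ fun i j => ?_
    simpa using h i j
  | succ k ih =>
    rw [pow_succ' ((n : ℝ) / (n + 1)), oSdPow, pow_succ' (oSd _ _), Module.End.mul_apply]
    refine osupp_induction _ _ (fun u hu => ?_) ih
    have := oSd_mesh u (by positivity) hu
    rwa [← mul_assoc] at this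

theorem dist_simp_le_one (x y : stdSimplex ℝ (Fin m)) : dist x y ≤ 1 := by
  rw [Subtype.dist_eq, dist_pi_le_iff zero_le_one]
  intro j
  rw [Real.dist_eq, abs_le]
  have h1 := stdSimplex.zero_le x j
  have h2 := stdSimplex.zero_le y j
  have h3 := stdSimplex.le_one x j
  have h4 := stdSimplex.le_one y j
  constructor
  · exact (by linarith : -1 ≤ x j - y j)
  · exact (by linarith : x j - y j ≤ 1)

theorem exists_oSdPow_small (n : ℕ) {δ : ℝ} (hδ : 0 < δ) : ∃ k₀, ∀ k ≥ k₀,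
    oSdPow bary k (n + 1) (oOf (vtx n)) ∈
      Finsupp.supported ℤ ℤ {u | ∀ i j, dist (u i) (u j) < δ} := by
  have h1 : (n : ℝ) / (n + 1) < 1 := by
    rw [div_lt_one (by positivity)]
    linarith
  obtain ⟨k₀, hk₀⟩ := exists_pow_lt_of_lt_one hδ h1
  refine ⟨k₀, fun k hk => ?_⟩
  refine Finsupp.supported_mono (fun u hu i j => ?_)
    (oSdPow_mesh k (vtx n) zero_le_one fun _ _ => dist_simp_le_one _ _)
  refine (hu i j).trans_lt ?_
  rw [mul_one]
  exact (pow_le_pow_of_le_one (by positivity) h1.le hk).trans_lt hk₀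

variable {Y : Type*} [TopologicalSpace Y]

/-- The simplices that lie in one of the sets of a cover. -/
def simpSub {ι : Type*} (U : ι → Set Y) (n : ℕ) : Set (SingSimplex Y n) :=
  {σ | ∃ i, ∀ x, σ x ∈ U i}

theorem face_mem_simpSub {ι : Type*} {U : ι → Set Y} {n : ℕ} {σ : SingSimplex Y (n + 1)}
    (h : σ ∈ simpSub U (n + 1)) (i : Fin (n + 2)) : face i σ ∈ simpSub U n := by
  obtain ⟨j, hj⟩ := h
  exact ⟨j, fun x => hj _⟩

/-- Iterated subdivisions of a chain are eventually subordinate to an open cover. -/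
theorem exists_sSd_small {ι : Type*} {U : ι → Set Y} (hU : ∀ i, IsOpen (U i))
    (hc : ∀ y, ∃ i, y ∈ U i) {n : ℕ} (c : SChain Y n) :
    ∃ k₀, ∀ k ≥ k₀, sSd Y k n c ∈ supp (simpSub U n) := by
  induction c using Finsupp.induction_linear with
  | zero => exact ⟨0, fun k _ => by rw [map_zero]; exact Submodule.zero_mem _⟩
  | add c d hc hd =>
    obtain ⟨k₀, h₀⟩ := hc
    obtain ⟨k₁, h₁⟩ := hd
    refine ⟨max k₀ k₁, fun k hk => ?_⟩
    rw [map_add]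
    exact Submodule.add_mem _ (h₀ k (le_of_max_le_left hk)) (h₁ k (le_of_max_le_right hk))
  | single σ a =>
    obtain ⟨δ, hδ, h⟩ := lebesgue_number_lemma_of_metric (s := (univ : Set (Simp n)))
      (c := fun i => σ ⁻¹' U i) isCompact_univ (fun i => (hU i).preimage σ.continuous)
      (fun x _ => mem_iUnion.2 (hc (σ x)))
    obtain ⟨k₀, h₀⟩ := exists_oSdPow_small n (half_pos hδ)
    refine ⟨k₀, fun k hk => ?_⟩
    rw [← mul_one a, ← smul_eq_mul, ← Finsupp.smul_single, map_smul, sSd_of]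
    refine Submodule.smul_mem _ _ (oReal_mem_supp _ fun u hu => ?_)
    obtain ⟨i, hi⟩ := h (u 0) (mem_univ _)
    refine ⟨i, fun x => hi ?_⟩
    rw [Metric.mem_ball]
    refine (dist_aff_le u x (u 0) (half_pos hδ).le fun j => ?_).trans_lt (half_lt_self hδ)
    exact ((Finsupp.mem_supported ℤ _).1 (h₀ k hk) hu j 0).le

end Small

/-! ### Labels and degrees -/

section Label

variable {V W : Type*}

theorem exists_label {n : ℕ} (x : Simp n) : ∃ i, 1 / ((n : ℝ) + 1) ≤ x i := by
  by_contra! h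
  have h1 : ∑ i, x i < ∑ _i : Fin (n + 1), 1 / ((n : ℝ) + 1) :=
    Finset.sum_lt_sum_of_nonempty Finset.univ_nonempty fun i _ => h i
  rw [stdSimplex.sum_eq_one, Finset.sum_const, Finset.card_univ, Fintype.card_fin,
    nsmul_eq_mul] at h1
  push_cast at h1
  rw [mul_one_div_cancel (by positivity)] at h1
  exact lt_irrefl _ h1

/-- An index of a large barycentric coordinate. -/
def label {n : ℕ} (x : Simp n) : Fin (n + 1) := (exists_label x).choose

theorem le_label {n : ℕ} (x : Simp n) : 1 / ((n : ℝ) + 1) ≤ x (label x) :=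
  (exists_label x).choose_spec

theorem label_ne {n : ℕ} {x : Simp n} {i : Fin (n + 1)} (h : x i < 1 / ((n : ℝ) + 1)) :
    label x ≠ i := by
  rintro rfl
  exact h.not_ge (le_label x)

theorem vtx_apply {n : ℕ} (i j : Fin (n + 1)) : vtx n i j = if i = j then 1 else 0 := by
  change (stdSimplex.vertex i : Simp n) j = _
  simp only [stdSimplex.vertex_coe, Pi.single_apply]
  simp only [eq_comm]

theorem label_vtx {n : ℕ} (i : Fin (n + 1)) : label (vtx n i) = i := by
  by_contra h
  have := le_label (vtx n i)
  rw [vtx_apply, if_neg (Ne.symm h)] at this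
  exact absurd this (not_le.2 (by positivity))

theorem faceMap_apply_self {n : ℕ} (i : Fin (n + 2)) (x : Simp n) : faceMap i x i = 0 := by
  change stdSimplex.map i.succAbove x i = 0
  rw [stdSimplex.map_coe, FunOnFinite.linearMap_apply_apply]
  refine Finset.sum_eq_zero fun k hk => ?_
  exact absurd (Finset.mem_filter.1 hk).2 (Fin.succAbove_ne i k)

/-- The degree cochain of a labelling of the vertices by vectors. -/
def oDeg {n : ℕ} (l : V → Fin (n + 1) → ℤ) : OChain V (n + 1) →ₗ[ℤ] ℤ :=
  Finsupp.linearCombination ℤ (fun w => Matrix.det (Matrix.of fun i => l (w i)))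

@[simp] theorem oDeg_of {n : ℕ} (l : V → Fin (n + 1) → ℤ) (w : Fin (n + 1) → V) :
    oDeg l (oOf w) = Matrix.det (Matrix.of fun i => l (w i)) := by
  simp [oDeg]

/-- Put a column of ones in front of `v`. The rows of `v` sum to one, so (1, -1, …, -1) is in the
kernel of the enlarged matrix; its vanishing determinant is expanded along the new column. This is
the cocycle property of the degree. -/
theorem alternating_sum_det {n : ℕ} (v : Fin (n + 2) → Fin (n + 1) → ℤ)
    (h : ∀ i, ∑ j, v i j = 1) :
    ∑ i : Fin (n + 2), (-1 : ℤ) ^ (i : ℕ) * Matrix.det (Matrix.of fun k => v (i.succAbove k)) = 0 := by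
  let M : Matrix (Fin (n + 2)) (Fin (n + 2)) ℤ := Matrix.of fun i => (Fin.cons 1 (v i) : Fin (n + 2) → ℤ)
  have h0 : M.det = 0 := by
    rw [← Matrix.exists_mulVec_eq_zero_iff]
    refine ⟨Fin.cons 1 (fun _ => -1), fun h => by simpa using congrFun h 0, ?_⟩
    funext i
    simp [M, Matrix.mulVec, dotProduct, Fin.sum_univ_succ (n := n + 1), h i]
  rw [Matrix.det_succ_column_zero] at h0
  rw [← h0]
  refine Finset.sum_congr rfl fun i _ => ?_
  have : M i 0 = 1 := rfl
  rw [this, mul_one]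
  rfl

theorem det_eq_zero_of_label {n : ℕ} (v : Fin (n + 1) → Fin (n + 1) → ℤ) (j : Fin (n + 1))
    (h : ∀ i, v i j = 0) : Matrix.det (Matrix.of v) = 0 :=
  Matrix.det_eq_zero_of_column_eq_zero j h

/-- The vector of a label. -/
def labelVec {n : ℕ} (x : Simp n) : Fin (n + 1) → ℤ := Pi.single (label x) 1

theorem sum_labelVec {n : ℕ} (x : Simp n) : ∑ j, labelVec x j = 1 := by
  simp [labelVec]

theorem oDeg_oBdry {n : ℕ} {l : V → Fin (n + 1) → ℤ} (w : Fin (n + 2) → V)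
    (h : ∀ i, ∑ j, l (w i) j = 1) : oDeg l (oBdry V (n + 1) (oOf w)) = 0 := by
  rw [oBdry_of]
  simp only [map_sum, map_smul, oDeg_of, smul_eq_mul]
  exact alternating_sum_det (fun i => l (w i)) h

/-- Subdivision of the standard simplex has degree one. -/
theorem oDeg_oSdPow (k n : ℕ) : oDeg labelVec (oSdPow bary k (n + 1) (oOf (vtx n))) = 1 := by
  have hb : ∀ c, oDeg (n := n) labelVec (oBdry (Simp n) (n + 1) c) = 0 := by
    refine ochain_induction (oDeg labelVec ∘ₗ oBdry (Simp n) (n + 1)) 0 fun w => ?_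
    exact oDeg_oBdry w fun i => sum_labelVec _
  have h := oBdry_oHtpy (oSdPow bary k) (fun _ => LinearMap.id) bary (oBdry_oSdPow bary k)
    (fun _ _ => rfl) (oSdPow_zero_eq bary k) n (oOf (vtx n))
  have h' := congrArg (oDeg labelVec) h
  rw [hb, map_sub, map_sub] at h'
  have h1 : oDeg labelVec ((LinearMap.id : OChain (Simp n) (n + 1) →ₗ[ℤ] _) (oOf (vtx n))) = 1 := by
    rw [LinearMap.id_apply, oDeg_of]
    convert Matrix.det_one (n := Fin (n + 1)) (R := ℤ)
    ext i j
    simp [labelVec, label_vtx, Matrix.one_apply, Pi.single_apply, eq_comm]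
  -- The homotopy term comes from the faces, and a point of the `i`-th face never has the label `i`,
  -- so a column of each determinant is zero.
  have h2 : oDeg labelVec (oHtpy (oSdPow bary k) (fun _ => LinearMap.id) bary n
      (oBdry (Simp n) n (oOf (vtx n)))) = 0 := by
    cases n with
    | zero => simp [oHtpy]
    | succ n =>
      rw [oBdry_vtx]
      simp only [map_sum, map_smul]
      refine Finset.sum_eq_zero fun i _ => ?_
      have h3 := oMap_oHtpy (f' := oSdPow bary k) (g := fun _ => LinearMap.id)
        (g' := fun _ => LinearMap.id) (faceMap i)
        (faceMap i) (oMap_oSdPow _ (faceMap_bary i) k) (fun _ _ => rfl)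
        (faceMap_bary i) (n + 1) (oOf (vtx n))
      rw [← h3]
      have h4 : ∀ c, oDeg labelVec (oMap (faceMap i) (n + 2) c) = 0 := by
        refine ochain_induction (oDeg labelVec ∘ₗ oMap (faceMap i) (n + 2)) 0 fun w => ?_
        rw [LinearMap.comp_apply, oMap_of, oDeg_of, LinearMap.zero_apply]
        refine det_eq_zero_of_label _ i fun k => ?_
        simp only [labelVec, Function.comp_apply]
        refine Pi.single_eq_of_ne (label_ne ?_).symm _
        rw [faceMap_apply_self]
        positivity
      rw [h4, smul_zero]
  rw [h1, h2] at h'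
  linarith

end Label

end AbCover
end

noncomputable section
namespace AbCover
open HasAff

/-! ### Relative cycles of the standard simplex -/

section SimplexCycles

/-- The boundary of the standard simplex. -/
def bdrySimp (n : ℕ) : Set (Simp n) := {x | ∃ i, x i = 0}

/-- The relative boundaries of `(Y, A)` together with the span of some chains. -/
def relSpan {Y : Type*} [TopologicalSpace Y] (A : Set Y) {n : ℕ} (s : Set (SingSimplex Y n)) :
    Submodule ℤ (SChain Y n) :=
  supp s ⊔ (LinearMap.range (singBdryInt Y n) ⊔ supp (simpIn A n))

section

variable {Y : Type*} [TopologicalSpace Y] {A : Set Y} {n : ℕ} {s : Set (SingSimplex Y n)}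

theorem of_mem_relSpan {σ : SingSimplex Y n} (h : σ ∈ s) : sOf σ ∈ relSpan A s :=
  Submodule.mem_sup_left (sOf_mem_supp h)

theorem bdry_mem_relSpan (c : SChain Y (n + 1)) : singBdryInt Y n c ∈ relSpan A s :=
  Submodule.mem_sup_right (Submodule.mem_sup_left ⟨c, rfl⟩)

theorem sub_mem_relSpan {c : SChain Y n} (h : c ∈ supp (simpIn A n)) : c ∈ relSpan A s :=
  Submodule.mem_sup_right (Submodule.mem_sup_right h)

theorem sMap_mem_relSpan {Y' : Type*} [TopologicalSpace Y'] {A' : Set Y'}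
    {s' : Set (SingSimplex Y' n)} (f : C(Y, Y')) (hA : ∀ x ∈ A, f x ∈ A')
    (hs : ∀ σ ∈ s, f.comp σ ∈ s') {c : SChain Y n} (hc : c ∈ relSpan A s) :
    sMap f n c ∈ relSpan A' s' := by
  obtain ⟨x, hx, y, hy, rfl⟩ := Submodule.mem_sup.1 hc
  obtain ⟨_, ⟨b, rfl⟩, a, ha, rfl⟩ := Submodule.mem_sup.1 hy
  rw [map_add, map_add, ← singBdryInt_sMap]
  refine Submodule.add_mem _ (Submodule.mem_sup_left (sMap_mem_supp f hs hx))
    (Submodule.add_mem _ (bdry_mem_relSpan _) (sub_mem_relSpan (sMap_mem_supp f ?_ ha)))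
  intro σ hσ
  rw [mem_simpIn] at hσ ⊢
  exact fun x => hA _ (hσ x)

/-- A relative cycle may be replaced by its subdivision. -/
theorem mem_relSpan_of_sSd {s : Set (SingSimplex Y (n + 1))} {c : SChain Y (n + 1)}
    (hc : singBdryInt Y n c ∈ supp (simpIn A n)) (k : ℕ) (h : sSd Y k (n + 1) c ∈ relSpan A s) :
    c ∈ relSpan A s := by
  have h1 := singBdryInt_sSdHtpy k n c
  have h2 : c = sSd Y k (n + 1) c - singBdryInt Y (n + 1) (sSdHtpy Y k (n + 1) c) -
      sSdHtpy Y k n (singBdryInt Y n c) := by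
    rw [h1]
    abel
  rw [h2]
  exact Submodule.sub_mem _ (Submodule.sub_mem _ h (bdry_mem_relSpan _))
    (sub_mem_relSpan (sSdHtpy_mem_supp k hc))

/-- A relative cycle may be replaced by the end of a homotopy. -/
theorem mem_relSpan_of_sEnd (G : ∀ n, SingSimplex Y n → C(Simp n × Simp 1, Y))
    (hG : ∀ n i σ, G n (face i σ) = (G (n + 1) σ).comp ((faceMap i).prodMap (ContinuousMap.id _)))
    (h0 : ∀ n σ, (G n σ).comp (cylEnd _ 0) = σ)
    {s : Set (SingSimplex Y (n + 1))} {c : SChain Y (n + 1)} {Q : Set (SingSimplex Y n)}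
    (hc : singBdryInt Y n c ∈ supp Q) (hQ : ∀ σ ∈ Q, ∀ x, G n σ x ∈ A)
    (h : sEnd G 1 (n + 1) c ∈ relSpan A s) : c ∈ relSpan A s := by
  have h1 := singBdryInt_sPrism G hG n c
  have h3 : sEnd G 0 (n + 1) c = c := by
    refine schain_induction (sEnd G 0 (n + 1)) LinearMap.id (fun σ => ?_) c
    rw [sEnd_of, h0, LinearMap.id_apply]
  rw [h3] at h1
  have h2 : c = sEnd G 1 (n + 1) c - singBdryInt Y (n + 1) (sPrism G (n + 1) c) -
      sPrism G n (singBdryInt Y n c) := by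
    rw [h1]
    abel
  rw [h2]
  exact Submodule.sub_mem _ (Submodule.sub_mem _ h (bdry_mem_relSpan _))
    (sub_mem_relSpan (sPrism_mem_supp G hQ hc))

end

theorem aff_mem_bdrySimp {m n : ℕ} (w : Fin (m + 1) → Simp n) (i : Fin (n + 1))
    (h : ∀ k, w k i = 0) (x : Simp m) : aff w x ∈ bdrySimp n :=
  ⟨i, by rw [aff_apply]; simp [h]⟩

theorem aff_vtx_mem_bdrySimp {n : ℕ} (l : Fin (n + 1) → Fin (n + 1)) (h : ¬ Function.Surjective l) :
    aff (vtx n ∘ l) ∈ simpIn (bdrySimp n) n := by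
  rw [mem_simpIn]
  intro x
  simp only [Function.Surjective, not_forall, not_exists] at h
  obtain ⟨i, hi⟩ := h
  refine aff_mem_bdrySimp _ i (fun k => ?_) x
  rw [Function.comp_apply, vtx_apply, if_neg (hi k)]

/-- Repeats the `i`-th vertex after the next one. -/
def repeatVtx {n : ℕ} (i : Fin n) (j : Fin (n + 2)) : Fin (n + 1) :=
  ⟨if (j : ℕ) ≤ i + 1 then j else if (j : ℕ) = i + 2 then i else j - 1, by split_ifs <;> omega⟩

theorem val_succAbove {n : ℕ} (j : Fin (n + 1)) (k : Fin n) :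
    (j.succAbove k : ℕ) = if (k : ℕ) < j then (k : ℕ) else k + 1 := by
  rw [Fin.succAbove, apply_ite Fin.val]
  rfl

/-- The vertex sequence is 0, …, i, i+1, i, i+2, …. Omitting the first i gives an adjacent
transposition, omitting the second gives the identity, and any other omission loses a vertex
altogether. One boundary therefore relates two permutations. -/
theorem repeatVtx_first {n : ℕ} (i : Fin n) :
    repeatVtx i ∘ (i.castSucc.castSucc).succAbove = Equiv.swap i.castSucc i.succ := by
  funext k
  have hi := i.2
  have hk := k.2
  rw [Fin.ext_iff, Equiv.swap_apply_def, apply_ite Fin.val, apply_ite Fin.val]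
  simp only [Function.comp_apply, repeatVtx, val_succAbove, Fin.val_castSucc, Fin.val_succ,
    Fin.ext_iff]
  split_ifs <;> omega

theorem repeatVtx_last {n : ℕ} (i : Fin n) : repeatVtx i ∘ (i.succ.succ).succAbove = id := by
  funext k
  have hi := i.2
  have hk := k.2
  rw [Fin.ext_iff]
  simp only [Function.comp_apply, repeatVtx, val_succAbove, Fin.val_succ, id]
  split_ifs <;> omega

theorem repeatVtx_not_surjective {n : ℕ} (i : Fin n) (j : Fin (n + 2))
    (h1 : j ≠ i.castSucc.castSucc) (h2 : j ≠ i.succ.succ) :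
    ¬ Function.Surjective (repeatVtx i ∘ j.succAbove) := by
  intro hs
  have hi := i.2
  have hj := j.2
  simp only [ne_eq, Fin.ext_iff, Fin.val_castSucc, Fin.val_succ] at h1 h2
  obtain ⟨k, hk⟩ := hs (repeatVtx i j)
  have hk2 := k.2
  simp only [Function.comp_apply, Fin.ext_iff, repeatVtx, val_succAbove] at hk
  split_ifs at hk <;> omega

/-- Adjacent transpositions generate the permutations. The boundary of the simplex with a repeated
vertex relates π and π · swap up to sign, its other faces being contained in ∂Δ. -/
theorem aff_perm_mem {n : ℕ} (π : Equiv.Perm (Fin (n + 1))) :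
    sOf (aff (vtx n ∘ π)) ∈ relSpan (bdrySimp n) {ContinuousMap.id (Simp n)} := by
  have hπ : π ∈ Submonoid.closure
      (range fun i : Fin n => Equiv.swap i.castSucc i.succ) := by
    rw [Equiv.Perm.mclosure_swap_castSucc_succ]
    trivial
  induction hπ using Submonoid.closure_induction_right with
  | one =>
    have : vtx n ∘ ⇑(1 : Equiv.Perm (Fin (n + 1))) = vtx n := rfl
    rw [this, aff_vtx]
    exact of_mem_relSpan rfl
  | mul_right π _ s hs ih =>
    obtain ⟨i, rfl⟩ := hs
    have h := singBdryInt_oReal (ContinuousMap.id (Simp n)) n (oOf (vtx n ∘ π ∘ repeatVtx i))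
    have hne : i.castSucc.castSucc ≠ i.succ.succ := by
      rw [ne_eq, Fin.ext_iff]
      simp only [Fin.val_castSucc, Fin.val_succ]
      omega
    rw [oBdry_of, map_sum, ← Finset.add_sum_erase _ _ (Finset.mem_univ i.castSucc.castSucc),
      ← Finset.add_sum_erase _ _ (Finset.mem_erase.2 ⟨hne.symm, Finset.mem_univ i.succ.succ⟩)] at h
    simp only [map_smul, oReal_of, ContinuousMap.id_comp] at h
    have e1 : (vtx n ∘ ⇑π ∘ repeatVtx i) ∘ (i.castSucc.castSucc).succAbove =
        vtx n ∘ ⇑(π * Equiv.swap i.castSucc i.succ) := by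
      rw [Function.comp_assoc, Function.comp_assoc, repeatVtx_first]
      rfl
    have e2 : (vtx n ∘ ⇑π ∘ repeatVtx i) ∘ (i.succ.succ).succAbove = vtx n ∘ π := by
      rw [Function.comp_assoc, Function.comp_assoc, repeatVtx_last]
      rfl
    rw [e1, e2] at h
    have h3 := bdry_mem_relSpan (A := bdrySimp n) (s := {ContinuousMap.id (Simp n)})
      (sOf (aff (vtx n ∘ π ∘ repeatVtx i)))
    rw [h, Submodule.add_mem_iff_left, ← mul_one ((-1 : ℤ) ^ _)] at h3
    · rw [mul_one] at h3
      rcases neg_one_pow_eq_or ℤ ((i.castSucc.castSucc : Fin (n + 2)) : ℕ) with h4 | h4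
      · rwa [h4, one_smul] at h3
      · rwa [h4, neg_smul, one_smul, Submodule.neg_mem_iff] at h3
    · refine Submodule.add_mem _ (Submodule.smul_mem _ _ ih) (Submodule.sum_mem _ fun j hj => ?_)
      refine Submodule.smul_mem _ _ (sub_mem_relSpan (sOf_mem_supp ?_))
      simp only [Finset.mem_erase] at hj
      refine aff_vtx_mem_bdrySimp (π ∘ repeatVtx i ∘ j.succAbove) fun hs => ?_
      refine repeatVtx_not_surjective i j hj.2.1 hj.1 ?_
      exact π.comp_surjective _ |>.1 hs

theorem aff_labels_mem {n : ℕ} (l : Fin (n + 1) → Fin (n + 1)) :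
    sOf (aff (vtx n ∘ l)) ∈ relSpan (bdrySimp n) {ContinuousMap.id (Simp n)} := by
  by_cases h : Function.Surjective l
  · exact aff_perm_mem (Equiv.ofBijective l (Finite.surjective_iff_bijective.1 h))
  · exact sub_mem_relSpan (sOf_mem_supp (aff_vtx_mem_bdrySimp l h))

/-- Straight lines in the standard simplex. -/
def lineSimp (n : ℕ) : C((Simp n × Simp n) × Simp 1, Simp n) where
  toFun p := aff ![p.1.1, p.1.2] p.2
  continuous_toFun := by
    refine Continuous.subtype_mk (continuous_pi fun j => continuous_finsetSum _ fun i _ => ?_) _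
    refine ((continuous_apply i).comp (continuous_subtype_val.comp continuous_snd)).mul ?_
    fin_cases i
    · exact (continuous_apply j).comp
        (continuous_subtype_val.comp (continuous_fst.comp continuous_fst))
    · exact (continuous_apply j).comp
        (continuous_subtype_val.comp (continuous_snd.comp continuous_fst))

/-- The affine simplex on the labels of the vertices of a singular simplex. -/
def labelSimp {m n : ℕ} (σ : SingSimplex (Simp n) m) : SingSimplex (Simp n) m :=
  aff (fun i => vtx n (label (σ (vtx m i))))

/-- The label simplex depends on the vertices only, so the straight-line homotopies agree on faces,
as the prism operator requires. -/
theorem labelSimp_face {m n : ℕ} (i : Fin (m + 2)) (σ : SingSimplex (Simp n) (m + 1)) :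
    labelSimp (face i σ) = face i (labelSimp σ) := by
  rw [face_eq i (labelSimp σ), labelSimp, labelSimp, HasAff.aff_face]
  congr 1
  funext k
  simp only [Function.comp_apply]
  rw [← Function.comp_apply (f := vtx (m + 1)), ← faceMap_vtx]
  rfl

/-- The straight-line homotopy from a singular simplex to the simplex on its labels. -/
def labelHtpy {n : ℕ} (m : ℕ) (σ : SingSimplex (Simp n) m) : C(Simp m × Simp 1, Simp n) :=
  (lineSimp n).comp ((σ.prodMk (labelSimp σ)).prodMap (ContinuousMap.id _))

theorem labelHtpy_end {m n : ℕ} (σ : SingSimplex (Simp n) m) (i : Fin 2) :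
    (labelHtpy m σ).comp (cylEnd _ i) = ![σ, labelSimp σ] i := by
  ext1 x
  refine (aff_apply_vtx ![σ x, labelSimp σ x] i).trans ?_
  fin_cases i <;> rfl

/-- Relative cycles of the pair `(Δⁿ, ∂Δⁿ)` are homologous to multiples of the identity. -/
theorem simplex_cycle_mem {n : ℕ} {c : SChain (Simp (n + 1)) (n + 1)}
    (hc : singBdryInt _ n c ∈ supp (simpIn (bdrySimp (n + 1)) n)) :
    c ∈ relSpan (bdrySimp (n + 1)) {ContinuousMap.id (Simp (n + 1))} := by
  -- Two points in a ball of radius `r` have coordinates that differ by less than 2r, which is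
  -- exactly the threshold for a label.
  set r : ℝ := 1 / (2 * ((n + 1 : ℕ) + 1)) with hr
  have hrpos : 0 < r := by positivity
  let U : Simp (n + 1) → Set (Simp (n + 1)) := fun x => Metric.ball x r
  obtain ⟨k, hk⟩ := exists_sSd_small (U := U) (fun x => Metric.isOpen_ball)
    (fun y => ⟨y, Metric.mem_ball_self hrpos⟩) c
  have hk := hk k le_rfl
  refine mem_relSpan_of_sSd hc k ?_
  have h1 : singBdryInt _ n (sSd _ k (n + 1) c) ∈
      supp (simpIn (bdrySimp (n + 1)) n ∩ simpSub U n) := by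
    rw [supp, Finsupp.supported_inter]
    refine ⟨?_, singBdryInt_mem_supp (fun σ hσ i => face_mem_simpSub hσ i) hk⟩
    rw [singBdryInt_sSd]
    exact sSd_mem_supp k hc
  refine mem_relSpan_of_sEnd labelHtpy (fun m i σ => ?_) (fun m σ => (labelHtpy_end σ 0).trans rfl) h1 ?_ ?_
  · simp only [labelHtpy, labelSimp_face]
    rfl
  · rintro σ ⟨hσ, z, hz⟩ ⟨x, s⟩
    rw [mem_simpIn] at hσ
    obtain ⟨j, hj⟩ := hσ x
    refine ⟨j, ?_⟩
    have hlab : ∀ y, label (σ y) ≠ j := fun y => by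
      refine label_ne ?_
      have h2 : dist (σ y) (σ x) < r + r :=
        (dist_triangle_right _ _ z).trans_lt (add_lt_add (hz y) (hz x))
      have h3 : dist ((σ y).1 j) ((σ x).1 j) < r + r :=
        (dist_le_pi_dist (σ y).1 (σ x).1 j).trans_lt h2
      rw [Real.dist_eq] at h3
      have h4 : (σ x).1 j = 0 := hj
      rw [h4, sub_zero] at h3
      refine ((le_abs_self _).trans_lt h3).trans_eq ?_
      rw [hr]
      field_simp
      ring
    have hl : labelSimp σ x j = 0 := by
      rw [labelSimp, aff_apply]
      refine Finset.sum_eq_zero fun i _ => ?_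
      rw [vtx_apply, if_neg (hlab _), mul_zero]
    change aff ![σ x, labelSimp σ x] s j = 0
    rw [aff_apply, Fin.sum_univ_two]
    simp [hj, hl]
  · have hd : sSd (Simp (n + 1)) k (n + 1) c ∈ supp univ := by
      rw [supp, Finsupp.supported_univ]
      trivial
    refine supp_induction _ _ (fun σ _ => ?_) hd
    rw [sEnd_of, labelHtpy_end]
    exact aff_labels_mem (fun i => label (σ (vtx (n + 1) i)))

end SimplexCycles

end AbCover
end

noncomputable section
namespace AbCover
open HasAff

/-! ### Collapsing a collar of the boundary of the simplex -/

section Collapse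

/-- The smallest barycentric coordinate. -/
def minCoord {n : ℕ} (x : Simp n) : ℝ := Finset.univ.inf' Finset.univ_nonempty (fun i => x i)

theorem minCoord_le {n : ℕ} (x : Simp n) (i : Fin (n + 1)) : minCoord x ≤ x i :=
  Finset.inf'_le _ (Finset.mem_univ i)

theorem minCoord_nonneg {n : ℕ} (x : Simp n) : 0 ≤ minCoord x :=
  Finset.le_inf' _ _ fun i _ => stdSimplex.zero_le x i

theorem exists_minCoord_eq {n : ℕ} (x : Simp n) : ∃ i, minCoord x = x i := by
  obtain ⟨i, -, hi⟩ := Finset.exists_mem_eq_inf' Finset.univ_nonempty (fun i => x i)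
  exact ⟨i, hi⟩

theorem continuous_coord {n : ℕ} (i : Fin (n + 1)) : Continuous fun x : Simp n => x i :=
  (continuous_apply i).comp continuous_subtype_val

theorem continuous_minCoord (n : ℕ) : Continuous (minCoord (n := n)) :=
  Continuous.finset_inf'_apply _ fun i _ => continuous_coord i

/-- The size of the collar. -/
def collar (n : ℕ) : ℝ := 1 / (2 * (n + 1))

theorem collar_pos (n : ℕ) : 0 < collar n := by
  unfold collar
  positivity

/-- The amount that is subtracted from the coordinates when the collar is collapsed. -/
def collapseShift {n : ℕ} (p : Simp n × Simp 1) : ℝ := p.2 1 * min (collar n) (minCoord p.1)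

theorem collapseShift_le {n : ℕ} (p : Simp n × Simp 1) :
    collapseShift p ≤ min (collar n) (minCoord p.1) :=
  mul_le_of_le_one_left (le_min (collar_pos n).le (minCoord_nonneg _)) (stdSimplex.le_one _ _)

theorem collapse_denom_pos {n : ℕ} (p : Simp n × Simp 1) :
    0 < 1 - (n + 1) * collapseShift p := by
  have h := (collapseShift_le p).trans (min_le_left _ _)
  have h2 : ((n : ℝ) + 1) * collar n = 1 / 2 := by
    unfold collar
    field_simp
  have h3 : ((n : ℝ) + 1) * collapseShift p ≤ (n + 1) * collar n := by gcongr
  linarith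

/-- The homotopy of the standard simplex that collapses a collar of the boundary. -/
def collapse (n : ℕ) : C(Simp n × Simp 1, Simp n) where
  toFun p := ⟨fun i => (p.1 i - collapseShift p) / (1 - (n + 1) * collapseShift p), by
    refine ⟨fun i => div_nonneg ?_ (collapse_denom_pos p).le, ?_⟩
    · have := (collapseShift_le p).trans (min_le_right _ _)
      linarith [minCoord_le p.1 i]
    · rw [← Finset.sum_div, Finset.sum_sub_distrib, stdSimplex.sum_eq_one, Finset.sum_const,
        Finset.card_univ, Fintype.card_fin, nsmul_eq_mul]
      push_cast
      exact div_self (collapse_denom_pos p).ne'⟩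
  continuous_toFun := by
    have hs : Continuous (collapseShift (n := n)) :=
      ((continuous_coord 1).comp continuous_snd).mul
        (continuous_const.min ((continuous_minCoord n).comp continuous_fst))
    refine Continuous.subtype_mk (continuous_pi fun i => ?_) _
    refine Continuous.div (((continuous_coord i).comp continuous_fst).sub hs)
      (continuous_const.sub (continuous_const.mul hs)) fun p => (collapse_denom_pos p).ne'

theorem collapse_apply {n : ℕ} (p : Simp n × Simp 1) (i : Fin (n + 1)) :
    collapse n p i = (p.1 i - collapseShift p) / (1 - (n + 1) * collapseShift p) := rfl

theorem collapse_eq_self {n : ℕ} (p : Simp n × Simp 1) (h : collapseShift p = 0) :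
    collapse n p = p.1 := by
  ext i
  change collapse n p i = p.1 i
  rw [collapse_apply, h]
  simp

theorem endpt_apply (i j : Fin 2) : endpt i j = if i = j then 1 else 0 := vtx_apply i j

theorem collapse_zero {n : ℕ} (x : Simp n) : collapse n (x, endpt 0) = x :=
  collapse_eq_self _ (by simp [collapseShift, endpt_apply])

theorem collapse_bdry {n : ℕ} {x : Simp n} (h : x ∈ bdrySimp n) (s : Simp 1) :
    collapse n (x, s) = x := by
  obtain ⟨i, hi⟩ := h
  have h0 : minCoord x = 0 := le_antisymm (hi ▸ minCoord_le x i) (minCoord_nonneg x)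
  exact collapse_eq_self _ (by simp [collapseShift, h0, (collar_pos n).le])

/-- The points away from the collar. -/
def coreSimp (n : ℕ) : Set (Simp n) := {x | ∀ i, collar n ≤ x i}

/-- Some coordinate is below the collar width, so at time one exactly the minimal coordinate is
subtracted, and it becomes zero. -/
theorem collapse_one {n : ℕ} {x : Simp n} (h : x ∉ coreSimp n) :
    collapse n (x, endpt 1) ∈ bdrySimp n := by
  obtain ⟨i, hi⟩ : ∃ i, x i < collar n := by simpa [coreSimp] using h
  obtain ⟨j, hj⟩ := exists_minCoord_eq x
  refine ⟨j, ?_⟩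
  have : collapseShift (x, endpt 1) = x j := by
    rw [← hj]
    simp [collapseShift, endpt_apply, ((minCoord_le x i).trans hi.le)]
  rw [collapse_apply, this]
  simp

theorem isClosed_coreSimp (n : ℕ) : IsClosed (coreSimp n) := by
  simp only [coreSimp, ofPred_forall]
  exact isClosed_iInter fun i => isClosed_le continuous_const (continuous_coord i)

end Collapse

/-! ### Relative cells -/

section RelCells

variable {B : Type*} [TopologicalSpace B] {J : Type*}

/-- The interior of the standard simplex. -/
def intSimp (n : ℕ) : Set (Simp n) := {x | ∀ i, 0 < x i}

theorem mem_bdry_of_not_int {n : ℕ} {x : Simp n} (h : x ∉ intSimp n) : x ∈ bdrySimp n := by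
  obtain ⟨i, hi⟩ : ∃ i, x i ≤ 0 := by simpa [intSimp] using h
  exact ⟨i, le_antisymm hi (stdSimplex.zero_le x i)⟩

theorem core_subset_int (n : ℕ) : coreSimp n ⊆ intSimp n :=
  fun _ h i => (collar_pos n).trans_le (h i)

/-- The space `B` is obtained from the closed subset `A` by attaching the `n`-cells `φ j`. -/
structure RelCells (A : Set B) (n : ℕ) (φ : J → C(Simp n, B)) : Prop where
  isClosed : IsClosed A
  locallyFinite : LocallyFinite fun j => range (φ j)
  bdry {j x} : x ∈ bdrySimp n → φ j x ∈ A
  int {j x} : x ∈ intSimp n → φ j x ∉ A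
  inj {j j' x x'} : x ∈ intSimp n → φ j x = φ j' x' → j = j' ∧ x = x'
  cover (y) : y ∈ A ∨ ∃ j x, φ j x = y

namespace RelCells

variable {A : Set B} {n : ℕ} {φ : J → C(Simp n, B)} (h : RelCells A n φ)
include h

variable [T2Space B]

theorem isClosed_union (S : J → Set (Simp n)) (hS : ∀ j, IsClosed (S j)) :
    IsClosed (A ∪ ⋃ j, φ j '' S j) := by
  refine h.isClosed.union (LocallyFinite.isClosed_iUnion
    (h.locallyFinite.subset fun j => image_subset_range _ _) fun j => ?_)
  exact ((hS j).isCompact.image (φ j).continuous).isClosed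

/-- The complement consists of `A`, the other closed cells and the closed rest of this one, a
locally finite union of closed sets. -/
theorem isOpen_cell (j : J) {S : Set (Simp n)} (hS : IsOpen S) (hSi : S ⊆ intSimp n) :
    IsOpen (φ j '' S) := by
  classical
  have h1 := h.isClosed_union (fun j' => if j' = j then Sᶜ else univ) fun j' => by
    split_ifs
    · exact hS.isClosed_compl
    · exact isClosed_univ
  convert h1.isOpen_compl
  ext y
  simp only [mem_compl_iff, mem_union, mem_iUnion, not_or, not_exists, mem_image]
  constructor
  · rintro ⟨x, hx, rfl⟩
    refine ⟨h.int (hSi hx), ?_⟩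
    rintro j' x' ⟨hx', hxx⟩
    obtain ⟨rfl, rfl⟩ := h.inj (hSi hx) hxx.symm
    rw [if_pos rfl] at hx'
    exact hx' hx
  · rintro ⟨hA, h2⟩
    obtain hA' | ⟨j', x, rfl⟩ := h.cover y
    · exact absurd hA' hA
    · by_cases hj : j' = j
      · subst hj
        refine ⟨x, ?_, rfl⟩
        by_contra hx
        exact h2 j' x ⟨by rwa [if_pos rfl], rfl⟩
      · exact absurd ⟨by rw [if_neg hj]; trivial, rfl⟩ (h2 j' x)

end RelCells

/-- The degree cochain on singular chains of a labelling of the points by vectors. -/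
def sDeg {n : ℕ} (l : B → Fin (n + 1) → ℤ) : SChain B n →ₗ[ℤ] ℤ :=
  Finsupp.linearCombination ℤ (fun σ => Matrix.det (Matrix.of fun i => l (σ (vtx n i))))

theorem sDeg_of {n : ℕ} (l : B → Fin (n + 1) → ℤ) (σ : SingSimplex B n) :
    sDeg l (sOf σ) = Matrix.det (Matrix.of fun i => l (σ (vtx n i))) := by
  simp [sDeg]

theorem sDeg_oReal {m n : ℕ} (l : B → Fin (n + 1) → ℤ) (g : C(Simp m, B))
    (c : OChain (Simp m) (n + 1)) : sDeg l (oReal g n c) = oDeg (l ∘ g) c := by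
  refine ochain_induction (sDeg l ∘ₗ oReal g n) (oDeg (l ∘ g)) (fun w => ?_) c
  simp only [LinearMap.comp_apply, oReal_of, sDeg_of, oDeg_of, ContinuousMap.comp_apply,
    aff_apply_vtx, Function.comp_apply]

theorem sDeg_bdry {n : ℕ} (l : B → Fin (n + 1) → ℤ) (τ : SingSimplex B (n + 1)) :
    sDeg l (singBdryInt B n (sOf τ)) = ∑ i : Fin (n + 2), (-1 : ℤ) ^ (i : ℕ) *
      Matrix.det (Matrix.of fun k => l (τ (vtx (n + 1) (i.succAbove k)))) := by
  simp only [singBdryInt_of, map_sum, map_smul, sDeg_of, smul_eq_mul, face_eq,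
    ContinuousMap.comp_apply]
  refine Finset.sum_congr rfl fun i _ => ?_
  have : ∀ k, faceMap i (vtx n k) = vtx (n + 1) (i.succAbove k) := congrFun (faceMap_vtx i)
  simp only [this]

open Classical in
/-- The labelling of the points of `B` by the labels of the core of a cell. -/
def cellLabel {n : ℕ} (φ : C(Simp n, B)) (y : B) : Fin (n + 1) → ℤ :=
  if h : ∃ x, (∀ i, collar n < x i) ∧ φ x = y then labelVec h.choose else 0

theorem RelCells.cellLabel_apply {A : Set B} {n : ℕ} {φ : J → C(Simp n, B)} (h : RelCells A n φ)
    {j : J} {x : Simp n} (hx : ∀ i, collar n < x i) : cellLabel (φ j) (φ j x) = labelVec x := by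
  have h1 : ∃ x', (∀ i, collar n < x' i) ∧ φ j x' = φ j x := ⟨x, hx, rfl⟩
  rw [cellLabel, dif_pos h1]
  rw [(h.inj (core_subset_int n fun i => (h1.choose_spec.1 i).le) h1.choose_spec.2).2]

theorem cellLabel_of_not {n : ℕ} {φ : C(Simp n, B)} {y : B}
    (hy : ∀ x, (∀ i, collar n < x i) → φ x ≠ y) : cellLabel φ y = 0 := by
  rw [cellLabel, dif_neg]
  rintro ⟨x, hx, hxy⟩
  exact hy x hx hxy

/-- The fundamental classes of the cells are linearly independent. -/
theorem RelCells.indep [T2Space B] {A : Set B} {n : ℕ} {φ : J → C(Simp n, B)}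
    (h : RelCells A n φ) (m : J →₀ ℤ) (b : SChain B (n + 1)) {a : SChain B n}
    (ha : a ∈ supp (simpIn A n))
    (heq : Finsupp.linearCombination ℤ (fun j => sOf (φ j)) m = singBdryInt B n b + a) :
    m = 0 := by
  classical
  ext j
  set l := cellLabel (φ j) with hl
  have hε : 2 * collar n = 1 / ((n : ℝ) + 1) := by
    unfold collar
    field_simp
  have hint : ∀ {x : Simp n}, (∀ i, collar n < x i) → x ∈ intSimp n :=
    fun hx => core_subset_int n fun i => (hx i).le
  -- `O` carries the labels of the cell, and `K i` contains the points labelled `i`. The degree is a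
  -- cocycle on simplices in `O`, and the `i`-th column vanishes off `K i`. These open sets cover: a
  -- point in every `K i` has all coordinates at least 1/(n+1), beyond the collar width.
  let O : Set B := φ j '' {x | ∀ i, collar n < x i}
  let K : Fin (n + 1) → Set B := fun i => φ j '' {x | x ∈ coreSimp n ∧ 1 / ((n : ℝ) + 1) ≤ x i}
  let U : Option (Fin (n + 1)) → Set B := fun o => o.elim O fun i => (K i)ᶜ
  have hU : ∀ o, IsOpen (U o) := by
    rintro (_ | i)
    · refine h.isOpen_cell j ?_ fun x hx => hint hx
      simp only [ofPred_forall]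
      exact isOpen_iInter_of_finite fun i => isOpen_lt continuous_const (continuous_coord i)
    · refine (IsCompact.isClosed ?_).isOpen_compl
      refine IsCompact.image (IsClosed.isCompact ?_) (φ j).continuous
      exact (isClosed_coreSimp n).inter (isClosed_le continuous_const (continuous_coord i))
  have hcov : ∀ y, ∃ o, y ∈ U o := by
    intro y
    by_contra! hy
    have h1 : ∀ i, y ∈ K i := fun i => by
      by_contra hi
      exact hy (some i) hi
    obtain ⟨x, ⟨hx, -⟩, hxy⟩ := h1 0
    refine hy none ⟨x, fun i => ?_, hxy⟩
    obtain ⟨x', ⟨-, hx'⟩, hxy'⟩ := h1 i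
    obtain ⟨-, rfl⟩ := h.inj (core_subset_int n hx) (hxy.trans hxy'.symm)
    linarith [collar_pos n]
  have hlO : ∀ y ∈ O, ∑ i, l y i = 1 := by
    rintro _ ⟨x, hx, rfl⟩
    rw [hl, h.cellLabel_apply hx, sum_labelVec]
  have hlK : ∀ i, ∀ y ∉ K i, l y i = 0 := by
    intro i y hy
    by_cases hyO : y ∈ O
    · obtain ⟨x, hx, rfl⟩ := hyO
      rw [hl, h.cellLabel_apply hx]
      refine Pi.single_eq_of_ne (label_ne ?_).symm _
      by_contra! hxi
      exact hy ⟨x, ⟨fun i => (hx i).le, hxi⟩, rfl⟩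
    · rw [hl, cellLabel_of_not fun x hx hxy => hyO ⟨x, hx, hxy⟩]
      rfl
  have hlA : ∀ y ∈ A, l y = 0 := fun y hy => cellLabel_of_not fun x hx hxy =>
    h.int (hint hx) (hxy ▸ hy)
  -- The same power of subdivision makes `b` small for the cover and brings the mesh of the standard
  -- simplex below the collar width.
  obtain ⟨k₀, hk₀⟩ := exists_sSd_small hU hcov b
  obtain ⟨k₁, hk₁⟩ := exists_oSdPow_small n (collar_pos n)
  set k := max k₀ k₁ with hk
  have hb : sDeg l (singBdryInt B n (sSd B k (n + 1) b)) = 0 := by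
    refine (Submodule.mem_bot ℤ).1 (supp_induction (sDeg l ∘ₗ singBdryInt B n) ⊥ ?_
      (hk₀ k (le_max_left _ _)))
    rintro τ ⟨o, ho⟩
    rw [Submodule.mem_bot, LinearMap.comp_apply, sDeg_bdry]
    cases o with
    | none => exact alternating_sum_det (fun i => l (τ (vtx (n + 1) i))) fun i => hlO _ (ho _)
    | some i =>
      refine Finset.sum_eq_zero fun k _ => ?_
      rw [det_eq_zero_of_label _ i fun k => hlK i _ (ho _), mul_zero]
  have ha' : sDeg l (sSd B k n a) = 0 := by
    refine (Submodule.mem_bot ℤ).1 (supp_induction (sDeg l) ⊥ ?_ (sSd_mem_supp k ha))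
    intro σ hσ
    rw [mem_simpIn] at hσ
    rw [Submodule.mem_bot, sDeg_of]
    exact det_eq_zero_of_label _ 0 fun i => congrFun (hlA _ (hσ _)) 0
  have hφ : ∀ j', sDeg l (sSd B k n (sOf (φ j'))) = if j' = j then 1 else 0 := by
    intro j'
    rw [sSd_of, sDeg_oReal]
    split_ifs with hj
    · subst hj
      rw [← oDeg_oSdPow k n, ← sub_eq_zero, ← LinearMap.sub_apply]
      refine (Submodule.mem_bot ℤ).1 (osupp_induction (oDeg (l ∘ φ j') - oDeg labelVec) ⊥ ?_
        (hk₁ k (le_max_right _ _)))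
      intro u hu
      rw [Submodule.mem_bot, LinearMap.sub_apply, oDeg_of, oDeg_of, sub_eq_zero]
      -- Either all vertices are beyond the collar, where both labellings agree, or some vertex has
      -- a `q`-th coordinate at most the collar width. Then this coordinate is below twice that
      -- width, the label threshold, at every vertex, and neither labelling uses `q`.
      by_cases hc : ∀ i, ∀ q, collar n < u i q
      · congr 2
        funext i
        exact h.cellLabel_apply (hc i)
      · push Not at hc
        obtain ⟨i, q, hq⟩ := hc
        have hlab : ∀ i', u i' q < 1 / ((n : ℝ) + 1) := fun i' => by
          have h1 : dist ((u i').1 q) ((u i).1 q) < collar n :=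
            (dist_le_pi_dist (u i').1 (u i).1 q).trans_lt (hu i' i)
          rw [Real.dist_eq] at h1
          have h2 := (le_abs_self _).trans_lt h1
          have h3 : (u i).1 q ≤ collar n := hq
          rw [← hε]
          exact (by linarith : (u i').1 q < 2 * collar n)
        rw [det_eq_zero_of_label _ q, det_eq_zero_of_label _ q]
        · exact fun i' => Pi.single_eq_of_ne (label_ne (hlab i')).symm _
        · intro i'
          refine hlK q _ ?_
          rintro ⟨x, ⟨hx, hxq⟩, hxu⟩
          obtain ⟨-, rfl⟩ := h.inj (core_subset_int n hx) hxu
          exact (hlab i').not_ge hxq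
    · have : l ∘ φ j' = fun _ => 0 := by
        funext x
        refine cellLabel_of_not fun x' hx' hxx => hj ?_
        exact (h.inj (hint hx') hxx).1.symm
      rw [this]
      refine (Submodule.mem_bot ℤ).1 (osupp_induction (oDeg fun _ => 0) ⊥ ?_
        (hk₁ k (le_max_right _ _)))
      intro u _
      rw [Submodule.mem_bot, oDeg_of]
      exact det_eq_zero_of_label _ 0 fun _ => rfl
  have h1 := congrArg (fun c => sDeg l (sSd B k n c)) heq
  simp only [map_add, ← singBdryInt_sSd, hb, ha', add_zero] at h1
  rw [Finsupp.linearCombination_apply, Finsupp.sum, map_sum, map_sum] at h1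
  simp only [map_smul, hφ, smul_eq_mul, mul_ite, mul_one, mul_zero, Finset.sum_ite_eq'] at h1
  simpa using h1

end RelCells

end AbCover
end

noncomputable section
namespace AbCover
open HasAff

/-! ### Relative cells span the relative cycles -/

section RelCellsSpan

variable {B : Type*} [TopologicalSpace B] {J : Type*}

namespace RelCells

variable {A : Set B} {n : ℕ} {φ : J → C(Simp n, B)}

/-- The collapses of the single cells fix the boundaries, so they glue with the identity of `A`.
Continuity is checked on the locally finite closed cover by `A` and the closed cells. -/
theorem exists_collapse [T2Space B] (h : RelCells A n φ) : ∃ R : C(B × Simp 1, B),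
    (∀ y, R (y, endpt 0) = y) ∧ (∀ y ∈ A, ∀ s, R (y, s) = y) ∧
    ∀ j x s, R (φ j x, s) = φ j (collapse n (x, s)) := by
  classical
  let R : B × Simp 1 → B := fun p =>
    if h : ∃ q : J × Simp n, q.2 ∈ intSimp n ∧ φ q.1 q.2 = p.1 then
      φ h.choose.1 (collapse n (h.choose.2, p.2)) else p.1
  have hA : ∀ y ∈ A, ∀ s, R (y, s) = y := by
    intro y hy s
    refine dif_neg ?_
    rintro ⟨q, hq, hqy⟩
    exact h.int hq (mem_of_eq_of_mem hqy hy)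
  have hφ : ∀ j x s, R (φ j x, s) = φ j (collapse n (x, s)) := by
    intro j x s
    by_cases hx : x ∈ intSimp n
    · have h1 : ∃ q : J × Simp n, q.2 ∈ intSimp n ∧ φ q.1 q.2 = φ j x := ⟨(j, x), hx, rfl⟩
      refine (dif_pos h1).trans ?_
      obtain ⟨h2, h3⟩ := h.inj h1.choose_spec.1 h1.choose_spec.2
      rw [h2, h3]
    · have hx' := mem_bdry_of_not_int hx
      rw [hA _ (h.bdry hx'), collapse_bdry hx']
  have hc : Continuous R := by
    let T : Option J → Set (B × Simp 1) :=
      fun o => o.elim (Prod.fst ⁻¹' A) fun j => Prod.fst ⁻¹' range (φ j)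
    have hcl : ∀ o, IsClosed (T o) := by
      rintro (_ | j)
      · exact h.isClosed.preimage continuous_fst
      · exact (isCompact_range (φ j).continuous).isClosed.preimage continuous_fst
    have hlf : LocallyFinite T := by
      refine (locallyFinite_option (f := T)).2 ?_
      exact h.locallyFinite.preimage_continuous continuous_fst
    refine hlf.continuous (eq_univ_of_forall fun p => ?_) hcl ?_
    · rw [mem_iUnion]
      obtain hp | ⟨j, x, hx⟩ := h.cover p.1
      · exact ⟨none, hp⟩
      · exact ⟨some j, x, hx⟩
    · rintro (_ | j)
      · refine continuous_fst.continuousOn.congr fun p hp => ?_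
        exact hA p.1 hp p.2
      · let g : Simp n × Simp 1 → B × Simp 1 := Prod.map (φ j) id
        have hg : Continuous g := (φ j).continuous.prodMap continuous_id
        have hRg : Continuous (R ∘ g) := by
          have : R ∘ g = fun p => φ j (collapse n p) := funext fun p => hφ j p.1 p.2
          rw [this]
          exact (φ j).continuous.comp (collapse n).continuous
        -- The parametrization `g` goes from a compact space to a Hausdorff one, hence is closed,
        -- and continuity may be tested after composing with it.
        rw [continuousOn_iff_isClosed]
        intro t ht
        refine ⟨g '' ((R ∘ g) ⁻¹' t), ?_, ?_⟩
        · exact ((ht.preimage hRg).isCompact.image hg).isClosed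
        · ext p
          constructor
          · rintro ⟨hp, x, hx⟩
            have hgp : g (x, p.2) = p := Prod.ext hx rfl
            refine ⟨⟨(x, p.2), ?_, hgp⟩, x, hx⟩
            change R (g (x, p.2)) ∈ t
            rwa [hgp]
          · rintro ⟨⟨q, hq, rfl⟩, hp⟩
            exact ⟨hq, hp⟩
  refine ⟨⟨R, hc⟩, fun y => ?_, hA, hφ⟩
  obtain hy | ⟨j, x, rfl⟩ := h.cover y
  · exact hA y hy _
  · exact (hφ j x _).trans (by rw [collapse_zero])

/-- Injectivity on the open cell gives the lift. It is continuous because `φ j` sends closed sets to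
closed sets and the preimage of t under the lift is the preimage of `φ j '' t` under `σ`. -/
theorem exists_lift_simplex [T2Space B] (h : RelCells A n φ) {m : ℕ} {j : J} {σ : SingSimplex B m}
    (hσ : ∀ x, σ x ∈ φ j '' intSimp n) :
    ∃ τ : SingSimplex (Simp n) m, (∀ x, τ x ∈ intSimp n) ∧ (φ j).comp τ = σ := by
  choose τ hτ hτσ using hσ
  refine ⟨⟨τ, ?_⟩, hτ, ContinuousMap.ext hτσ⟩
  rw [continuous_iff_isClosed]
  intro t ht
  have : τ ⁻¹' t = σ ⁻¹' (φ j '' t) := by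
    ext x
    constructor
    · exact fun hx => ⟨τ x, hx, hτσ x⟩
    · rintro ⟨y, hy, hyx⟩
      obtain ⟨-, h2⟩ := h.inj (hτ x) ((hτσ x).trans hyx.symm)
      have h3 : τ x = y := h2
      rw [mem_preimage, h3]
      exact hy
  rw [this]
  exact (ht.isCompact.image (φ j).continuous).isClosed.preimage σ.continuous

/-- A singular simplex in one of the open cells. -/
def InCell (φ : J → C(Simp n, B)) {m : ℕ} (σ : SingSimplex B m) (q : J × SingSimplex (Simp n) m) :
    Prop := (∀ x, q.2 x ∈ intSimp n) ∧ (φ q.1).comp q.2 = σ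

theorem InCell.unique (h : RelCells A n φ) {m : ℕ} {σ : SingSimplex B m}
    {q q' : J × SingSimplex (Simp n) m} (hq : InCell φ σ q) (hq' : InCell φ σ q') : q = q' := by
  have h1 := fun x => h.inj (hq.1 x) (DFunLike.congr_fun (hq.2.trans hq'.2.symm) x)
  exact Prod.ext (h1 (vtx m 0)).1 (ContinuousMap.ext fun x => (h1 x).2)

theorem InCell.face {m : ℕ} {σ : SingSimplex B (m + 1)} {q : J × SingSimplex (Simp n) (m + 1)}
    (hq : InCell φ σ q) (i : Fin (m + 2)) :
    InCell φ (face i σ) (q.1, AbCover.face i q.2) :=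
  ⟨fun x => hq.1 _, by rw [← hq.2]; rfl⟩

open Classical in
/-- The part of a chain that lies in the open cells. -/
def cellPart (φ : J → C(Simp n, B)) (m : ℕ) : SChain B m →ₗ[ℤ] J →₀ SChain (Simp n) m :=
  Finsupp.linearCombination ℤ (fun σ =>
    if h : ∃ q, InCell φ σ q then Finsupp.single h.choose.1 (sOf h.choose.2) else 0)

theorem cellPart_of_inCell (h : RelCells A n φ) {m : ℕ} {σ : SingSimplex B m}
    {q : J × SingSimplex (Simp n) m} (hq : InCell φ σ q) :
    cellPart φ m (sOf σ) = Finsupp.single q.1 (sOf q.2) := by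
  have h1 : ∃ q, InCell φ σ q := ⟨q, hq⟩
  have h2 : h1.choose = q := InCell.unique h h1.choose_spec hq
  rw [cellPart, Finsupp.linearCombination_single, one_smul, dif_pos h1, h2]

theorem cellPart_of_not {m : ℕ} {σ : SingSimplex B m} (hσ : ¬ ∃ q, InCell φ σ q) :
    cellPart φ m (sOf σ) = 0 := by
  rw [cellPart, Finsupp.linearCombination_single, one_smul, dif_neg hσ]

/-- The open cover by the open cells and the complement of their cores. -/
def cellCover (φ : J → C(Simp n, B)) (o : Option J) : Set B :=
  o.elim {y | ∀ j, ∀ x ∈ coreSimp n, φ j x ≠ y} fun j => φ j '' intSimp n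

theorem isOpen_cellCover [T2Space B] (h : RelCells A n φ) (o : Option J) :
    IsOpen (cellCover φ o) := by
  cases o with
  | none =>
    have h1 : IsClosed (⋃ j, φ j '' coreSimp n) := by
      refine LocallyFinite.isClosed_iUnion
        (h.locallyFinite.subset fun j => image_subset_range _ _) fun j => ?_
      exact ((isClosed_coreSimp n).isCompact.image (φ j).continuous).isClosed
    convert h1.isOpen_compl
    ext y
    simp [cellCover]
  | some j =>
    refine h.isOpen_cell j ?_ subset_rfl
    simp only [intSimp, ofPred_forall]
    exact isOpen_iInter_of_finite fun i => isOpen_lt continuous_const (continuous_coord i)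

theorem mem_cellCover (φ : J → C(Simp n, B)) (y : B) : ∃ o, y ∈ cellCover φ o := by
  by_cases hy : ∃ j, y ∈ φ j '' intSimp n
  · obtain ⟨j, hj⟩ := hy
    exact ⟨some j, hj⟩
  · refine ⟨none, fun j x hx hxy => hy ⟨j, x, core_subset_int n hx, hxy⟩⟩

/-- `cellPart` fails to be a chain map only when a simplex outside the open cells has a face inside
one. For a small chain such a simplex misses all cores, so the defect does too. -/
theorem bdry_cellPart [T2Space B] (h : RelCells A n φ) (m : ℕ) (j : J) {c : SChain B (m + 1)}
    (hc : c ∈ supp (simpSub (cellCover φ) (m + 1))) :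
    singBdryInt _ m (cellPart φ (m + 1) c j) - cellPart φ m (singBdryInt B m c) j ∈
      supp (simpIn (coreSimp n)ᶜ m) := by
  classical
  refine supp_induction (singBdryInt _ m ∘ₗ Finsupp.lapply j ∘ₗ cellPart φ (m + 1) -
    Finsupp.lapply j ∘ₗ cellPart φ m ∘ₗ singBdryInt B m) _ (fun σ hσ => ?_) hc
  simp only [LinearMap.sub_apply, LinearMap.comp_apply, Finsupp.lapply_apply, singBdryInt_of,
    map_sum, map_smul]
  by_cases hq : ∃ q, InCell φ σ q
  · obtain ⟨q, hq⟩ := hq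
    rw [cellPart_of_inCell h hq]
    have h1 : ∀ i, cellPart φ m (sOf (face i σ)) =
        Finsupp.single q.1 (sOf (AbCover.face i q.2)) :=
      fun i => cellPart_of_inCell h (hq.face i)
    simp only [h1, Finsupp.single_apply]
    split_ifs
    · rw [singBdryInt_of, sub_self]
      exact Submodule.zero_mem _
    · simp
  · rw [cellPart_of_not hq, Finsupp.coe_zero, Pi.zero_apply, map_zero, zero_sub,
      Submodule.neg_mem_iff]
    refine Submodule.sum_mem _ fun i _ => ?_
    refine Submodule.smul_mem _ _ ?_
    obtain ⟨_ | j', ho⟩ := hσ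
    · by_cases hf : ∃ q, InCell φ (face i σ) q
      · obtain ⟨q, hf⟩ := hf
        rw [cellPart_of_inCell h hf, Finsupp.single_apply]
        split_ifs
        · refine sOf_mem_supp ?_
          rw [mem_simpIn]
          intro x hx
          exact ho (faceMap i x) q.1 (q.2 x) hx (DFunLike.congr_fun hf.2 x)
        · exact Submodule.zero_mem _
      · rw [cellPart_of_not hf]
        exact Submodule.zero_mem _
    · exfalso
      obtain ⟨τ, hτ, hτσ⟩ := h.exists_lift_simplex ho
      exact hq ⟨(j', τ), hτ, hτσ⟩

theorem cellPart_of_mem (h : RelCells A n φ) {m : ℕ} {c : SChain B m} (hc : c ∈ supp (simpIn A m)) :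
    cellPart φ m c = 0 := by
  refine (Submodule.mem_bot ℤ).1 (supp_induction (cellPart φ m) ⊥ (fun σ hσ => ?_) hc)
  rw [Submodule.mem_bot]
  refine cellPart_of_not ?_
  rintro ⟨q, hq, hqσ⟩
  rw [mem_simpIn] at hσ
  refine h.int (hq (vtx m 0)) (?_ : φ q.1 (q.2 (vtx m 0)) ∈ A)
  have : (φ q.1) (q.2 (vtx m 0)) = σ (vtx m 0) := DFunLike.congr_fun hqσ (vtx m 0)
  rw [this]
  exact hσ _

/-- Chains in the cells, as chains in the space. -/
def cellSum (φ : J → C(Simp n, B)) (m : ℕ) : (J →₀ SChain (Simp n) m) →ₗ[ℤ] SChain B m :=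
  Finsupp.lsum ℤ fun j => sMap (φ j) m

theorem sub_cellSum_mem [T2Space B] (h : RelCells A n φ) {m : ℕ} {c : SChain B m}
    (hc : c ∈ supp (simpSub (cellCover φ) m)) :
    c - cellSum φ m (cellPart φ m c) ∈ supp (simpIn (cellCover φ none) m) := by
  refine supp_induction (LinearMap.id - cellSum φ m ∘ₗ cellPart φ m) _ (fun σ hσ => ?_) hc
  rw [LinearMap.sub_apply, LinearMap.comp_apply, LinearMap.id_apply]
  by_cases hq : ∃ q, InCell φ σ q
  · obtain ⟨q, hq⟩ := hq
    rw [cellPart_of_inCell h hq, cellSum, Finsupp.lsum_single, sMap_of, hq.2, sub_self]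
    exact Submodule.zero_mem _
  · rw [cellPart_of_not hq, map_zero, sub_zero]
    obtain ⟨_ | j, ho⟩ := hσ
    · exact sOf_mem_supp (mem_simpIn.2 ho)
    · exfalso
      obtain ⟨τ, hτ, hτσ⟩ := h.exists_lift_simplex ho
      exact hq ⟨(j, τ), hτ, hτσ⟩

/-- The fundamental classes of the cells span the relative cycles. -/
theorem span [T2Space B] {φ : J → C(Simp (n + 1), B)} (h : RelCells A (n + 1) φ)
    {c : SChain B (n + 1)} (hc : singBdryInt B n c ∈ supp (simpIn A n)) :
    c ∈ relSpan A (range φ) := by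
  obtain ⟨R, hR0, hRA, hRφ⟩ := h.exists_collapse
  obtain ⟨k, hk⟩ := exists_sSd_small h.isOpen_cellCover (mem_cellCover φ) c
  have hk := hk k le_rfl
  refine mem_relSpan_of_sSd hc k ?_
  set c' := sSd B k (n + 1) c with hc'
  have hbd : singBdryInt B n c' ∈ supp (simpIn A n) := by
    rw [hc', singBdryInt_sSd]
    exact sSd_mem_supp k hc
  let G : ∀ m, SingSimplex B m → C(Simp m × Simp 1, B) :=
    fun m σ => R.comp (σ.prodMap (ContinuousMap.id _))
  refine mem_relSpan_of_sEnd G (fun m i σ => rfl) (fun m σ => ?_) hbd (fun σ hσ x => ?_) ?_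
  · ext1 x
    exact hR0 _
  · exact (hRA _ (mem_simpIn.1 hσ x.1) x.2).symm ▸ mem_simpIn.1 hσ x.1
  · let r : C(B, B) := R.comp (cylEnd B 1)
    have hr : sEnd G 1 (n + 1) c' = sMap r (n + 1) c' :=
      schain_induction (sEnd G 1 (n + 1)) (sMap r (n + 1))
        (fun σ => by rw [sEnd_of, sMap_of]; rfl) c'
    have hrφ : ∀ j, r.comp (φ j) = (φ j).comp ((collapse (n + 1)).comp (cylEnd _ 1)) :=
      fun j => ContinuousMap.ext fun x => hRφ j x _
    -- Split the small chain into its part in the open cells and the rest. The rest misses the cores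
    -- and is pushed into `A`; the first part is treated on standard simplices.
    rw [hr, ← sub_add_cancel c' (cellSum φ (n + 1) (cellPart φ (n + 1) c')), map_add]
    refine Submodule.add_mem _ (sub_mem_relSpan ?_) ?_
    · refine sMap_mem_supp r (fun σ hσ => ?_) (sub_cellSum_mem h hk)
      rw [mem_simpIn] at hσ ⊢
      intro x
      change R (σ x, endpt 1) ∈ A
      obtain hA | ⟨j, y, hy⟩ := h.cover (σ x)
      · rwa [hRA _ hA]
      · rw [← hy, hRφ]
        exact h.bdry (collapse_one fun hy' => hσ x j y hy' hy)
    · rw [cellSum, Finsupp.lsum_apply, Finsupp.sum, map_sum]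
      refine Submodule.sum_mem _ fun j _ => ?_
      have h1 : sMap r (n + 1) (sMap (φ j) (n + 1) (cellPart φ (n + 1) c' j)) =
          sMap (φ j) (n + 1) (sMap ((collapse (n + 1)).comp (cylEnd _ 1)) (n + 1)
            (cellPart φ (n + 1) c' j)) := by
        refine schain_induction (sMap r (n + 1) ∘ₗ sMap (φ j) (n + 1))
          (sMap (φ j) (n + 1) ∘ₗ sMap ((collapse (n + 1)).comp (cylEnd _ 1)) (n + 1))
          (fun σ => ?_) _
        simp only [LinearMap.comp_apply, sMap_of, ← ContinuousMap.comp_assoc, hrφ]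
      rw [h1]
      refine sMap_mem_relSpan (φ j) (fun x hx => h.bdry hx) (fun σ hσ => ?_)
        (simplex_cycle_mem ?_)
      · rw [mem_singleton_iff.1 hσ]
        exact ⟨j, rfl⟩
      -- The boundary of `c'` lies in `A` and has no part in the cells, so the lifted chain has its
      -- boundary off the core. The collapse makes it a relative cycle of the simplex modulo its
      -- boundary.
      · rw [singBdryInt_sMap]
        have h2 := h.bdry_cellPart n j hk
        rw [h.cellPart_of_mem hbd, Finsupp.coe_zero, Pi.zero_apply, sub_zero] at h2
        refine sMap_mem_supp _ (fun σ hσ => ?_) h2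
        rw [mem_simpIn] at hσ ⊢
        exact fun x => collapse_one (hσ x)

/-- In dimension zero, every chain is a combination of cells. -/
theorem span_zero {φ : J → C(Simp 0, B)} (h : RelCells A 0 φ) (c : SChain B 0) :
    c ∈ relSpan A (range φ) := by
  have hd : c ∈ supp univ := by
    rw [supp, Finsupp.supported_univ]
    trivial
  refine supp_induction LinearMap.id _ (fun σ _ => ?_) hd
  rw [LinearMap.id_apply]
  have hs : ∀ x : Simp 0, x = vtx 0 0 := fun x => by
    have : Subsingleton (Simp 0) := inferInstanceAs (Subsingleton (stdSimplex ℝ (Fin 1)))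
    exact Subsingleton.elim _ _
  obtain hA | ⟨j, x, hx⟩ := h.cover (σ (vtx 0 0))
  · refine sub_mem_relSpan (sOf_mem_supp (mem_simpIn.2 fun x => ?_))
    rwa [hs x]
  · refine of_mem_relSpan ⟨j, ContinuousMap.ext fun y => ?_⟩
    rw [hs y, ← hx, hs x]

end RelCells

end RelCellsSpan

end AbCover
end

noncomputable section
namespace AbCover
open HasAff

/-! ### Equivariant chains -/

section Equivariant

variable (H : Type w) [CommGroup H] {Y : Type v} [TopologicalSpace Y] [MulAction H Y]
  [ContinuousConstSMul H Y]

/-- Equivariant singular chains as integral singular chains. -/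
def toInt (n : ℕ) : SingChain H Y n ≃+ SChain Y n :=
  (singRep H Y n).asModuleEquiv.toAddEquiv

theorem toInt_singOf {n : ℕ} (σ : SingSimplex Y n) : toInt H n (singOf H σ) = sOf σ := rfl

theorem toInt_singBdry (n : ℕ) (c : SingChain H Y (n + 1)) :
    toInt H n (singBdry H Y n c) = singBdryInt Y n (toInt H (n + 1) c) := rfl

theorem single_smul_singOf {n : ℕ} (h : H) (a : ℤ) (σ : SingSimplex Y n) :
    toInt H n (MonoidAlgebra.single h a • singOf H σ) = a • sOf (h • σ) := by
  rw [Representation.single_smul]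
  change toInt H n (a • (toInt H n).symm (singRep H Y n h (sOf σ))) = _
  rw [map_zsmul, AddEquiv.apply_symm_apply]
  congr 1
  simp [singRep]

/-- A set that is preserved by the action. -/
def Invariant (S : Set Y) : Prop := ∀ (h : H), ∀ y ∈ S, h • y ∈ S

variable {H}

theorem monoidAlgebra_induction {p : MonoidAlgebra ℤ H → Prop} (x : MonoidAlgebra ℤ H)
    (h0 : p 0) (hadd : ∀ x y, p x → p y → p (x + y))
    (hs : ∀ h a, p (MonoidAlgebra.single h a)) : p x := by
  have h1 : ∀ f : H →₀ ℤ, p (MonoidAlgebra.ofCoeff f) := fun f => by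
    induction f using Finsupp.induction_linear with
    | zero => exact h0
    | add f g hf hg => exact hadd _ _ hf hg
    | single h a => exact hs h a
  exact h1 x.coeff

theorem Invariant.smul_mem_supp {S : Set Y} (hS : Invariant H S) {n : ℕ} (r : MonoidAlgebra ℤ H)
    {c : SingChain H Y n} (hc : toInt H n c ∈ supp (simpIn S n)) :
    toInt H n (r • c) ∈ supp (simpIn S n) := by
  induction r using monoidAlgebra_induction with
  | h0 => rw [zero_smul, map_zero]; exact Submodule.zero_mem _
  | hadd x y hx hy => rw [add_smul, map_add]; exact Submodule.add_mem _ hx hy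
  | hs h a =>
    rw [Representation.single_smul]
    change toInt H n (a • (toInt H n).symm (singRep H Y n h (toInt H n c))) ∈ _
    rw [map_zsmul, AddEquiv.apply_symm_apply]
    refine Submodule.smul_mem _ _ (supp_induction (singRep H Y n h) _ (fun σ hσ => ?_) hc)
    have : singRep H Y n h (sOf σ) = sOf (h • σ) := by simp [singRep]
    rw [this]
    refine sOf_mem_supp ?_
    rw [mem_simpIn] at hσ ⊢
    exact fun x => hS h _ (hσ x)

/-- For an invariant set the integral span of its simplices is already stable under the group ring,
so equivariant questions reduce to integral ones. -/
theorem mem_chainsIn {S : Set Y} (hS : Invariant H S) {n : ℕ} {c : SingChain H Y n} :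
    c ∈ chainsIn H S n ↔ toInt H n c ∈ supp (simpIn S n) := by
  constructor
  · intro hc
    induction hc using Submodule.span_induction with
    | mem x hx =>
      obtain ⟨σ, hσ, rfl⟩ := hx
      exact sOf_mem_supp hσ
    | zero => rw [map_zero]; exact Submodule.zero_mem _
    | add x y _ _ hx hy => rw [map_add]; exact Submodule.add_mem _ hx hy
    | smul r x _ hx => exact hS.smul_mem_supp r hx
  · intro hc
    have h1 := supp_induction ((toInt H n).symm.toAddMonoidHom.toIntLinearMap)
      ((chainsIn H S n).toAddSubgroup.toIntSubmodule)
      (fun σ hσ => (Submodule.subset_span ⟨σ, hσ, rfl⟩ : singOf H σ ∈ chainsIn H S n)) hc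
    have h2 : (toInt H n).symm (toInt H n c) ∈ chainsIn H S n := h1
    rwa [AddEquiv.symm_apply_apply] at h2

theorem mem_relCycles_succ {S T : Set Y} (hS : Invariant H S) (hT : Invariant H T) {n : ℕ}
    {c : SingChain H Y (n + 1)} : c ∈ relCycles H S T (n + 1) ↔
      toInt H (n + 1) c ∈ supp (simpIn S (n + 1)) ∧
        singBdryInt Y n (toInt H (n + 1) c) ∈ supp (simpIn T n) := by
  rw [← mem_chainsIn hS, ← toInt_singBdry, ← mem_chainsIn hT]
  rfl

theorem toInt_mem_of_mem_relCycles {S T : Set Y} (hS : Invariant H S) {n : ℕ}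
    {c : SingChain H Y n} (hc : c ∈ relCycles H S T n) : toInt H n c ∈ supp (simpIn S n) := by
  cases n with
  | zero => exact (mem_chainsIn hS).1 hc
  | succ n => exact (mem_chainsIn hS).1 hc.1

theorem mem_relBoundaries {S T : Set Y} (hS : Invariant H S) (hT : Invariant H T) {n : ℕ}
    {c : SingChain H Y n} : c ∈ relBoundaries H S T n ↔
      ∃ b ∈ supp (simpIn S (n + 1)), ∃ a ∈ supp (simpIn T n),
        toInt H n c = singBdryInt Y n b + a := by
  constructor
  · intro hc
    obtain ⟨_, ⟨b, hb, rfl⟩, a, ha, rfl⟩ := Submodule.mem_sup.1 hc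
    refine ⟨toInt H _ b, (mem_chainsIn hS).1 hb, toInt H _ a, (mem_chainsIn hT).1 ha, ?_⟩
    rw [map_add, toInt_singBdry]
  · rintro ⟨b, hb, a, ha, h⟩
    refine Submodule.mem_sup.2 ⟨singBdry H Y n ((toInt H _).symm b), ⟨_, ?_, rfl⟩,
      (toInt H _).symm a, ?_, ?_⟩
    · exact (mem_chainsIn hS).2 (by rwa [AddEquiv.apply_symm_apply])
    · exact (mem_chainsIn hT).2 (by rwa [AddEquiv.apply_symm_apply])
    · apply (toInt H n).injective
      rw [map_add, toInt_singBdry, h, AddEquiv.apply_symm_apply, AddEquiv.apply_symm_apply]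

/-- The inclusion of a subset. -/
abbrev incl (S : Set Y) : C(S, Y) := ⟨Subtype.val, continuous_subtype_val⟩

theorem exists_sMap_incl {S : Set Y} {n : ℕ} {c : SChain Y n} (hc : c ∈ supp (simpIn S n)) :
    ∃ c', sMap (incl S) n c' = c := by
  have := supp_induction LinearMap.id (LinearMap.range (sMap (incl S) n)) (fun σ hσ => ?_) hc
  · exact this
  · rw [mem_simpIn] at hσ
    refine ⟨sOf ⟨fun x => ⟨σ x, hσ x⟩, σ.continuous.subtype_mk _⟩, ?_⟩
    rw [sMap_of]
    rfl

theorem sMap_incl_injective (S : Set Y) (n : ℕ) : Function.Injective (sMap (incl S) n) := by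
  refine Finsupp.mapDomain_injective fun σ τ h => ContinuousMap.ext fun x => Subtype.ext ?_
  exact DFunLike.congr_fun h x

theorem mem_supp_of_sMap_incl {S T : Set Y} (hTS : T ⊆ S) {n : ℕ} {c : SChain S n}
    (hc : sMap (incl S) n c ∈ supp (simpIn T n)) :
    c ∈ supp (simpIn (Subtype.val ⁻¹' T : Set S) n) := by
  have := supp_induction LinearMap.id ((supp (simpIn (Subtype.val ⁻¹' T : Set S) n)).map
    (sMap (incl S) n)) (fun σ hσ => ?_) hc
  · obtain ⟨c', hc', h⟩ := this
    rwa [← sMap_incl_injective S n h]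
  · rw [mem_simpIn] at hσ
    refine ⟨sOf ⟨fun x => ⟨σ x, hTS (hσ x)⟩, σ.continuous.subtype_mk _⟩, ?_, ?_⟩
    · exact sOf_mem_supp (mem_simpIn.2 fun x => hσ x)
    · rw [sMap_of]
      rfl

/-- Equivariant cells: the translates of the `φ e` are the cells of the pair `(S, T)`. -/
structure EquivCells (H : Type w) [CommGroup H] {Y : Type v} [TopologicalSpace Y] [MulAction H Y]
    [ContinuousConstSMul H Y] (S T : Set Y) (n : ℕ) {E : Type*} (φ : E → C(Simp n, Y)) : Prop where
  invS : Invariant H S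
  invT : Invariant H T
  subset : T ⊆ S
  mem (e x) : φ e x ∈ S
  cells : RelCells (Subtype.val ⁻¹' T : Set S) n (fun j : E × H =>
    (⟨fun x => ⟨j.2 • φ j.1 x, invS _ _ (mem _ _)⟩,
      ((φ j.1).continuous.const_smul _).subtype_mk _⟩ : C(Simp n, S)))

namespace EquivCells

variable {S T : Set Y} {n : ℕ} {E : Type*} {φ : E → C(Simp n, Y)} (hE : EquivCells H S T n φ)
include hE

theorem bdry_mem {e : E} {x : Simp n} (hx : x ∈ bdrySimp n) : φ e x ∈ T := by
  have := hE.cells.bdry (j := (e, 1)) hx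
  have h2 : (1 : H) • φ e x ∈ T := this
  rwa [one_smul] at h2

theorem singOf_mem (e : E) : singOf H (φ e) ∈ relCycles H S T n := by
  have h1 : sOf (φ e) ∈ supp (simpIn S n) := sOf_mem_supp (mem_simpIn.2 (hE.mem e))
  cases n with
  | zero => exact (mem_chainsIn hE.invS).2 h1
  | succ n =>
    rw [mem_relCycles_succ hE.invS hE.invT, toInt_singOf]
    refine ⟨h1, ?_⟩
    rw [singBdryInt_of]
    refine Submodule.sum_mem _ fun i _ => Submodule.smul_mem _ _ (sOf_mem_supp ?_)
    rw [mem_simpIn]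
    exact fun x => hE.bdry_mem ⟨i, faceMap_apply_self i x⟩

/-- The class of a cell. -/
def cellClass (e : E) : RelHomology H S T n :=
  Submodule.Quotient.mk ⟨singOf H (φ e), hE.singOf_mem e⟩

omit hE in
/-- The chain of cells with given coefficients. -/
theorem toInt_sum_cells (f : E →₀ MonoidAlgebra ℤ H) :
    toInt H n (f.sum fun e r => r • singOf H (φ e)) =
      Finsupp.linearCombination ℤ (fun j : E × H => sOf (j.2 • φ j.1))
        ((Finsupp.curryLinearEquiv ℤ).symm
          (f.mapRange MonoidAlgebra.coeff (MonoidAlgebra.coeff_zero))) := by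
  induction f using Finsupp.induction_linear with
  | zero =>
    rw [Finsupp.sum_zero_index, map_zero, Finsupp.mapRange_zero, map_zero, map_zero]
  | add f g hf hg =>
    rw [Finsupp.sum_add_index' (h := fun e r => r • singOf H (φ e)) (fun _ => zero_smul _ _) (fun _ _ _ => add_smul _ _ _), map_add,
      hf, hg, Finsupp.mapRange_add (fun _ _ => rfl), map_add, map_add]
  | single e r =>
    rw [Finsupp.sum_single_index (h := fun e r => r • singOf H (φ e)) (zero_smul _ _), Finsupp.mapRange_single]
    induction r using monoidAlgebra_induction with
    | h0 =>
      rw [zero_smul, map_zero, MonoidAlgebra.coeff_zero, Finsupp.single_zero, map_zero, map_zero]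
    | hadd x y hx hy =>
      rw [add_smul, map_add, hx, hy, MonoidAlgebra.coeff_add, Finsupp.single_add, map_add, map_add]
    | hs h a =>
      rw [single_smul_singOf, MonoidAlgebra.coeff_single]
      have : (Finsupp.curryLinearEquiv ℤ).symm (Finsupp.single e (Finsupp.single h a)) =
          Finsupp.single (e, h) a := by
        rw [LinearEquiv.symm_apply_eq]
        ext e' h'
        simp [Finsupp.curryLinearEquiv]
      rw [this, Finsupp.linearCombination_single]

variable [T2Space Y]

/-- After currying, a group-ring relation between the chosen cells is an integral relation between
all their translates, and `RelCells.indep` applies inside the subspace `S`. -/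
theorem linearIndependent_cellClass : LinearIndependent (MonoidAlgebra ℤ H) hE.cellClass := by
  rw [linearIndependent_iff]
  intro f hf
  have h1 : (f.sum fun e r => r • singOf H (φ e)) ∈ relBoundaries H S T n := by
    have h2 : Finsupp.linearCombination (MonoidAlgebra ℤ H) hE.cellClass f = Submodule.Quotient.mk
        (f.sum fun e r => r • (⟨singOf H (φ e), hE.singOf_mem e⟩ : relCycles H S T n)) := by
      rw [Finsupp.linearCombination_apply, ← Submodule.mkQ_apply, map_finsuppSum]
      rfl
    rw [hf, eq_comm, Submodule.Quotient.mk_eq_zero, Submodule.submoduleOf, Submodule.mem_comap,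
      map_finsuppSum] at h2
    exact h2
  rw [mem_relBoundaries hE.invS hE.invT, toInt_sum_cells] at h1
  obtain ⟨b, hb, a, ha, h2⟩ := h1
  set m := (Finsupp.curryLinearEquiv ℤ).symm
    (f.mapRange MonoidAlgebra.coeff (MonoidAlgebra.coeff_zero)) with hm
  obtain ⟨b', rfl⟩ := exists_sMap_incl hb
  obtain ⟨a', rfl⟩ := exists_sMap_incl (Finsupp.supported_mono (R := ℤ) (M := ℤ)
    (fun σ (hσ : σ ∈ simpIn T n) => mem_simpIn.2 fun x => hE.subset (mem_simpIn.1 hσ x)) ha)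
  have h3 := hE.cells.indep m b' (mem_supp_of_sMap_incl hE.subset ha) ?_
  · rw [hm, LinearEquiv.map_eq_zero_iff] at h3
    ext1 e
    have h4 := DFunLike.congr_fun h3 e
    rw [Finsupp.mapRange_apply] at h4
    exact MonoidAlgebra.coeff_eq_zero.1 h4
  · apply sMap_incl_injective S n
    rw [map_add, ← singBdryInt_sMap, ← h2, Finsupp.linearCombination_apply,
      Finsupp.linearCombination_apply, map_finsuppSum]
    refine Finsupp.sum_congr fun j _ => ?_
    rw [map_smul, sMap_of]
    rfl

/-- `RelCells.span` writes a cycle, modulo relative boundaries, by translates of the chosen cells,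
and each translate is a group element times a chosen cell. -/
theorem span_cellClass : ⊤ ≤ Submodule.span (MonoidAlgebra ℤ H) (range hE.cellClass) := by
  rintro x -
  obtain ⟨⟨c, hc⟩, rfl⟩ := Submodule.Quotient.mk_surjective _ x
  obtain ⟨c', hc'⟩ := exists_sMap_incl (toInt_mem_of_mem_relCycles hE.invS hc)
  have h1 : c' ∈ relSpan (Subtype.val ⁻¹' T : Set S) (range fun j : E × H =>
      (⟨fun x => ⟨j.2 • φ j.1 x, hE.invS _ _ (hE.mem _ _)⟩,
        ((φ j.1).continuous.const_smul _).subtype_mk _⟩ : C(Simp n, S))) := by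
    cases n with
    | zero => exact hE.cells.span_zero c'
    | succ n =>
      refine hE.cells.span (mem_supp_of_sMap_incl hE.subset ?_)
      rw [← singBdryInt_sMap, hc']
      exact ((mem_relCycles_succ hE.invS hE.invT).1 hc).2
  obtain ⟨p, hp, r, hr, hpr⟩ := Submodule.mem_sup.1 h1
  obtain ⟨_, ⟨b, rfl⟩, a, ha, rfl⟩ := Submodule.mem_sup.1 hr
  have h2 : (toInt H n).symm (sMap (incl S) n p) ∈ (Submodule.span (MonoidAlgebra ℤ H)
      (range fun e => (⟨singOf H (φ e), hE.singOf_mem e⟩ : relCycles H S T n))).map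
        (relCycles H S T n).subtype := by
    refine supp_induction (((toInt H n).symm.toAddMonoidHom.toIntLinearMap) ∘ₗ sMap (incl S) n)
      ((Submodule.map (relCycles H S T n).subtype _).toAddSubgroup.toIntSubmodule) ?_ hp
    rintro _ ⟨⟨e, h⟩, rfl⟩
    refine ⟨MonoidAlgebra.single h 1 • ⟨singOf H (φ e), hE.singOf_mem e⟩,
      Submodule.smul_mem _ _ (Submodule.subset_span ⟨e, rfl⟩), ?_⟩
    apply (toInt H n).injective
    refine (single_smul_singOf H h 1 (φ e)).trans ?_
    rw [one_smul, LinearMap.comp_apply, sMap_of]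
    exact ((toInt H n).apply_symm_apply _).symm
  obtain ⟨⟨q, hq⟩, hqs, hqp⟩ := h2
  have h3 : (Submodule.Quotient.mk ⟨c, hc⟩ : RelHomology H S T n) =
      Submodule.Quotient.mk ⟨q, hq⟩ := by
    rw [Submodule.Quotient.eq]
    change c - q ∈ relBoundaries H S T n
    rw [mem_relBoundaries hE.invS hE.invT]
    refine ⟨sMap (incl S) _ b, ?_, sMap (incl S) _ a, ?_, ?_⟩
    · have hb : b ∈ supp univ := by
        rw [supp, Finsupp.supported_univ]
        trivial
      exact sMap_mem_supp _ (fun σ _ => mem_simpIn.2 fun x => (σ x).2) hb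
    · exact sMap_mem_supp _ (fun σ hσ => mem_simpIn.2 fun x => mem_simpIn.1 hσ x) ha
    · rw [map_sub, ← hc', ← hpr, map_add, map_add, ← singBdryInt_sMap]
      have : toInt H n q = sMap (incl S) n p := by
        rw [← AddEquiv.eq_symm_apply]
        exact hqp
      rw [this]
      abel
  rw [h3]
  have h4 := Submodule.mem_map_of_mem 
    (f := ((relBoundaries H S T n).submoduleOf (relCycles H S T n)).mkQ) hqs
  rw [Submodule.map_span, ← range_comp] at h4
  exact h4

/-- The basis of the relative homology of an equivariant relative cell complex. -/
def basis : Module.Basis E (MonoidAlgebra ℤ H) (RelHomology H S T n) :=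
  Module.Basis.mk hE.linearIndependent_cellClass hE.span_cellClass

theorem basis_apply (e : E) : hE.basis e = hE.cellClass e := Module.Basis.mk_apply _ _ e

end EquivCells

end Equivariant

end AbCover
end

noncomputable section
namespace AbCover
open HasAff

/-! ### Topology of quotient coverings -/

section Cover

variable {X : Type u} [TopologicalSpace X] [T2Space X] {Y : Type v} [TopologicalSpace Y]
  {H : Type w} [CommGroup H] [MulAction H Y] {p : Y → X} (hp : IsQuotientCoveringMap p H)
include hp

theorem t2Space_of_cover : T2Space Y := by
  refine ⟨fun y y' hne => ?_⟩
  by_cases h : p y = p y'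
  · exact hp.isCoveringMap.isSeparatedMap y y' h hne
  · obtain ⟨U, V, hU, hV, hy, hy', hd⟩ := t2_separation h
    exact ⟨p ⁻¹' U, p ⁻¹' V, hU.preimage hp.continuous, hV.preimage hp.continuous, hy, hy',
      hd.preimage p⟩

/-- By compactness it is enough to look near one point k. If k and y lie in one orbit, a
neighbourhood of y with disjoint translates leaves a single group element; otherwise disjoint
neighbourhoods in the Hausdorff base leave none. -/
theorem finite_translates {K : Set Y} (hK : IsCompact K) (y : Y) :
    ∃ U ∈ 𝓝 y, {h : H | ((h • ·) '' K ∩ U).Nonempty}.Finite := by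
  have := hp.toContinuousConstSMul
  refine hK.induction_on (p := fun K => ∃ U ∈ 𝓝 y, {h : H | ((h • ·) '' K ∩ U).Nonempty}.Finite)
    ⟨univ, Filter.univ_mem, by simp⟩ ?_ ?_ ?_
  · rintro s t hst ⟨U, hU, hf⟩
    exact ⟨U, hU, hf.subset fun h hh => hh.mono (by gcongr)⟩
  · rintro s t ⟨U, hU, hf⟩ ⟨V, hV, hg⟩
    refine ⟨U ∩ V, Filter.inter_mem hU hV, (hf.union hg).subset ?_⟩
    rintro h ⟨_, ⟨x, hx | hx, rfl⟩, hxU, hxV⟩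
    · exact Or.inl ⟨_, ⟨x, hx, rfl⟩, hxU⟩
    · exact Or.inr ⟨_, ⟨x, hx, rfl⟩, hxV⟩
  · intro k _
    by_cases hky : p k = p y
    · obtain ⟨g, rfl⟩ := hp.apply_eq_iff_mem_orbit.1 hky
      obtain ⟨W, hW, hd⟩ := hp.disjoint y
      refine ⟨(g⁻¹ • ·) ⁻¹' W, mem_nhdsWithin_of_mem_nhds
        ((continuous_const_smul g⁻¹).continuousAt.preimage_mem_nhds ?_), W, hW,
        (finite_singleton g⁻¹).subset ?_⟩
      · simpa using hW
      · rintro h ⟨_, ⟨x, hx, rfl⟩, hxW⟩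
        have : h * g = 1 := hd _ ⟨h • x, ⟨g⁻¹ • x, hx, by simp [smul_smul]⟩, hxW⟩
        exact eq_inv_of_mul_eq_one_left this
    · obtain ⟨U, V, hU, hV, hk, hy, hd⟩ := t2_separation hky
      refine ⟨p ⁻¹' U, mem_nhdsWithin_of_mem_nhds ((hU.preimage hp.continuous).mem_nhds hk),
        p ⁻¹' V, (hV.preimage hp.continuous).mem_nhds hy, ?_⟩
      convert finite_empty
      rw [eq_empty_iff_forall_notMem]
      rintro h ⟨_, ⟨x, hx, rfl⟩, hxV⟩
      refine disjoint_left.1 hd hx ?_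
      have : p (h • x) ∈ V := hxV
      rwa [hp.map_smul] at this

theorem locallyFinite_translates {E : Type*} [Finite E] {K : E → Set Y}
    (hK : ∀ e, IsCompact (K e)) :
    LocallyFinite fun j : E × H => (j.2 • ·) '' K j.1 := by
  intro y
  choose U hU hf using fun e => finite_translates hp (hK e) y
  refine ⟨⋂ e, U e, Filter.iInter_mem.2 hU,
    (finite_iUnion fun e => (hf e).image (Prod.mk e)).subset ?_⟩
  rintro ⟨e, h⟩ ⟨x, hx, hxU⟩
  exact mem_iUnion.2 ⟨e, h, ⟨x, hx, mem_iInter.1 hxU e⟩, rfl⟩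

/-- A group that acts on a connected space by deck transformations is finitely generated if the
translates of a compact set cover the space. -/
theorem fg_of_compact_cover [PreconnectedSpace Y] [Nonempty Y] {K : Set Y} (hK : IsCompact K)
    (hcov : ∀ y, ∃ (h : H), ∃ k ∈ K, h • k = y) : Group.FG H := by
  have hlf (S : Set H) : IsClosed (⋃ h ∈ S, (h • ·) '' K) := by
    have := t2Space_of_cover hp
    have := hp.toContinuousConstSMul
    have h1 := locallyFinite_translates hp (E := Unit) (K := fun _ => K) fun _ => hK
    have h2 : LocallyFinite fun h : S => ((h : H) • ·) '' K :=
      h1.comp_injective (g := fun h : S => ((), (h : H))) fun a b h =>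
        Subtype.ext (congrArg Prod.snd h)
    rw [biUnion_eq_iUnion]
    exact h2.isClosed_iUnion fun h => (hK.image (continuous_const_smul _)).isClosed
  have hT : {h : H | ((h • ·) '' K ∩ K).Nonempty}.Finite := by
    choose U hU hf using fun y => finite_translates hp hK y
    obtain ⟨t, -, ht⟩ := hK.elim_nhds_subcover U fun y _ => hU y
    refine (t.finite_toSet.biUnion fun y _ => hf y).subset ?_
    rintro h ⟨x, hx, hxK⟩
    obtain ⟨y, hy, hxy⟩ := mem_iUnion₂.1 (ht hxK)
    exact mem_iUnion₂.2 ⟨y, hy, x, hx, hxy⟩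
  -- The translates of `K` under `G` and those under its complement are disjoint, since overlapping
  -- translates differ by a generator. Both unions are closed by local finiteness, so connectedness
  -- leaves only `G`.
  set G := Subgroup.closure {h : H | ((h • ·) '' K ∩ K).Nonempty} with hG
  refine ⟨hT.toFinset, ?_⟩
  rw [Finite.coe_toFinset, ← hG, eq_top_iff]
  have hcompl : (⋃ h ∈ (G : Set H), (h • ·) '' K)ᶜ = ⋃ h ∈ (G : Set H)ᶜ, (h • ·) '' K := by
    ext y
    constructor
    · intro hy
      obtain ⟨h, k, hk, rfl⟩ := hcov y
      refine mem_iUnion₂.2 ⟨h, fun hh => hy (mem_iUnion₂.2 ⟨h, hh, k, hk, rfl⟩), k, hk, rfl⟩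
    · intro hy hy'
      obtain ⟨h, hh, k, hk, rfl⟩ := mem_iUnion₂.1 hy
      obtain ⟨h', hh', k', hk', heq⟩ := mem_iUnion₂.1 hy'
      refine hh ?_
      have h1 : h'⁻¹ * h ∈ G := Subgroup.subset_closure
        ⟨k', ⟨k, hk, by simp only [mul_smul, ← heq, inv_smul_smul]⟩, hk'⟩
      simpa using G.mul_mem hh' h1
  have hclopen : IsClopen (⋃ h ∈ (G : Set H), (h • ·) '' K) :=
    ⟨hlf _, by rw [← isClosed_compl_iff, hcompl]; exact hlf _⟩
  have hne : (⋃ h ∈ (G : Set H), (h • ·) '' K).Nonempty := by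
    obtain ⟨h, k, hk, -⟩ := hcov (Classical.arbitrary Y)
    exact ⟨(1 : H) • k, mem_iUnion₂.2 ⟨1, G.one_mem, k, hk, rfl⟩⟩
  have huniv := hclopen.eq_univ hne
  rw [← compl_empty_iff, hcompl] at huniv
  obtain ⟨-, k, hk, -⟩ := hcov (Classical.arbitrary Y)
  intro h _
  by_contra hh
  have : h • k ∈ (∅ : Set Y) := huniv ▸ mem_iUnion₂.2 ⟨h, hh, k, hk, rfl⟩
  exact this

end Cover

/-! ### Simplices and balls -/

/-- Dropping the zeroth coordinate identifies the simplex with the closure of a bounded convex open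
set, and an ambient homeomorphism takes this to the unit ball. The sup norm is used because
characteristic maps live on `Fin n → ℝ`. -/
theorem exists_simplex_ball (n : ℕ) : ∃ θ : Simp n → (Fin n → ℝ), Continuous θ ∧
    Function.Injective θ ∧ range θ = Metric.closedBall 0 1 ∧
    (∀ x ∈ intSimp n, θ x ∈ Metric.ball 0 1) ∧ ∀ x ∈ bdrySimp n, θ x ∈ Metric.sphere 0 1 := by
  set U : Set (Fin n → ℝ) := {y | (∀ i, 0 < y i) ∧ ∑ i, y i < 1} with hU
  set D : Set (Fin n → ℝ) := {y | (∀ i, 0 ≤ y i) ∧ ∑ i, y i ≤ 1} with hD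
  have hUD : U ⊆ D := fun y hy => ⟨fun i => (hy.1 i).le, hy.2.le⟩
  have hsum : Continuous fun y : Fin n → ℝ => ∑ i, y i :=
    continuous_finsetSum _ fun i _ => continuous_apply i
  have hUo : IsOpen U := by
    have : U = (⋂ i, {y | 0 < y i}) ∩ {y | ∑ i, y i < 1} := by
      ext y; simp [hU]
    rw [this]
    exact (isOpen_iInter_of_finite fun i => isOpen_lt continuous_const (continuous_apply i)).inter
      (isOpen_lt hsum continuous_const)
  have hDc : IsClosed D := by
    have : D = (⋂ i, {y | 0 ≤ y i}) ∩ {y | ∑ i, y i ≤ 1} := by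
      ext y; simp [hD]
    rw [this]
    exact (isClosed_iInter fun i => isClosed_le continuous_const (continuous_apply i)).inter
      (isClosed_le hsum continuous_const)
  have hn : (0 : ℝ) < n + 1 := by positivity
  have hc : (fun _ => 1 / (n + 1 : ℝ) : Fin n → ℝ) ∈ U := by
    refine ⟨fun i => by positivity, ?_⟩
    rw [Finset.sum_const, Finset.card_univ, Fintype.card_fin, nsmul_eq_mul, mul_one_div,
      div_lt_one hn]
    linarith
  have hseg : ∀ y ∈ D, ∀ c ∈ U, ∀ t ∈ Ioc (0 : ℝ) 1, (1 - t) • y + t • c ∈ U := by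
    intro y hy c hc t ht
    refine ⟨fun i => ?_, ?_⟩
    · have h1 := mul_nonneg (sub_nonneg.2 ht.2) (hy.1 i)
      have h2 := mul_pos ht.1 (hc.1 i)
      simp only [Pi.add_apply, Pi.smul_apply, smul_eq_mul]
      linarith
    · simp only [Pi.add_apply, Pi.smul_apply, smul_eq_mul, Finset.sum_add_distrib,
        ← Finset.mul_sum]
      have h1 := mul_le_mul_of_nonneg_left hy.2 (sub_nonneg.2 ht.2)
      have h2 := mul_lt_mul_of_pos_left hc.2 ht.1
      linarith
  have hcl : closure U = D := by
    refine Subset.antisymm (closure_minimal hUD hDc) fun y hy => ?_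
    have h1 : Filter.Tendsto (fun t : ℝ => (1 - t) • y + t • (fun _ => 1 / (n + 1 : ℝ) : Fin n → ℝ))
        (𝓝[>] 0) (𝓝 y) := by
      have h2 : Continuous fun t : ℝ =>
          (1 - t) • y + t • (fun _ => 1 / (n + 1 : ℝ) : Fin n → ℝ) := by fun_prop
      have h3 := h2.tendsto 0
      simp only [sub_zero, one_smul, zero_smul, add_zero] at h3
      exact h3.mono_left nhdsWithin_le_nhds
    refine mem_closure_of_tendsto h1 ?_
    filter_upwards [Ioc_mem_nhdsGT (zero_lt_one' ℝ)] with t ht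
    exact hseg y hy _ hc t ht
  have hconv : Convex ℝ U := by
    rw [convex_iff_forall_pos]
    intro x hx y hy a b ha hb hab
    have := hseg x (hUD hx) y hy b ⟨hb, by linarith⟩
    rwa [show 1 - b = a by linarith] at this
  have hbd : Bornology.IsBounded U := by
    refine (Metric.isBounded_closedBall (x := 0) (r := 1)).subset fun y hy => ?_
    rw [mem_closedBall_zero_iff, pi_norm_le_iff_of_nonneg zero_le_one]
    intro i
    rw [Real.norm_eq_abs, abs_of_pos (hy.1 i)]
    exact (Finset.single_le_sum (fun j _ => (hy.1 j).le) (Finset.mem_univ i)).trans hy.2.le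
  obtain ⟨h, h1, h2, h3⟩ := exists_homeomorph_image_interior_closure_frontier_eq_unitBall hconv
    (by rw [hUo.interior_eq]; exact ⟨_, hc⟩) hbd
  rw [hUo.interior_eq] at h1
  rw [hcl] at h2
  rw [hUo.frontier_eq, hcl] at h3
  set τ : Simp n → (Fin n → ℝ) := fun x i => x i.succ with hτ
  have hτs (x : Simp n) : ∑ i, τ x i = 1 - x 0 := by
    have := stdSimplex.sum_eq_one x
    rw [Fin.sum_univ_succ] at this
    simp only [hτ]
    linarith
  have hτD (x : Simp n) : τ x ∈ D := by
    refine ⟨fun i => x.2.1 _, ?_⟩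
    rw [hτs]
    linarith [show 0 ≤ x 0 from x.2.1 0]
  refine ⟨fun x => h (τ x), h.continuous.comp (continuous_pi fun i => continuous_coord _), ?_, ?_,
    ?_, ?_⟩
  · refine h.injective.comp fun x y hxy => ?_
    ext i
    refine Fin.cases ?_ (fun i => congrFun hxy i) i
    have h4 := hτs x
    rw [hxy, hτs y] at h4
    linarith
  · rw [← h2, range_comp' h τ]
    congr 1
    refine Subset.antisymm (range_subset_iff.2 hτD) fun y hy => ?_
    refine ⟨⟨Fin.cons (1 - ∑ i, y i) y, ?_, ?_⟩, ?_⟩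
    · refine Fin.cases ?_ fun i => ?_
      · rw [Fin.cons_zero]; linarith [hy.2]
      · rw [Fin.cons_succ]; exact hy.1 i
    · rw [Fin.sum_univ_succ]
      simp
    · funext i
      exact Fin.cons_succ (α := fun _ => ℝ) (1 - ∑ i, y i) y i
  · intro x hx
    rw [← h1]
    refine mem_image_of_mem _ ⟨fun i => hx _, ?_⟩
    rw [hτs]
    linarith [hx 0]
  · rintro x ⟨i, hi⟩
    rw [← h3]
    refine mem_image_of_mem _ ⟨hτD x, fun hxU => ?_⟩
    revert hi
    refine Fin.cases (fun hi => ?_) (fun i hi => ?_) i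
    · have := hxU.2
      rw [hτs, hi] at this
      linarith
    · exact (hxU.1 i).ne' hi

/-- A homeomorphism of the standard simplex with the closed unit ball of the sup norm. -/
def simplexBall (n : ℕ) : Simp n → (Fin n → ℝ) := (exists_simplex_ball n).choose

theorem continuous_simplexBall (n : ℕ) : Continuous (simplexBall n) :=
  (exists_simplex_ball n).choose_spec.1

theorem simplexBall_injective (n : ℕ) : Function.Injective (simplexBall n) :=
  (exists_simplex_ball n).choose_spec.2.1

theorem range_simplexBall (n : ℕ) : range (simplexBall n) = Metric.closedBall 0 1 :=
  (exists_simplex_ball n).choose_spec.2.2.1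

theorem simplexBall_mem_ball {n : ℕ} {x : Simp n} (hx : x ∈ intSimp n) :
    simplexBall n x ∈ Metric.ball 0 1 :=
  (exists_simplex_ball n).choose_spec.2.2.2.1 x hx

theorem simplexBall_mem_sphere {n : ℕ} {x : Simp n} (hx : x ∈ bdrySimp n) :
    simplexBall n x ∈ Metric.sphere 0 1 :=
  (exists_simplex_ball n).choose_spec.2.2.2.2 x hx

/-! ### The cells of a covering of a CW complex -/

section CW

variable {X : Type u} [TopologicalSpace X] [CWComplex (univ : Set X)]

/-- The characteristic map of a cell, as a singular simplex. -/
def charMap {n : ℕ} (e : RelCWComplex.cell (univ : Set X) n) : C(Simp n, X) where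
  toFun x := RelCWComplex.map n e (simplexBall n x)
  continuous_toFun := (RelCWComplex.continuousOn n e).comp_continuous (continuous_simplexBall n)
    fun x => range_simplexBall n ▸ mem_range_self x

theorem range_charMap {n : ℕ} (e : RelCWComplex.cell (univ : Set X) n) :
    range (charMap e) = RelCWComplex.closedCell n e := by
  rw [RelCWComplex.closedCell, ← range_simplexBall n, ← range_comp]
  rfl

variable [T2Space X] {Y : Type v} [TopologicalSpace Y] {H : Type w} [CommGroup H] [MulAction H Y]
  [ContinuousConstSMul H Y] {p : Y → X} (hp : IsQuotientCoveringMap p H)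
include hp

-- The simplex is contractible and locally path connected, so maps from it lift through a covering.
omit [T2Space X] [ContinuousConstSMul H Y] in
theorem exists_lift_charMap {n : ℕ} (e : RelCWComplex.cell (univ : Set X) n) :
    ∃ φ : C(Simp n, Y), ∀ x, p (φ x) = charMap e x := by
  have h0 := convex_stdSimplex ℝ (Fin (n + 1))
  have : ContractibleSpace (Simp n) := h0.contractibleSpace ⟨_, (vtx n 0).2⟩
  have : LocallyPathConnectedSpace (Simp n) := h0.locallyPathConnectedSpace
  obtain ⟨y, hy⟩ := hp.surjective (charMap e (vtx n 0))
  obtain ⟨φ, ⟨-, hφ⟩, -⟩ := hp.isCoveringMap.existsUnique_continuousMap_lifts (charMap e) _ y hy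
  exact ⟨φ, congrFun hφ⟩

/-- Disjointness and boundary conditions are pulled back from the CW structure below. Finiteness of
the set of `n`-cells and discontinuity of the action give local finiteness. -/
theorem equivCells [CWComplex.Finite (univ : Set X)] {n : ℕ}
    (φ : RelCWComplex.cell (univ : Set X) n → C(Simp n, Y)) (hφ : ∀ e x, p (φ e x) = charMap e x) :
    EquivCells H (p ⁻¹' (CWComplex.skeletonLT (univ : Set X) ((n + 1 : ℕ) : ℕ∞)))
      (p ⁻¹' (CWComplex.skeletonLT (univ : Set X) (n : ℕ∞))) n φ := by
  have hfin : Finite (RelCWComplex.cell (univ : Set X) n) :=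
    RelCWComplex.FiniteType.finite_cell n
  have hcast : ((n + 1 : ℕ) : ℕ∞) = (n : ℕ∞) + 1 := by push_cast; rfl
  have hinv (A : Set X) : Invariant H (p ⁻¹' A) := fun h y hy => by
    rwa [mem_preimage, hp.map_smul]
  have hmem (e x) : φ e x ∈ p ⁻¹' (CWComplex.skeletonLT (univ : Set X) ((n + 1 : ℕ) : ℕ∞)) := by
    rw [mem_preimage, hφ, hcast]
    refine RelCWComplex.closedCell_subset_skeletonLT (C := (univ : Set X)) n e ?_
    rw [← range_charMap]
    exact mem_range_self x
  have hopen {e : RelCWComplex.cell (univ : Set X) n} {x} (hx : x ∈ intSimp n) : charMap e x ∈ RelCWComplex.openCell n e :=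
    mem_image_of_mem (RelCWComplex.map n e) (simplexBall_mem_ball hx)
  refine ⟨hinv _, hinv _, preimage_mono
    (RelCWComplex.skeletonLT_mono (C := (univ : Set X)) (by rw [hcast]; simp)), hmem,
    ?_⟩
  constructor
  · exact ((CWComplex.skeletonLT (univ : Set X) (n : ℕ∞)).closed.preimage
      hp.continuous).preimage continuous_subtype_val
  · have h1 := (locallyFinite_translates hp (K := fun e => range (φ e))
      fun e => isCompact_range (φ e).continuous).preimage_continuous
      (continuous_subtype_val (p := (· ∈ p ⁻¹' (CWComplex.skeletonLT (univ : Set X)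
        ((n + 1 : ℕ) : ℕ∞) : Set X))))
    refine h1.subset fun j => ?_
    rintro _ ⟨x, rfl⟩
    exact ⟨_, ⟨x, rfl⟩, rfl⟩
  · rintro ⟨e, h⟩ x hx
    change p (h • φ e x) ∈ (RelCWComplex.skeletonLT (univ : Set X) (n : ℕ∞) : Set X)
    rw [hp.map_smul, hφ]
    exact RelCWComplex.cellFrontier_subset_skeletonLT n e
      (mem_image_of_mem _ (simplexBall_mem_sphere hx))
  · rintro ⟨e, h⟩ x hx hmem
    have h1 : p (h • φ e x) ∈ CWComplex.skeletonLT (univ : Set X) (n : ℕ∞) := hmem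
    rw [hp.map_smul, hφ] at h1
    exact disjoint_left.1 (RelCWComplex.disjoint_skeletonLT_openCell le_rfl) h1 (hopen hx)
  · rintro ⟨e, h⟩ ⟨e', h'⟩ x x' hx heq
    have h0 : h • φ e x = h' • φ e' x' := congrArg Subtype.val heq
    have h1 := congrArg p h0
    rw [hp.map_smul, hp.map_smul, hφ, hφ] at h1
    have hx' : x' ∈ intSimp n := by
      by_contra hx'
      have h2 : charMap e' x' ∈ CWComplex.skeletonLT (univ : Set X) (n : ℕ∞) :=
        RelCWComplex.cellFrontier_subset_skeletonLT n e'
          (mem_image_of_mem _ (simplexBall_mem_sphere (mem_bdry_of_not_int hx')))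
      rw [← h1] at h2
      exact disjoint_left.1 (RelCWComplex.disjoint_skeletonLT_openCell le_rfl) h2 (hopen hx)
    have he : e = e' := by
      by_contra hne
      refine disjoint_left.1 (RelCWComplex.disjoint_openCell_of_ne (i := e) (j := e') ?_) (hopen hx)
        (h1 ▸ hopen hx')
      simpa using hne
    subst he
    have hxx : x = x' := by
      apply simplexBall_injective n
      refine (RelCWComplex.map n e).injOn ?_ ?_ h1
      · rw [RelCWComplex.source_eq]; exact simplexBall_mem_ball hx
      · rw [RelCWComplex.source_eq]; exact simplexBall_mem_ball hx'
    subst hxx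
    -- The action is free, so the group element is determined by the translated point.
    have := hp.isCancelSMul
    exact ⟨Prod.ext rfl (IsCancelSMul.right_cancel _ _ _ h0), rfl⟩
  · rintro ⟨y, hy⟩
    rw [mem_preimage, hcast, ← RelCWComplex.skeletonLT_union_iUnion_closedCell_eq_skeletonLT_succ] at hy
    obtain hy' | hy' := hy
    · exact Or.inl hy'
    · obtain ⟨e, he⟩ := mem_iUnion.1 hy'
      rw [← range_charMap] at he
      obtain ⟨x, hx⟩ := he
      rw [← hφ] at hx
      obtain ⟨h, hh⟩ := hp.apply_eq_iff_mem_orbit.1 hx.symm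
      exact Or.inr ⟨(e, h), x, Subtype.ext hh⟩

omit [ContinuousConstSMul H Y] in
theorem fg_of_cover [CWComplex.Finite (univ : Set X)] [PreconnectedSpace Y] [Nonempty Y] :
    Group.FG H := by
  have hfin : Finite (Σ n, RelCWComplex.cell (univ : Set X) n) := RelCWComplex.finite_cells_of_finite
  choose φ hφ using fun e : Σ n, RelCWComplex.cell (univ : Set X) n => exists_lift_charMap hp e.2
  refine fg_of_compact_cover hp (isCompact_iUnion fun e => isCompact_range (φ e).continuous)
    fun y => ?_
  have h1 : p y ∈ ⋃ (n : ℕ) (j : RelCWComplex.cell (univ : Set X) n), RelCWComplex.closedCell n j := by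
    rw [CWComplex.union]
    trivial
  obtain ⟨n, e, he⟩ := mem_iUnion₂.1 h1
  rw [← range_charMap] at he
  obtain ⟨x, hx⟩ := he
  rw [← hφ ⟨n, e⟩] at hx
  obtain ⟨h, hh⟩ := hp.apply_eq_iff_mem_orbit.1 hx.symm
  exact ⟨h, _, mem_iUnion.2 ⟨⟨n, e⟩, mem_range_self x⟩, hh⟩

end CW

end AbCover
end

noncomputable section
namespace AbCover
open HasAff

/-! ### Comparison of abelian covers -/

theorem monodromy_symm {X Y : Type*} [TopologicalSpace X] [TopologicalSpace Y] {p : Y → X}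
    (cov : IsCoveringMap p) {x y : X} (α : Path.Homotopic.Quotient x y) (e : p ⁻¹' {x}) :
    cov.monodromy α.symm (cov.monodromy α e) = e := by
  obtain ⟨a, rfl⟩ := Path.Homotopic.Quotient.mk_surjective α
  rw [← IsCoveringMap.monodromy_trans_apply, ← Path.Homotopic.Quotient.mk_symm,
    ← Path.Homotopic.Quotient.mk_trans, ← Path.Homotopic.Quotient.eq.2 ⟨.reflTransSymm a⟩,
    Path.Homotopic.Quotient.mk_refl, IsCoveringMap.monodromy_refl]
  rfl

section Comparison

variable {X : Type u} [TopologicalSpace X] {x₀ : X}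
  {A : Type*} [CommGroup A] {μ : FundamentalGroup X x₀ →* A}
  {Z : Type z} [TopologicalSpace Z] [MulAction A Z] (cZ : AbelianCover x₀ μ Z)
  {H : Type w} [CommGroup H] {ν : FundamentalGroup X x₀ →* H}
  {Y : Type v} [TopologicalSpace Y] [MulAction H Y] (cY : AbelianCover x₀ ν Y)

namespace AbelianCover

/-- The end point of the lift, from the base point, of a path from `x₀`. -/
abbrev lift {x : X} (α : Path.Homotopic.Quotient x₀ x) : cY.proj ⁻¹' {x} :=
  cY.isCover.isCoveringMap.monodromy α cY.base

theorem exists_lift (z : Y) :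
    ∃ α : Path.Homotopic.Quotient x₀ (cY.proj z), cY.lift α = ⟨z, rfl⟩ := by
  have := cY.pathConnected
  obtain ⟨γ⟩ := PathConnectedSpace.joined (cY.base : Y) z
  refine ⟨((Path.Homotopic.Quotient.mk γ).map ⟨cY.proj, cY.isCover.continuous⟩).cast
    (Eq.symm cY.base.2) rfl, ?_⟩
  refine cY.isCover.isCoveringMap.monodromy_eq_of_map_eq (Path.Homotopic.Quotient.mk γ) ?_
  exact ((Path.Homotopic.Quotient.cast_cast _ _ _ _ _).trans
    (Path.Homotopic.Quotient.cast_rfl_rfl _)).symm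

/-- The map of covers that preserves the base points. -/
def compare (x : Z) : Y := cY.lift (cZ.exists_lift x).choose

theorem proj_compare (x : Z) : cY.proj (compare cZ cY x) = cZ.proj x :=
  (cY.lift (cZ.exists_lift x).choose).2

variable {φ : A →* H} (hφ : ∀ γ, φ (μ γ) = ν γ)
include hφ

/-- The loop α followed by the reverse of α' lifts to a closed loop in the first cover, so `μ` kills
it; then so does `ν`, and it lifts to a closed loop in the second cover. Hence `compare` does not
depend on its chosen paths. -/
theorem lift_eq_of_lift_eq {x : X} {α α' : Path.Homotopic.Quotient x₀ x}
    (h : cZ.lift α = cZ.lift α') : cY.lift α = cY.lift α' := by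
  have h1 : cZ.isCover.isCoveringMap.monodromy (α.trans α'.symm) cZ.base = cZ.base := by
    rw [IsCoveringMap.monodromy_trans_apply, show cZ.isCover.isCoveringMap.monodromy α cZ.base = _
      from h, monodromy_symm]
  have h2 := cZ.monodromy_base (α.trans α'.symm)
  rw [h1] at h2
  have hA := cZ.isCover.isCancelSMul
  have h3 : μ (α.trans α'.symm) = 1 :=
    IsCancelSMul.right_cancel _ _ (cZ.base : Z) (by rw [← h2, one_smul])
  have h4 := cY.monodromy_base (α.trans α'.symm)
  rw [← hφ, h3, map_one, one_smul] at h4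
  refine (cY.isCover.isCoveringMap.monodromy_bijective α'.symm).1 ?_
  rw [monodromy_symm, ← IsCoveringMap.monodromy_trans_apply]
  exact Subtype.ext h4

theorem compare_eq {x : X} {α : Path.Homotopic.Quotient x₀ x} {y : cZ.proj ⁻¹' {x}}
    (h : cZ.lift α = y) : compare cZ cY y = cY.lift α := by
  obtain ⟨y, hy⟩ := y
  obtain rfl : cZ.proj y = x := hy
  have h1 := (cZ.exists_lift y).choose_spec
  exact congrArg Subtype.val (lift_eq_of_lift_eq cZ cY hφ (h1.trans h.symm))

/-- A deck transformation `μ γ` prepends the loop γ to a path from the base point, because monodromy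
commutes with deck transformations. Surjectivity of `μ` reaches every group element. -/
theorem compare_smul (hμ : Function.Surjective μ) (a : A) (x : Z) :
    compare cZ cY (a • x) = φ a • compare cZ cY x := by
  obtain ⟨γ, rfl⟩ := hμ a
  obtain ⟨α, hα⟩ := cZ.exists_lift x
  have h1 : cZ.isCover.toPermFiber x₀ (μ γ) cZ.base =
      cZ.isCover.isCoveringMap.monodromy γ cZ.base := Subtype.ext (cZ.monodromy_base γ).symm
  have h2 : cY.isCover.toPermFiber x₀ (ν γ) cY.base =
      cY.isCover.isCoveringMap.monodromy γ cY.base := Subtype.ext (cY.monodromy_base γ).symm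
  have h3 : cZ.lift (Path.Homotopic.Quotient.trans γ α) =
      cZ.isCover.toPermFiber _ (μ γ) ⟨x, rfl⟩ := by
    rw [lift, IsCoveringMap.monodromy_trans_apply, ← h1,
      IsQuotientCoveringMap.monodromy_toPermFiber]
    exact congrArg _ hα
  have h4 := compare_eq cZ cY hφ h3
  have h5 : cY.lift (Path.Homotopic.Quotient.trans γ α) =
      cY.isCover.toPermFiber _ (ν γ) (cY.lift α) := by
    rw [lift, IsCoveringMap.monodromy_trans_apply, ← h2,
      IsQuotientCoveringMap.monodromy_toPermFiber]
  rw [h5] at h4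
  refine h4.trans ?_
  rw [hφ, compare_eq cZ cY hφ hα]
  rfl

/-- A lift `F` and `compare` both follow the lift of the same path in the base, so agreement at one
parameter spreads to all. -/
theorem compare_comp {B : Type*} [TopologicalSpace B] [PathConnectedSpace B] (σ : C(B, Z))
    (F : C(B, Y)) (hF : ∀ b, cY.proj (F b) = cZ.proj (σ b)) (b₀ b : B)
    (h0 : F b₀ = compare cZ cY (σ b₀)) : F b = compare cZ cY (σ b) := by
  obtain ⟨δ⟩ := PathConnectedSpace.joined b₀ b
  obtain ⟨α, hα⟩ := cZ.exists_lift (σ b₀)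
  set q : C(Z, X) := ⟨cZ.proj, cZ.isCover.continuous⟩
  set p : C(Y, X) := ⟨cY.proj, cY.isCover.continuous⟩
  set β : Path.Homotopic.Quotient (cZ.proj (σ b₀)) (cZ.proj (σ b)) :=
    (Path.Homotopic.Quotient.mk δ).map (q.comp σ) with hβ
  have h1 : cZ.isCover.isCoveringMap.monodromy β ⟨σ b₀, rfl⟩ = ⟨σ b, rfl⟩ := by
    rw [hβ, Path.Homotopic.Quotient.map_comp]
    exact cZ.isCover.isCoveringMap.monodromy_map _
  have h2 : cY.isCover.isCoveringMap.monodromy β ⟨F b₀, hF b₀⟩ = ⟨F b, hF b⟩ := by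
    refine cY.isCover.isCoveringMap.monodromy_eq_of_map_eq
      ((Path.Homotopic.Quotient.mk δ).map F) ?_
    refine Eq.trans ?_ (Path.Homotopic.Quotient.mk_cast (δ.map (q.comp σ).continuous) (hF b₀) (hF b))
    exact congrArg Path.Homotopic.Quotient.mk (Path.ext (funext fun t => hF _))
  have h3 : cZ.lift (α.trans β) = ⟨σ b, rfl⟩ := by
    rw [lift, IsCoveringMap.monodromy_trans_apply, show
      cZ.isCover.isCoveringMap.monodromy α cZ.base = _ from hα, h1]
  have h4 : (⟨F b₀, hF b₀⟩ : cY.proj ⁻¹' {cZ.proj (σ b₀)}) = cY.lift α :=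
    Subtype.ext (h0.trans (compare_eq cZ cY hφ hα))
  rw [compare_eq cZ cY hφ h3, lift, IsCoveringMap.monodromy_trans_apply, ← lift, ← h4, h2]

/-- Only continuity along singular simplices is needed to push chains forward. There `compare`
coincides with the continuous lift of the projected simplex with the same starting value. -/
theorem continuous_compare_comp {n : ℕ} (σ : C(Simp n, Z)) :
    Continuous fun x => compare cZ cY (σ x) := by
  have h0 := convex_stdSimplex ℝ (Fin (n + 1))
  have : ContractibleSpace (Simp n) := h0.contractibleSpace ⟨_, (vtx n 0).2⟩
  have : LocallyPathConnectedSpace (Simp n) := h0.locallyPathConnectedSpace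
  obtain ⟨F, ⟨hF0, hF⟩, -⟩ := cY.isCover.isCoveringMap.existsUnique_continuousMap_lifts
    (⟨fun x => cZ.proj (σ x), cZ.isCover.continuous.comp σ.continuous⟩ : C(Simp n, X)) (vtx n 0)
    (compare cZ cY (σ (vtx n 0))) (proj_compare cZ cY _)
  have h1 : (fun x => compare cZ cY (σ x)) = F := by
    funext x
    exact (compare_comp cZ cY hφ σ F (congrFun hF) (vtx n 0) x hF0).symm
  rw [h1]
  exact F.continuous

/-- The image of a singular simplex under the map of covers. -/
def push {n : ℕ} (σ : SingSimplex Z n) : SingSimplex Y n :=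
  ⟨fun x => compare cZ cY (σ x), continuous_compare_comp cZ cY hφ σ⟩

theorem push_apply {n : ℕ} (σ : SingSimplex Z n) (x : Simp n) :
    push cZ cY hφ σ x = compare cZ cY (σ x) := rfl

/-- The map of integral chains induced by the map of covers. -/
def pushInt (n : ℕ) : SChain Z n →ₗ[ℤ] SChain Y n :=
  Finsupp.lmapDomain ℤ ℤ (push cZ cY hφ)

theorem pushInt_of {n : ℕ} (σ : SingSimplex Z n) :
    pushInt cZ cY hφ n (sOf σ) = sOf (push cZ cY hφ σ) := by
  simp [pushInt]

theorem singBdryInt_pushInt (n : ℕ) (c : SChain Z (n + 1)) :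
    singBdryInt Y n (pushInt cZ cY hφ (n + 1) c) = pushInt cZ cY hφ n (singBdryInt Z n c) := by
  refine schain_induction (singBdryInt Y n ∘ₗ pushInt cZ cY hφ (n + 1))
    (pushInt cZ cY hφ n ∘ₗ singBdryInt Z n) (fun σ => ?_) c
  simp only [LinearMap.comp_apply, pushInt_of, singBdryInt_of, map_sum, map_smul]
  rfl

theorem pushInt_mem {S : Set X} {n : ℕ} {c : SChain Z n}
    (hc : c ∈ supp (simpIn (cZ.proj ⁻¹' S) n)) :
    pushInt cZ cY hφ n c ∈ supp (simpIn (cY.proj ⁻¹' S) n) := by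
  refine supp_induction _ _ (fun σ hσ => ?_) hc
  rw [pushInt_of]
  refine sOf_mem_supp (mem_simpIn.2 fun x => ?_)
  rw [mem_preimage, push_apply, proj_compare]
  exact mem_simpIn.1 hσ x

/-! ### Equivariance of the comparison and matrices of the differentials -/

variable [ContinuousConstSMul A Z] [ContinuousConstSMul H Y]

theorem push_smul (hμ : Function.Surjective μ) {n : ℕ} (a : A) (σ : SingSimplex Z n) :
    push cZ cY hφ (a • σ) = φ a • push cZ cY hφ σ :=
  ContinuousMap.ext fun x => compare_smul cZ cY hφ hμ a (σ x)

/-- The map of equivariant chains induced by the map of covers. -/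
def pushChain (n : ℕ) : SingChain A Z n →+ SingChain H Y n :=
  ((toInt H n).symm.toAddMonoidHom.comp (pushInt cZ cY hφ n).toAddMonoidHom).comp
    (toInt A n).toAddMonoidHom

theorem toInt_pushChain (n : ℕ) (c : SingChain A Z n) :
    toInt H n (pushChain cZ cY hφ n c) = pushInt cZ cY hφ n (toInt A n c) :=
  (toInt H n).apply_symm_apply _

theorem pushChain_singOf {n : ℕ} (σ : SingSimplex Z n) :
    pushChain cZ cY hφ n (singOf A σ) = singOf H (push cZ cY hφ σ) := by
  apply (toInt H n).injective
  rw [toInt_pushChain, toInt_singOf, toInt_singOf, pushInt_of]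

theorem singBdry_pushChain (n : ℕ) (c : SingChain A Z (n + 1)) :
    singBdry H Y n (pushChain cZ cY hφ (n + 1) c) = pushChain cZ cY hφ n (singBdry A Z n c) := by
  apply (toInt H n).injective
  rw [toInt_pushChain, toInt_singBdry, toInt_singBdry, toInt_pushChain, singBdryInt_pushInt]

theorem pushChain_smul_singOf (hμ : Function.Surjective μ) {n : ℕ} (r : MonoidAlgebra ℤ A)
    (σ : SingSimplex Z n) : pushChain cZ cY hφ n (r • singOf A σ) =
      MonoidAlgebra.mapDomainRingHom ℤ φ r • singOf H (push cZ cY hφ σ) := by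
  induction r using monoidAlgebra_induction with
  | h0 => rw [zero_smul, map_zero, map_zero, zero_smul]
  | hadd x y hx hy => rw [add_smul, map_add, hx, hy, map_add, add_smul]
  | hs a m =>
    apply (toInt H n).injective
    have h1 : MonoidAlgebra.mapDomainRingHom ℤ φ (MonoidAlgebra.single a m) =
        MonoidAlgebra.single (φ a) m := MonoidAlgebra.mapDomain_single
    rw [toInt_pushChain, single_smul_singOf, h1, single_smul_singOf, map_smul, pushInt_of, push_smul cZ cY hφ hμ]

theorem pushChain_mem_relBoundaries {S T : Set X} {n : ℕ} {c : SingChain A Z n}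
    (hc : c ∈ relBoundaries A (cZ.proj ⁻¹' S) (cZ.proj ⁻¹' T) n) :
    pushChain cZ cY hφ n c ∈ relBoundaries H (cY.proj ⁻¹' S) (cY.proj ⁻¹' T) n := by
  have hZ (S : Set X) : Invariant A (cZ.proj ⁻¹' S) := fun h y hy => by
    rwa [mem_preimage, cZ.isCover.map_smul]
  have hY (S : Set X) : Invariant H (cY.proj ⁻¹' S) := fun h y hy => by
    rwa [mem_preimage, cY.isCover.map_smul]
  rw [mem_relBoundaries (hZ S) (hZ T)] at hc
  rw [mem_relBoundaries (hY S) (hY T), toInt_pushChain]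
  obtain ⟨b, hb, a, ha, h⟩ := hc
  exact ⟨_, pushInt_mem cZ cY hφ hb, _, pushInt_mem cZ cY hφ ha, by
    rw [h, map_add, singBdryInt_pushInt]⟩

/-- The lifts of the characteristic maps of the cells form a basis of the cellular chains. -/
def cellBasis [T2Space X] [CWComplex (univ : Set X)] [CWComplex.Finite (univ : Set X)]
    {n : ℕ} {ψ : RelCWComplex.cell (univ : Set X) n → C(Simp n, Y)}
    (hψ : ∀ e x, cY.proj (ψ e x) = charMap e x) :
    Module.Basis (RelCWComplex.cell (univ : Set X) n) (MonoidAlgebra ℤ H)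
      (RelHomology H (cY.proj ⁻¹' (CWComplex.skeletonLT (univ : Set X) ((n + 1 : ℕ) : ℕ∞)))
        (cY.proj ⁻¹' (CWComplex.skeletonLT (univ : Set X) (n : ℕ∞))) n) :=
  have := t2Space_of_cover cY.isCover
  (equivCells cY.isCover ψ hψ).basis

variable [T2Space X] [CWComplex (univ : Set X)] [CWComplex.Finite (univ : Set X)]
  {n : ℕ} {ψ : RelCWComplex.cell (univ : Set X) n → C(Simp n, Z)}
  (hψ : ∀ e x, cZ.proj (ψ e x) = charMap e x)

omit [ContinuousConstSMul A Z] [ContinuousConstSMul H Y] [CWComplex.Finite (univ : Set X)]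
  [T2Space X] in
include hψ in
theorem proj_push (e x) : cY.proj (push cZ cY hφ (ψ e) x) = charMap e x := by
  rw [push_apply, proj_compare, hψ]

/-- Expand the boundary of a lifted cell in the first cover and push this relation, modulo relative
boundaries, to the second. The bases there are the pushed lifts, so the entries change by `φ` alone;
this replaces a base-change isomorphism of complexes. -/
theorem repr_push (hμ : Function.Surjective μ)
    {ψ' : RelCWComplex.cell (univ : Set X) (n + 1) → C(Simp (n + 1), Z)}
    (hψ' : ∀ e x, cZ.proj (ψ' e x) = charMap e x) (e e') :
    (cellBasis cY (proj_push cZ cY hφ hψ)).repr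
        (relBdry H _ _ _ n (cellBasis cY (proj_push cZ cY hφ hψ') e)) e' =
      MonoidAlgebra.mapDomainRingHom ℤ φ
        ((cellBasis cZ hψ).repr (relBdry A _ _ _ n (cellBasis cZ hψ' e)) e') := by
  have hfin : Finite (RelCWComplex.cell (univ : Set X) n) := RelCWComplex.FiniteType.finite_cell n
  cases nonempty_fintype (RelCWComplex.cell (univ : Set X) n)
  have hZ := t2Space_of_cover cZ.isCover
  have hY := t2Space_of_cover cY.isCover
  set r := (cellBasis cZ hψ).repr (relBdry A _ _ _ n (cellBasis cZ hψ' e)) with hr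
  have h1 : relBdry A _ _ _ n (cellBasis cZ hψ' e) = ∑ i, r i • cellBasis cZ hψ i :=
    ((cellBasis cZ hψ).sum_repr _).symm
  suffices h2 : relBdry H _ _ _ n (cellBasis cY (proj_push cZ cY hφ hψ') e) =
      ∑ i, MonoidAlgebra.mapDomainRingHom ℤ φ (r i) • cellBasis cY (proj_push cZ cY hφ hψ) i by
    rw [h2, Module.Basis.repr_sum_self]
  simp only [cellBasis, EquivCells.basis_apply, EquivCells.cellClass] at h1 ⊢
  have h3 : singBdry A Z n (singOf A (ψ' e)) - ∑ i, r i • singOf A (ψ i) ∈ relBoundaries A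
      (cZ.proj ⁻¹' (CWComplex.skeletonLT (univ : Set X) ((n + 1 : ℕ) : ℕ∞)))
      (cZ.proj ⁻¹' (CWComplex.skeletonLT (univ : Set X) (n : ℕ∞))) n := by
    have h4 : (Submodule.Quotient.mk (cycleBdry A _ _ _ n ⟨singOf A (ψ' e),
        (equivCells cZ.isCover ψ' hψ').singOf_mem e⟩) : RelHomology A
          (cZ.proj ⁻¹' (CWComplex.skeletonLT (univ : Set X) ((n + 1 : ℕ) : ℕ∞)))
          (cZ.proj ⁻¹' (CWComplex.skeletonLT (univ : Set X) (n : ℕ∞))) n) =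
        Submodule.Quotient.mk (∑ i, r i • ⟨singOf A (ψ i),
          (equivCells cZ.isCover ψ hψ).singOf_mem i⟩) := by
      refine h1.trans ?_
      rw [← Submodule.mkQ_apply, map_sum]
      rfl
    rw [Submodule.Quotient.eq] at h4
    have h5 := Submodule.mem_comap.1 h4
    simpa [cycleBdry] using h5
  have h4 := pushChain_mem_relBoundaries cZ cY hφ h3
  rw [map_sub, map_sum, ← singBdry_pushChain, pushChain_singOf] at h4
  simp only [pushChain_smul_singOf cZ cY hφ hμ] at h4
  have h5 : (Submodule.Quotient.mk (cycleBdry H _ _ _ n ⟨singOf H (push cZ cY hφ (ψ' e)),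
      (equivCells cY.isCover _ (proj_push cZ cY hφ hψ')).singOf_mem e⟩) : RelHomology H
        (cY.proj ⁻¹' (CWComplex.skeletonLT (univ : Set X) ((n + 1 : ℕ) : ℕ∞)))
        (cY.proj ⁻¹' (CWComplex.skeletonLT (univ : Set X) (n : ℕ∞))) n) =
      Submodule.Quotient.mk (∑ i, MonoidAlgebra.mapDomainRingHom ℤ φ (r i) •
        ⟨singOf H (push cZ cY hφ (ψ i)),
          (equivCells cY.isCover _ (proj_push cZ cY hφ hψ)).singOf_mem i⟩) := by
    rw [Submodule.Quotient.eq]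
    refine Submodule.mem_comap.2 ?_
    simpa [cycleBdry] using h4
  refine Eq.trans h5 ?_
  rw [← Submodule.mkQ_apply, map_sum]
  rfl

end AbelianCover

end Comparison

end AbCover
end

noncomputable section
namespace AbCover
open HasAff

/-! ### Finiteness over the integers and tropical varieties -/

section Trop

variable {H : Type w} [CommGroup H]

/-- All terms of `g` have positive `χ`-degree. -/
def PosSupp (χ : Additive H →+ ℝ) (g : MonoidAlgebra ℤ H) : Prop :=
  ∀ h, g.coeff h ≠ 0 → 0 < χ (Additive.ofMul h)

variable {χ : Additive H →+ ℝ}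

theorem PosSupp.zero : PosSupp χ (0 : MonoidAlgebra ℤ H) := fun _ hh => absurd rfl hh

theorem PosSupp.add {f g : MonoidAlgebra ℤ H} (hf : PosSupp χ f) (hg : PosSupp χ g) :
    PosSupp χ (f + g) := fun h hh => by
  by_cases h1 : f.coeff h = 0
  · exact hg h fun h2 => hh (by rw [MonoidAlgebra.coeff_add, Finsupp.add_apply, h1, h2, add_zero])
  · exact hf h h1

theorem PosSupp.mul {f g : MonoidAlgebra ℤ H} (hf : PosSupp χ f) (hg : PosSupp χ g) :
    PosSupp χ (f * g) := fun h hh => by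
  classical
  obtain ⟨a, ha, b, hb, rfl⟩ := Finset.mem_mul.1
    (MonoidAlgebra.support_coeff_mul_subset f g (Finsupp.mem_support_iff.2 hh))
  rw [ofMul_mul, map_add]
  exact add_pos (hf a (Finsupp.mem_support_iff.1 ha)) (hg b (Finsupp.mem_support_iff.1 hb))

/-- Needed because the comparison of jump ideals with annihilators holds only up to radical. -/
theorem PosSupp.exists_pow {g : MonoidAlgebra ℤ H} (hg : PosSupp χ g) (N : ℕ) :
    ∃ g', PosSupp χ g' ∧ (1 + g) ^ N = 1 + g' := by
  induction N with
  | zero => exact ⟨0, .zero, by simp⟩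
  | succ N ih =>
    obtain ⟨g', hg', h⟩ := ih
    exact ⟨g' + g + g' * g, (hg'.add hg).add (hg'.mul hg), by rw [pow_succ, h]; ring⟩

theorem PosSupp.single {h : H} (hh : 0 < χ (Additive.ofMul h)) (m : ℤ) :
    PosSupp χ (MonoidAlgebra.single h m) := fun h' hh' => by
  rw [MonoidAlgebra.coeff_single, Finsupp.single_apply_ne_zero] at hh'
  rwa [hh'.1]

theorem PosSupp.map {H' : Type*} [CommGroup H'] {χ' : Additive H' →+ ℝ} (φ : H →* H')
    (hχ : ∀ h, χ (Additive.ofMul h) = χ' (Additive.ofMul (φ h))) {g : MonoidAlgebra ℤ H}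
    (hg : PosSupp χ g) : PosSupp χ' (MonoidAlgebra.mapDomainRingHom ℤ φ g) := fun h hh => by
  classical
  have h1 : (MonoidAlgebra.mapDomainRingHom ℤ φ g).coeff = Finsupp.mapDomain φ g.coeff :=
    MonoidAlgebra.coeff_mapDomain _ _
  rw [h1] at hh
  obtain ⟨a, ha, rfl⟩ := Finset.mem_image.1
    (Finsupp.mapDomain_support (Finsupp.mem_support_iff.2 hh))
  rw [← hχ]
  exact hg a (Finsupp.mem_support_iff.1 ha)

/-- Each fixed-degree part of a combination of initial forms is the lowest part of a single element
of `I`, or zero: sums are formed at a common degree, and a monomial shifts `t` by its own degree. -/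
theorem exists_graded_part {I : Ideal (MonoidAlgebra ℤ H)} {y : MonoidAlgebra ℤ H}
    (hy : y ∈ initialIdeal χ I) (t : ℝ) :
    ∃ f ∈ I, (∀ h, χ (Additive.ofMul h) < t → f.coeff h = 0) ∧
      ∀ h, χ (Additive.ofMul h) = t → f.coeff h = y.coeff h := by
  induction hy using Submodule.span_induction generalizing t with
  | mem x hx =>
    obtain ⟨f, hf, rfl⟩ := hx
    have hin (h : H) : (initialForm χ f).coeff h = if ∀ h' ∈ f.coeff.support,
        χ (Additive.ofMul h) ≤ χ (Additive.ofMul h') then f.coeff h else 0 := by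
      rw [initialForm, MonoidAlgebra.coeff_ofCoeff, Finsupp.filter_apply]
    by_cases h0 : ∃ h₀, f.coeff h₀ ≠ 0 ∧ χ (Additive.ofMul h₀) = t ∧
        ∀ h' ∈ f.coeff.support, χ (Additive.ofMul h₀) ≤ χ (Additive.ofMul h')
    · obtain ⟨h₀, -, rfl, h2⟩ := h0
      refine ⟨f, hf, fun h hh => ?_, fun h hh => ?_⟩
      · by_contra hne
        exact (h2 h (Finsupp.mem_support_iff.2 hne)).not_gt hh
      · rw [hin, if_pos]
        rwa [hh]
    · refine ⟨0, I.zero_mem, fun _ _ => rfl, fun h hh => ?_⟩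
      rw [hin]
      split_ifs with h2
      · by_contra hne
        exact h0 ⟨h, fun h3 => hne h3.symm, hh, h2⟩
      · rfl
  | zero => exact ⟨0, I.zero_mem, fun _ _ => rfl, fun _ _ => rfl⟩
  | add x y _ _ hx hy =>
    obtain ⟨f, hf, h1, h2⟩ := hx t
    obtain ⟨g, hg, h3, h4⟩ := hy t
    refine ⟨f + g, I.add_mem hf hg, fun h hh => ?_, fun h hh => ?_⟩
    · rw [MonoidAlgebra.coeff_add, Finsupp.add_apply, h1 h hh, h3 h hh, add_zero]
    · rw [MonoidAlgebra.coeff_add, Finsupp.add_apply, h2 h hh, h4 h hh]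
      rfl
  | smul r x _ hx =>
    induction r using monoidAlgebra_induction generalizing t with
    | h0 => exact ⟨0, I.zero_mem, fun _ _ => rfl, fun _ _ => by rw [zero_smul]⟩
    | hadd r s hr hs =>
      obtain ⟨f, hf, h1, h2⟩ := hr t
      obtain ⟨g, hg, h3, h4⟩ := hs t
      refine ⟨f + g, I.add_mem hf hg, fun h hh => ?_, fun h hh => ?_⟩
      · rw [MonoidAlgebra.coeff_add, Finsupp.add_apply, h1 h hh, h3 h hh, add_zero]
      · rw [add_smul, MonoidAlgebra.coeff_add, Finsupp.add_apply, h2 h hh, h4 h hh]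
        rfl
    | hs a m =>
      obtain ⟨f, hf, h1, h2⟩ := hx (t - χ (Additive.ofMul a))
      have hχ (h : H) : χ (Additive.ofMul (a⁻¹ * h)) =
          χ (Additive.ofMul h) - χ (Additive.ofMul a) := by
        rw [ofMul_mul, ofMul_inv, map_add, map_neg]
        ring
      refine ⟨MonoidAlgebra.single a m * f, I.mul_mem_left _ hf, fun h hh => ?_, fun h hh => ?_⟩
      · rw [MonoidAlgebra.coeff_single_mul_apply, h1 _ (by rw [hχ]; linarith), mul_zero]
      · rw [smul_eq_mul, MonoidAlgebra.coeff_single_mul_apply,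
          MonoidAlgebra.coeff_single_mul_apply, h2 _ (by rw [hχ]; linarith)]

/-- Forwards, take the degree-zero part of 1 in the initial ideal and lift it to an element of `I`
with no lower terms. Backwards, the initial form of 1 + g is 1. -/
theorem initialIdeal_eq_top_iff {I : Ideal (MonoidAlgebra ℤ H)} :
    initialIdeal χ I = ⊤ ↔ ∃ g, PosSupp χ g ∧ 1 + g ∈ I := by
  classical
  have hone (h : H) : (1 : MonoidAlgebra ℤ H).coeff h = if h = 1 then 1 else 0 := by
    rw [MonoidAlgebra.one_def, MonoidAlgebra.coeff_single, Finsupp.single_apply]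
    simp only [eq_comm]
  constructor
  · intro h
    obtain ⟨f, hf, h1, h2⟩ := exists_graded_part (y := 1) (h ▸ Submodule.mem_top) 0
    refine ⟨f - 1, fun h hh => ?_, by rwa [add_sub_cancel]⟩
    by_contra hle
    apply hh
    rw [MonoidAlgebra.coeff_sub, Finsupp.sub_apply]
    obtain hlt | heq := (not_lt.1 hle).lt_or_eq
    · rw [h1 h hlt, hone, if_neg, sub_zero]
      rintro rfl
      rw [ofMul_one, map_zero] at hlt
      exact hlt.false
    · rw [h2 h heq, sub_self]
  · rintro ⟨g, hg, hI⟩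
    have hcoeff (h : H) : (1 + g).coeff h = (if h = 1 then 1 else 0) + g.coeff h := by
      rw [MonoidAlgebra.coeff_add, Finsupp.add_apply, hone]
    have hg1 : g.coeff 1 = 0 := by
      by_contra hne
      have := hg 1 hne
      rw [ofMul_one, map_zero] at this
      exact this.false
    have h1 : initialForm χ (1 + g) = 1 := by
      refine MonoidAlgebra.ext (Finsupp.ext fun h => ?_)
      rw [initialForm, MonoidAlgebra.coeff_ofCoeff, Finsupp.filter_apply, hone, hcoeff]
      by_cases hh : h = 1
      · subst hh
        rw [if_pos, if_pos rfl, hg1, add_zero]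
        intro h' hh'
        rw [Finsupp.mem_support_iff, hcoeff] at hh'
        rw [ofMul_one, map_zero]
        by_cases h2 : h' = 1
        · rw [h2, ofMul_one, map_zero]
        · rw [if_neg h2, zero_add] at hh'
          exact (hg _ hh').le
      · rw [if_neg hh, zero_add]
        split_ifs with h3
        · by_contra hne
          have h4 := h3 1 (by rw [Finsupp.mem_support_iff, hcoeff, if_pos rfl, hg1]; simp)
          rw [ofMul_one, map_zero] at h4
          exact (hg h hne).not_ge h4
        · rfl
    rw [Ideal.eq_top_iff_one, ← h1]
    exact Submodule.subset_span ⟨_, hI, rfl⟩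

theorem tropVariety_subset_iff {I : Ideal (MonoidAlgebra ℤ H)} :
    tropVariety I ⊆ {0} ↔ ∀ χ : Additive H →+ ℝ, χ ≠ 0 → ∃ g, PosSupp χ g ∧ 1 + g ∈ I := by
  constructor
  · intro h χ hχ
    rw [← initialIdeal_eq_top_iff]
    by_contra hne
    exact hχ (h hne)
  · intro h χ hχ
    by_contra hne
    exact hχ (initialIdeal_eq_top_iff.2 (h χ hne))

/-! ### The two directions of the finiteness criterion -/

variable {M : Type v} [AddCommGroup M] [Module (MonoidAlgebra ℤ H) M]

/-- A group element h with χ(h) < 0 acts integrally on `M`. Multiplying the monic relation by the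
inverse of its leading power makes the leading term 1 and the exponents of the other terms negative,
so their χ-degrees are positive. -/
theorem tropVariety_annihilator_of_finite [Module.Finite ℤ M] :
    tropVariety (Module.annihilator (MonoidAlgebra ℤ H) M) ⊆ {0} := by
  rw [tropVariety_subset_iff]
  intro χ hχ
  obtain ⟨h, hh⟩ : ∃ h : H, χ (Additive.ofMul h) < 0 := by
    obtain ⟨x, hx⟩ := DFunLike.ne_iff.1 hχ
    obtain hlt | hgt := lt_or_gt_of_ne hx
    · exact ⟨x.toMul, hlt⟩
    · refine ⟨x.toMul⁻¹, ?_⟩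
      rw [ofMul_inv, ofMul_toMul, map_neg]
      exact neg_neg_of_pos hgt
  set x : MonoidAlgebra ℤ H := MonoidAlgebra.single h 1 with hx
  have hxpow (k : ℕ) : x ^ k = MonoidAlgebra.single (h ^ k) 1 := by
    rw [hx, MonoidAlgebra.single_pow, one_pow]
  obtain ⟨P, hP, hP0⟩ := LinearMap.exists_monic_and_aeval_eq_zero ℤ
    (Module.toModuleEnd ℤ (S := MonoidAlgebra ℤ H) M x)
  have h1 : Polynomial.aeval x P ∈ Module.annihilator (MonoidAlgebra ℤ H) M := by
    rw [Module.mem_annihilator]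
    intro m
    have h2 := Polynomial.aeval_algHom_apply
      (Module.toModuleEnd ℤ (S := MonoidAlgebra ℤ H) M).toIntAlgHom x P
    have h3 := h2.symm.trans hP0
    exact LinearMap.congr_fun h3 m
  refine ⟨∑ k ∈ Finset.range P.natDegree,
    MonoidAlgebra.single ((h ^ P.natDegree)⁻¹ * h ^ k) (P.coeff k), ?_, ?_⟩
  · refine Finset.sum_induction _ (PosSupp χ) (fun _ _ => PosSupp.add) .zero fun k hk => ?_
    refine PosSupp.single ?_ _
    rw [ofMul_mul, ofMul_inv, ofMul_pow, ofMul_pow, map_add, map_neg, map_nsmul, map_nsmul,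
      nsmul_eq_mul, nsmul_eq_mul]
    have h4 : (k : ℝ) < P.natDegree := by exact_mod_cast Finset.mem_range.1 hk
    nlinarith
  · have h5 := Ideal.mul_mem_left _ (MonoidAlgebra.single (h ^ P.natDegree)⁻¹ (1 : ℤ)) h1
    convert h5 using 1
    rw [Polynomial.aeval_eq_sum_range, Finset.sum_range_succ, hP.coeff_natDegree, one_smul, mul_add,
      hxpow, MonoidAlgebra.single_mul_single, inv_mul_cancel, mul_one, ← MonoidAlgebra.one_def,
      add_comm, Finset.mul_sum]
    congr 1
    refine Finset.sum_congr rfl fun k _ => ?_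
    rw [hxpow, MonoidAlgebra.smul_single, MonoidAlgebra.single_mul_single, smul_eq_mul, mul_one,
      one_mul]

/-- A relation in `M` that rewrites an element as a combination of translates in the half space
of a linear functional. -/
theorem exists_halfspace_relation {n : ℕ} {π : (Fin n → ℤ) →ₗ[ℤ] Additive H}
    (hπ : Function.Surjective π)
    (hM : tropVariety (Module.annihilator (MonoidAlgebra ℤ H) M) ⊆ {0}) {v : Fin n → ℝ}
    (hv : v ≠ 0) : ∃ c : (Fin n → ℤ) →₀ ℤ, (∀ k ∈ c.support, 0 < ∑ i, v i * k i) ∧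
      ∀ m : M, m = c.sum fun k a => MonoidAlgebra.single (π k).toMul a • m := by
  classical
  set V : (Fin n → ℤ) →+ ℝ :=
    { toFun := fun k => ∑ i, v i * k i
      map_zero' := by simp
      map_add' := fun a b => by simp [mul_add, Finset.sum_add_distrib] } with hV
  have hVk (k) : V k = ∑ i, v i * k i := rfl
  -- If the functional vanishes on the kernel of `π`, it descends to a nonzero character, and the
  -- tropical hypothesis supplies 1 + g in the annihilator; the relation is multiplication by -g,
  -- lifted to the lattice.
  by_cases hker : ∀ k, π k = 0 → V k = 0
  · obtain ⟨s, hs⟩ := hπ.hasRightInverse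
    set χ : Additive H →+ ℝ := π.toAddMonoidHom.liftOfRightInverse s hs ⟨V, hker⟩ with hχ
    have hχπ (k) : χ (π k) = V k :=
      π.toAddMonoidHom.liftOfRightInverse_comp_apply s hs ⟨V, hker⟩ k
    have hχ0 : χ ≠ 0 := by
      rintro h0
      obtain ⟨i, hi⟩ := Function.ne_iff.1 hv
      have h1 := hχπ (Pi.single i 1)
      rw [h0, hVk] at h1
      have h2 : ∑ j, v j * ((Pi.single i 1 : Fin n → ℤ) j : ℝ) = v i := by
        rw [Finset.sum_eq_single i]
        · simp
        · intro j _ hj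
          simp [hj]
        · simp
      rw [h2] at h1
      exact hi h1.symm
    obtain ⟨g, hg, hI⟩ := tropVariety_subset_iff.1 hM χ hχ0
    refine ⟨Finsupp.mapDomain (fun h : H => s (Additive.ofMul h)) (-g.coeff), fun k hk => ?_,
      fun m => ?_⟩
    · obtain ⟨h, hh, rfl⟩ := Finset.mem_image.1 (Finsupp.mapDomain_support hk)
      rw [← hVk, ← hχπ, hs]
      exact hg h (by simpa using hh)
    · rw [Finsupp.sum_mapDomain_index (fun _ => by rw [MonoidAlgebra.single_zero, zero_smul])
        (fun _ _ _ => by rw [MonoidAlgebra.single_add, add_smul])]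
      have h1 := Module.mem_annihilator.1 hI m
      rw [add_smul, one_smul] at h1
      have h2 : g = g.coeff.sum fun h a => MonoidAlgebra.single h a :=
        (MonoidAlgebra.sum_coeff_single g).symm
      rw [Finsupp.sum_neg_index (fun _ => by rw [MonoidAlgebra.single_zero, zero_smul])]
      rw [h2, Finsupp.sum, Finset.sum_smul] at h1
      rw [Finsupp.sum]
      refine (eq_neg_of_add_eq_zero_left h1).trans ?_
      rw [← Finset.sum_neg_distrib]
      refine Finset.sum_congr rfl fun h _ => ?_
      rw [hs, MonoidAlgebra.single_neg, neg_smul]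
      rfl
  -- Otherwise some kernel vector, up to sign, has positive value. It acts trivially, so a single
  -- translate gives the relation.
  · push Not at hker
    obtain ⟨k, hk, hVk0⟩ : ∃ k, π k = 0 ∧ 0 < V k := by
      obtain ⟨k, hk, hne⟩ := hker
      obtain hlt | hgt := lt_or_gt_of_ne hne
      · exact ⟨-k, by rw [map_neg, hk, neg_zero], by rw [map_neg]; linarith⟩
      · exact ⟨k, hk, hgt⟩
    refine ⟨Finsupp.single k 1, fun k' hk' => ?_, fun m => ?_⟩
    · rw [Finset.mem_singleton.1 (Finsupp.support_single_subset hk')]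
      exact hVk0
    · rw [Finsupp.sum_single_index (by rw [MonoidAlgebra.single_zero, zero_smul]), hk, toMul_zero,
        ← MonoidAlgebra.one_def, one_smul]

/-- Uniform version of `exists_halfspace_relation`. -/
theorem exists_uniform_relation {n : ℕ} {π : (Fin n → ℤ) →ₗ[ℤ] Additive H}
    (hπ : Function.Surjective π)
    (hM : tropVariety (Module.annihilator (MonoidAlgebra ℤ H) M) ⊆ {0}) :
    ∃ δ : ℝ, 0 < δ ∧ ∃ B : ℝ, ∀ v ∈ Metric.sphere (0 : Fin n → ℝ) 1,
      ∃ c : (Fin n → ℤ) →₀ ℤ, (∀ k ∈ c.support, δ < ∑ i, v i * k i ∧ ∑ i, (k i : ℝ) ^ 2 ≤ B) ∧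
      ∀ m : M, m = c.sum fun k a => MonoidAlgebra.single (π k).toMul a • m := by
  have hcont (k : Fin n → ℤ) : Continuous fun v : Fin n → ℝ => ∑ i, v i * k i :=
    continuous_finsetSum _ fun i _ => (continuous_apply i).mul continuous_const
  refine (isCompact_sphere (0 : Fin n → ℝ) 1).induction_on
    (p := fun S => ∃ δ : ℝ, 0 < δ ∧ ∃ B : ℝ, ∀ v ∈ S,
      ∃ c : (Fin n → ℤ) →₀ ℤ, (∀ k ∈ c.support, δ < ∑ i, v i * k i ∧ ∑ i, (k i : ℝ) ^ 2 ≤ B) ∧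
      ∀ m : M, m = c.sum fun k a => MonoidAlgebra.single (π k).toMul a • m)
    ⟨1, one_pos, 0, by simp⟩ ?_ ?_ ?_
  · rintro S T hST ⟨δ, hδ, B, h⟩
    exact ⟨δ, hδ, B, fun v hv => h v (hST hv)⟩
  · rintro S T ⟨δ, hδ, B, h⟩ ⟨δ', hδ', B', h'⟩
    refine ⟨min δ δ', lt_min hδ hδ', max B B', ?_⟩
    rintro v (hv | hv)
    · obtain ⟨c, hc, hm⟩ := h v hv
      exact ⟨c, fun k hk => ⟨(min_le_left _ _).trans_lt (hc k hk).1,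
        (hc k hk).2.trans (le_max_left _ _)⟩, hm⟩
    · obtain ⟨c, hc, hm⟩ := h' v hv
      exact ⟨c, fun k hk => ⟨(min_le_right _ _).trans_lt (hc k hk).1,
        (hc k hk).2.trans (le_max_right _ _)⟩, hm⟩
  · intro v hv
    obtain ⟨c, hc, hm⟩ := exists_halfspace_relation hπ hM (v := v) (by
      rintro rfl
      simp at hv)
    -- Working near (0, v) chooses the margin `δ` and the neighbourhood of v at once; the relation
    -- `c` itself stays fixed.
    have hev : ∀ᶠ x : ℝ × (Fin n → ℝ) in 𝓝 (0, v), ∀ k ∈ c.support, x.1 < ∑ i, x.2 i * k i := by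
      rw [Filter.eventually_all_finset]
      intro k hk
      exact (isOpen_lt continuous_fst ((hcont k).comp continuous_snd)).mem_nhds (hc k hk)
    rw [nhds_prod_eq] at hev
    obtain ⟨p, hp, q, hq, hpq⟩ := Filter.eventually_prod_iff.1 hev
    obtain ⟨δ, hδp, hδ⟩ := ((hp.filter_mono nhdsWithin_le_nhds).and
      (self_mem_nhdsWithin (a := (0 : ℝ)) (s := Ioi 0))).exists
    refine ⟨{x | q x}, mem_nhdsWithin_of_mem_nhds hq, δ, hδ,
      ∑ k ∈ c.support, ∑ i, (k i : ℝ) ^ 2, fun x hx => ⟨c, fun k hk => ⟨hpq hδp hx k hk, ?_⟩, hm⟩⟩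
    exact Finset.single_le_sum (f := fun k : Fin n → ℤ => ∑ i, (k i : ℝ) ^ 2)
      (fun k _ => Finset.sum_nonneg fun i _ => sq_nonneg _) hk

/-- Descent on the Euclidean length of lattice vectors: the translate of a generator by a distant
vector is a combination of translates by strictly shorter vectors, so those in a bounded region span
over ℤ. -/
theorem finite_of_tropVariety_annihilator [Group.FG H] [Module.Finite (MonoidAlgebra ℤ H) M]
    (hM : tropVariety (Module.annihilator (MonoidAlgebra ℤ H) M) ⊆ {0}) : Module.Finite ℤ M := by
  have hfg : Module.Finite ℤ (Additive H) := Module.Finite.iff_addGroup_fg.2 inferInstance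
  obtain ⟨n, π, hπ⟩ := Module.Finite.exists_fin' ℤ (Additive H)
  obtain ⟨δ, hδ, B, hB⟩ := exists_uniform_relation hπ hM
  -- Beyond `R` the gain 2δ‖a‖ of one step exceeds its quadratic cost `B`. The absolute value keeps
  -- `R` nonnegative.
  set R : ℝ := |B| / (2 * δ) with hR
  set S : Set (Fin n → ℤ) := {a | ‖a‖ ≤ R} with hS
  have hSfin : S.Finite := by
    have := (isCompact_closedBall (0 : Fin n → ℤ) R).finite_of_discrete
    exact this.subset fun a ha => mem_closedBall_zero_iff.2 ha
  obtain ⟨G, hG⟩ := Module.Finite.fg_top (R := MonoidAlgebra ℤ H) (M := M)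
  set N : Submodule ℤ M := Submodule.span ℤ
    (image2 (fun (a : Fin n → ℤ) m => MonoidAlgebra.single (π a).toMul (1 : ℤ) • m) S (G : Set M))
    with hN
  have hzsmul (h : H) (z : ℤ) (m : M) : MonoidAlgebra.single h z • m =
      z • MonoidAlgebra.single h (1 : ℤ) • m := by
    rw [← smul_assoc, MonoidAlgebra.smul_single, smul_eq_mul, mul_one]
  have key (a : Fin n → ℤ) : ∀ m ∈ G, MonoidAlgebra.single (π a).toMul (1 : ℤ) • m ∈ N := by
    induction hk : (∑ i, a i ^ 2).toNat using Nat.strong_induction_on generalizing a with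
    | h k ih =>
      intro m hm
      by_cases ha : ‖a‖ ≤ R
      · exact Submodule.subset_span ⟨a, ha, m, hm, rfl⟩
      · rw [not_le] at ha
        have hR0 : 0 ≤ R := by positivity
        have ha0 : 0 < ‖a‖ := hR0.trans_lt ha
        -- The direction from `a` to the origin, scaled to sup norm one. Then |a + b|² = |a|² + |b|²
        -- - 2‖a‖ (v · b), with Euclidean lengths and the sup norm ‖a‖.
        set v : Fin n → ℝ := fun i => -(a i : ℝ) / ‖a‖ with hv
        have hnorm : ‖fun i => (a i : ℝ)‖ = ‖a‖ := by
          rw [Pi.norm_def, Pi.norm_def]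
          exact congrArg NNReal.toReal (Finset.sup_congr rfl fun i _ =>
            NNReal.eq (Int.norm_cast_real (a i)))
        have hav (i) : (a i : ℝ) = -(‖a‖ * v i) := by
          rw [hv]
          field_simp
        have hvs : v ∈ Metric.sphere (0 : Fin n → ℝ) 1 := by
          have : v = (-‖a‖⁻¹) • fun i => (a i : ℝ) := by
            funext i
            simp only [hv, Pi.smul_apply, smul_eq_mul]
            ring
          rw [mem_sphere_zero_iff_norm, this, norm_smul, hnorm, norm_neg, norm_inv, norm_norm,
            inv_mul_cancel₀ ha0.ne']
        obtain ⟨c, hc, hm'⟩ := hB v hvs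
        rw [hm' m, Finsupp.sum, Finset.smul_sum]
        refine Submodule.sum_mem _ fun b hb => ?_
        rw [hzsmul _ (c b), smul_comm, smul_smul, MonoidAlgebra.single_mul_single, mul_one, ← toMul_add,
          ← map_add]
        refine Submodule.smul_mem _ _ (ih _ ?_ (a + b) rfl m hm)
        rw [← hk]
        have h1 : ∑ i, (a + b) i ^ 2 < ∑ i, a i ^ 2 := by
          have h2 : ((∑ i, (a + b) i ^ 2 : ℤ) : ℝ) = ((∑ i, a i ^ 2 : ℤ) : ℝ) +
              (∑ i, (b i : ℝ) ^ 2 - 2 * ‖a‖ * ∑ i, v i * b i) := by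
            push_cast
            rw [Finset.mul_sum, ← Finset.sum_sub_distrib, ← Finset.sum_add_distrib]
            refine Finset.sum_congr rfl fun i _ => ?_
            rw [Pi.add_apply, Int.cast_add, hav i]
            ring
          obtain ⟨h3, h4⟩ := hc b hb
          have h5 : |B| < 2 * ‖a‖ * δ := by
            rw [hR, div_lt_iff₀ (by positivity)] at ha
            linarith
          have h6 : 2 * ‖a‖ * δ < 2 * ‖a‖ * ∑ i, v i * b i :=
            mul_lt_mul_of_pos_left h3 (by positivity)
          have h7 := le_abs_self B
          have h8 : ((∑ i, (a + b) i ^ 2 : ℤ) : ℝ) < ((∑ i, a i ^ 2 : ℤ) : ℝ) := by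
            rw [h2]
            linarith
          exact_mod_cast h8
        have h9 : 0 ≤ ∑ i, (a + b) i ^ 2 := Finset.sum_nonneg fun i _ => sq_nonneg _
        omega
  refine ⟨⟨(hSfin.image2 (fun (a : Fin n → ℤ) m => MonoidAlgebra.single (π a).toMul (1 : ℤ) • m)
    G.finite_toSet).toFinset, ?_⟩⟩
  rw [Finite.coe_toFinset, eq_top_iff]
  rintro x -
  have hx : x ∈ Submodule.span (MonoidAlgebra ℤ H) (G : Set M) := hG ▸ Submodule.mem_top
  -- By `key` the span `N` is stable under the group; as it contains the generators, it is all of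
  -- `M`.
  have hstable (h : H) (y : M) (hy : y ∈ N) : MonoidAlgebra.single h (1 : ℤ) • y ∈ N := by
    induction hy using Submodule.span_induction with
    | mem y hy =>
      obtain ⟨a, -, m, hm, rfl⟩ := hy
      obtain ⟨b, hb⟩ := hπ (Additive.ofMul h)
      have : h = (π b).toMul := by rw [hb]; rfl
      change _ • _ • _ ∈ N
      rw [this, smul_smul, MonoidAlgebra.single_mul_single, mul_one, ← toMul_add, ← map_add]
      exact key _ m hm
    | zero => rw [smul_zero]; exact N.zero_mem
    | add y z _ _ hy hz => rw [smul_add]; exact N.add_mem hy hz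
    | smul r y _ hy => rw [smul_comm]; exact N.smul_mem _ hy
  induction hx using Submodule.span_induction with
  | mem x hx =>
    have := key 0 x hx
    rwa [map_zero, toMul_zero, ← MonoidAlgebra.one_def, one_smul] at this
  | zero => exact N.zero_mem
  | add y z _ _ hy hz => exact N.add_mem hy hz
  | smul r y _ hy =>
    induction r using monoidAlgebra_induction with
    | h0 => rw [zero_smul]; exact N.zero_mem
    | hadd r s hr hs => rw [add_smul]; exact N.add_mem hr hs
    | hs h z => rw [hzsmul]; exact N.smul_mem _ (hstable h y hy)

end Trop

end AbCover
end

noncomputable section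
namespace AbCover
open HasAff

/-! ### Jump ideals and annihilators of homology -/

section Matrices

variable {ι r s : Type*} [Fintype ι] [Fintype r] [Fintype s]

/-- Matrices `A`, `B` with `B * A = 0` that have enough rank are split exact. -/
theorem exists_splitting {K : Type*} [Field K] [DecidableEq ι] {A : Matrix ι r K}
    {B : Matrix s ι K} (hBA : B * A = 0) {n : ℕ} (hn : n = Fintype.card ι)
    (W₁ : Matrix (Fin n) ι K) (U₁ : Matrix r (Fin n) K) (W₂ : Matrix (Fin n) s K)
    (U₂ : Matrix ι (Fin n) K) (hdet : (W₁ * A * U₁ + W₂ * B * U₂).det ≠ 0) :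
    ∃ (P : Matrix r ι K) (Q : Matrix ι s K), A * P + Q * B = 1 := by
  classical
  set f := A.mulVecLin with hf
  set g := B.mulVecLin with hg
  have hle : LinearMap.range f ≤ LinearMap.ker g := by
    rintro _ ⟨x, rfl⟩
    rw [LinearMap.mem_ker, hf, hg, Matrix.mulVecLin_apply, Matrix.mulVecLin_apply,
      Matrix.mulVec_mulVec, hBA, Matrix.zero_mulVec]
  -- A vector killed by both A·U₁ and B·U₂ is killed by the invertible matrix, so Kⁿ embeds in the
  -- product of the two ranges. By rank-nullity this forces range f = ker g.
  have h1 : n ≤ Module.finrank K (LinearMap.range f) + Module.finrank K (LinearMap.range g) := by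
    set k : (Fin n → K) →ₗ[K] LinearMap.range f × LinearMap.range g :=
      (f.rangeRestrict ∘ₗ U₁.mulVecLin).prod (g.rangeRestrict ∘ₗ U₂.mulVecLin) with hk
    have hinj : Function.Injective k := by
      rw [injective_iff_map_eq_zero]
      intro x hx
      have hx1 : A.mulVec (U₁.mulVec x) = 0 := congrArg (fun y => (y.1 : ι → K)) hx
      have hx2 : B.mulVec (U₂.mulVec x) = 0 := congrArg (fun y => (y.2 : s → K)) hx
      refine Matrix.eq_zero_of_mulVec_eq_zero hdet ?_
      rw [Matrix.add_mulVec, ← Matrix.mulVec_mulVec, ← Matrix.mulVec_mulVec, hx1,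
        ← Matrix.mulVec_mulVec, ← Matrix.mulVec_mulVec, hx2, Matrix.mulVec_zero,
        Matrix.mulVec_zero, add_zero]
    have := LinearMap.finrank_le_finrank_of_injective hinj
    rwa [Module.finrank_prod, Module.finrank_fin_fun] at this
  have h2 := LinearMap.finrank_range_add_finrank_ker g
  rw [Module.finrank_pi, ← hn] at h2
  have heq : LinearMap.range f = LinearMap.ker g := Submodule.eq_of_le_of_finrank_le hle (by omega)
  obtain ⟨σ, hσ⟩ := g.rangeRestrict.exists_rightInverse_of_surjective g.range_rangeRestrict
  obtain ⟨q, hq⟩ := LinearMap.exists_extend σ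
  have hgq (x) : g (q (g x)) = g x := by
    have h3 := LinearMap.congr_fun hq (g.rangeRestrict x)
    have h4 := LinearMap.congr_fun hσ (g.rangeRestrict x)
    have h5 : q (g x) = σ (g.rangeRestrict x) := h3
    rw [h5]
    exact congrArg Subtype.val h4
  obtain ⟨τ, hτ⟩ := f.rangeRestrict.exists_rightInverse_of_surjective f.range_rangeRestrict
  -- Subtracting q(g x) moves x into ker g = range f, where the section `τ` of f can be applied.
  set h : (ι → K) →ₗ[K] LinearMap.range f :=
    (LinearMap.id - q ∘ₗ g).codRestrict _ (fun x => by
      rw [heq, LinearMap.mem_ker, LinearMap.sub_apply, map_sub, LinearMap.comp_apply, hgq]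
      exact sub_self _) with hh
  refine ⟨LinearMap.toMatrix' (τ ∘ₗ h), LinearMap.toMatrix' q, ?_⟩
  apply Matrix.toLin'.injective
  rw [map_add, Matrix.toLin'_mul, Matrix.toLin'_mul, Matrix.toLin'_toMatrix',
    Matrix.toLin'_toMatrix', Matrix.toLin'_one]
  refine LinearMap.ext fun x => ?_
  have h3 : f (τ (h x)) = x - q (g x) := congrArg Subtype.val (LinearMap.congr_fun hτ (h x))
  change f (τ (h x)) + q (g x) = x
  rw [h3, sub_add_cancel]

variable {R : Type*} [CommRing R]

/-- Test at a prime p containing `I`. If the determinant survives in the fraction field of R/p, then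
A and B split there, and clearing denominators gives P, Q over `R` with det(AP + QB) a power of a
nonzero element modulo p. This contradicts `hI`. -/
theorem det_mem_radical [DecidableEq ι] {A : Matrix ι r R} {B : Matrix s ι R} (hBA : B * A = 0)
    {I : Ideal R} (hI : ∀ (P : Matrix r ι R) (Q : Matrix ι s R), (A * P + Q * B).det ∈ I) {n : ℕ}
    (hn : n = Fintype.card ι) (W₁ : Matrix (Fin n) ι R) (U₁ : Matrix r (Fin n) R)
    (W₂ : Matrix (Fin n) s R) (U₂ : Matrix ι (Fin n) R) :
    (W₁ * A * U₁ + W₂ * B * U₂).det ∈ I.radical := by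
  rw [Ideal.radical_eq_sInf, Ideal.mem_sInf]
  rintro p ⟨hIp, hp⟩
  by_contra hx
  set ψ : R →+* FractionRing (R ⧸ p) := (algebraMap (R ⧸ p) _).comp (Ideal.Quotient.mk p) with hψ
  have hker (x : R) : ψ x = 0 ↔ x ∈ p := by
    rw [hψ, RingHom.comp_apply, FaithfulSMul.algebraMap_eq_zero_iff, Ideal.Quotient.eq_zero_iff_mem]
  obtain ⟨P', Q', hPQ⟩ := exists_splitting (A := A.map ψ) (B := B.map ψ)
    (by rw [← Matrix.map_mul, hBA, Matrix.map_zero _ (map_zero ψ)]) hn (W₁.map ψ) (U₁.map ψ)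
    (W₂.map ψ) (U₂.map ψ) (by
      rw [← Matrix.map_mul, ← Matrix.map_mul, ← Matrix.map_mul, ← Matrix.map_mul,
        ← Matrix.map_add _ (map_add ψ), ← RingHom.mapMatrix_apply, ← RingHom.map_det]
      rwa [Ne, hker])
  -- A single denominator `b` serves all entries of both matrices, so AP + QB becomes b times the
  -- identity.
  obtain ⟨b, hb⟩ := IsLocalization.exist_integer_multiples_of_finite (nonZeroDivisors (R ⧸ p))
    (S := FractionRing (R ⧸ p)) (Sum.elim (fun i : r × ι => P' i.1 i.2) fun i : ι × s => Q' i.1 i.2)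
  have hb' (i) : ∃ x : R, ψ x = algebraMap (R ⧸ p) (FractionRing (R ⧸ p)) b *
      (Sum.elim (fun i : r × ι => P' i.1 i.2) fun i : ι × s => Q' i.1 i.2) i := by
    obtain ⟨y, hy⟩ := hb i
    obtain ⟨x, rfl⟩ := Ideal.Quotient.mk_surjective y
    exact ⟨x, hy.trans (Algebra.smul_def _ _)⟩
  choose X hX using hb'
  set P : Matrix r ι R := fun i j => X (Sum.inl (i, j)) with hP
  set Q : Matrix ι s R := fun i j => X (Sum.inr (i, j)) with hQ
  have h1 : P.map ψ = algebraMap (R ⧸ p) (FractionRing (R ⧸ p)) b • P' := by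
    ext i j
    exact hX (Sum.inl (i, j))
  have h2 : Q.map ψ = algebraMap (R ⧸ p) (FractionRing (R ⧸ p)) b • Q' := by
    ext i j
    exact hX (Sum.inr (i, j))
  have h3 : ψ (A * P + Q * B).det = 0 := (hker _).2 (hIp (hI P Q))
  rw [RingHom.map_det, RingHom.mapMatrix_apply, Matrix.map_add _ (map_add ψ), Matrix.map_mul,
    Matrix.map_mul, h1, h2, Matrix.mul_smul, Matrix.smul_mul, ← smul_add, hPQ, Matrix.det_smul,
    Matrix.det_one, mul_one] at h3
  have h4 := eq_zero_of_pow_eq_zero h3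
  rw [FaithfulSMul.algebraMap_eq_zero_iff] at h4
  exact nonZeroDivisors.coe_ne_zero b h4

theorem aeval_mul_of_comm [DecidableEq ι] [DecidableEq r] {N : Matrix ι ι R} {D : Matrix r r R}
    {A : Matrix ι r R} (h : N * A = A * D) (q : Polynomial R) :
    Polynomial.aeval N q * A = A * Polynomial.aeval D q := by
  induction q using Polynomial.induction_on' with
  | add p q hp hq => rw [map_add, map_add, Matrix.add_mul, Matrix.mul_add, hp, hq]
  | monomial k a =>
    have hk : N ^ k * A = A * D ^ k := by
      induction k with
      | zero => simp
      | succ k ih => rw [pow_succ, Matrix.mul_assoc, h, ← Matrix.mul_assoc, ih, Matrix.mul_assoc,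
          ← pow_succ]
    rw [Polynomial.aeval_monomial, Polynomial.aeval_monomial, ← Algebra.smul_def,
      ← Algebra.smul_def, Matrix.smul_mul, Matrix.mul_smul, hk]

/-- On ker B the matrix N = AP + QB agrees with AP, so it maps cycles to boundaries. Cayley–Hamilton
writes the determinant, up to sign, as a polynomial in N times N, and polynomials in N preserve the
image of A because NA = A(PA). -/
theorem exists_mulVec_eq_det_smul [DecidableEq ι] {A : Matrix ι r R} {B : Matrix s ι R}
    (hBA : B * A = 0) (P : Matrix r ι R) (Q : Matrix ι s R) {x : ι → R} (hx : B.mulVec x = 0) :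
    ∃ y, A.mulVec y = (A * P + Q * B).det • x := by
  classical
  set N := A * P + Q * B with hN
  have hNA : N * A = A * (P * A) := by
    rw [hN, Matrix.add_mul, Matrix.mul_assoc Q, hBA, Matrix.mul_zero, add_zero, Matrix.mul_assoc]
  have hNx : N.mulVec x = A.mulVec (P.mulVec x) := by
    rw [hN, Matrix.add_mulVec, ← Matrix.mulVec_mulVec, ← Matrix.mulVec_mulVec, hx,
      Matrix.mulVec_zero, add_zero]
  have h1 : Polynomial.aeval N N.charpoly.divX * N = -algebraMap R _ (N.charpoly.coeff 0) := by
    have h2 := N.aeval_self_charpoly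
    rw [← N.charpoly.divX_mul_X_add, map_add, map_mul, Polynomial.aeval_X, Polynomial.aeval_C] at h2
    simpa using eq_neg_of_add_eq_zero_left h2
  have h2 : N.charpoly.coeff 0 • x =
      A.mulVec (-(Polynomial.aeval (P * A) N.charpoly.divX).mulVec (P.mulVec x)) := by
    rw [Matrix.mulVec_neg, Matrix.mulVec_mulVec, ← aeval_mul_of_comm hNA, ← Matrix.mulVec_mulVec,
      ← hNx, Matrix.mulVec_mulVec, h1, Matrix.neg_mulVec, neg_neg, Algebra.algebraMap_eq_smul_one,
      Matrix.smul_mulVec, Matrix.one_mulVec]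
  rw [Matrix.det_eq_sign_charpoly_coeff, mul_smul, h2]
  exact ⟨_, Matrix.mulVec_smul _ _ _⟩

end Matrices

end AbCover
end

noncomputable section
namespace AbCover
open HasAff
/-! ### Homology of complexes of modules -/

section Complexes

variable {R : Type u} [CommRing R] (K : ChainComplex (ModuleCat.{v} R) ℕ)

theorem next_down (j : ℕ) : (ComplexShape.down ℕ).next j = j - 1 := by
  cases j with
  | zero => exact ChainComplex.next_nat_zero
  | succ j => exact ChainComplex.next_nat_succ j

/-- Only a surjection from cycles that kills boundaries is used, for finiteness and for
annihilators. With `j = 0` the outgoing map is `K.d 0 0 = 0`, so every chain is a cycle. -/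
theorem exists_homology_class (j : ℕ) :
    ∃ π : LinearMap.ker (K.d j (j - 1)).hom →ₗ[R] K.homology j, Function.Surjective π ∧
      ∀ z : LinearMap.ker (K.d j (j - 1)).hom, (z : K.X j) ∈ LinearMap.range (K.d (j + 1) j).hom → π z = 0 := by
  let S := K.sc' (j + 1) j (j - 1)
  let e : S.moduleCatLeftHomologyData.H ≅ K.homology j := S.moduleCatHomologyIso.symm ≪≫
    ShortComplex.homologyMapIso (K.isoSc' (j + 1) j (j - 1) (ChainComplex.prev ℕ j)
      (next_down j)).symm
  let π : LinearMap.ker S.g.hom →ₗ[R] K.homology j :=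
    e.hom.hom.comp (LinearMap.range S.moduleCatToCycles).mkQ
  refine ⟨π, ?_, ?_⟩
  · exact (ConcreteCategory.bijective_of_isIso e.hom).2.comp (Submodule.mkQ_surjective (LinearMap.range S.moduleCatToCycles))
  · rintro z ⟨y, hy⟩
    have : (LinearMap.range S.moduleCatToCycles).mkQ z = 0 :=
      (Submodule.Quotient.mk_eq_zero _).2 ⟨y, Subtype.ext hy⟩
    exact (congrArg e.hom.hom this).trans (map_zero _)

theorem finite_homology [IsNoetherianRing R] (j : ℕ) [Module.Finite R (K.X j)] :
    Module.Finite R (K.homology j) := by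
  obtain ⟨π, hπ, -⟩ := exists_homology_class K j
  exact Module.Finite.of_surjective π hπ

theorem mem_annihilator_homology {j : ℕ} {x : R}
    (hx : ∀ z, (K.d j (j - 1)).hom z = 0 → ∃ y, (K.d (j + 1) j).hom y = x • z) :
    x ∈ Module.annihilator R (K.homology j) := by
  obtain ⟨π, hπ, h0⟩ := exists_homology_class K j
  rw [Module.mem_annihilator]
  intro m
  obtain ⟨z, rfl⟩ := hπ m
  rw [← map_smul]
  exact h0 _ (hx z z.2)

theorem det_mem_annihilator_homology {j : ℕ} {ι r s : Type*} [Fintype ι] [Fintype r] [Fintype s]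
    [DecidableEq ι] [DecidableEq r] (b₂ : Module.Basis r R (K.X (j + 1)))
    (b₁ : Module.Basis ι R (K.X j)) (b₀ : Module.Basis s R (K.X (j - 1)))
    (P : Matrix r ι R) (Q : Matrix ι s R) :
    (LinearMap.toMatrix b₂ b₁ (K.d (j + 1) j).hom * P +
      Q * LinearMap.toMatrix b₁ b₀ (K.d j (j - 1)).hom).det ∈
        Module.annihilator R (K.homology j) := by
  refine mem_annihilator_homology K fun z hz => ?_
  have hBA : LinearMap.toMatrix b₁ b₀ (K.d j (j - 1)).hom *
      LinearMap.toMatrix b₂ b₁ (K.d (j + 1) j).hom = 0 := by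
    rw [← LinearMap.toMatrix_comp, ← ModuleCat.hom_comp, K.d_comp_d, ModuleCat.hom_zero, map_zero]
  obtain ⟨y, hy⟩ := exists_mulVec_eq_det_smul hBA P Q (x := b₁.repr z) (by
    rw [LinearMap.toMatrix_mulVec_repr, hz]
    simp)
  refine ⟨b₂.equivFun.symm y, b₁.repr.injective (DFunLike.coe_injective ?_)⟩
  rw [← LinearMap.toMatrix_mulVec_repr b₂ b₁]
  have : ⇑(b₂.repr (b₂.equivFun.symm y)) = y := b₂.equivFun.apply_symm_apply y
  rw [this, hy, map_smul, Finsupp.coe_smul]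

/-- Minors of `d ⊕ d'` in arbitrary bases, in terms of given bases. -/
theorem exists_minor_eq {M₁ M₂ N₁ N₂ : Type v} [AddCommGroup M₁] [Module R M₁] [AddCommGroup M₂]
    [Module R M₂] [AddCommGroup N₁] [Module R N₁] [AddCommGroup N₂] [Module R N₂]
    {κ₁ κ₂ ι₁ ι₂ : Type*} [Fintype κ₁] [Fintype κ₂] [Fintype ι₁] [Fintype ι₂]
    [DecidableEq κ₁] [DecidableEq κ₂]
    (a₁ : Module.Basis κ₁ R M₁) (a₂ : Module.Basis κ₂ R M₂) (b₁ : Module.Basis ι₁ R N₁)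
    (b₂ : Module.Basis ι₂ R N₂) (f : M₁ →ₗ[R] N₁) (g : M₂ →ₗ[R] N₂) {k m n : ℕ}
    (b : Module.Basis (Fin m) R (M₁ × M₂)) (c : Module.Basis (Fin n) R (N₁ × N₂))
    (p : Fin k → Fin n) (q : Fin k → Fin m) :
    ∃ (W₁ : Matrix (Fin k) ι₁ R) (U₁ : Matrix κ₁ (Fin k) R) (W₂ : Matrix (Fin k) ι₂ R)
      (U₂ : Matrix κ₂ (Fin k) R), (LinearMap.toMatrix b c (f.prodMap g)).submatrix p q =
        W₁ * LinearMap.toMatrix a₁ b₁ f * U₁ + W₂ * LinearMap.toMatrix a₂ b₂ g * U₂ := by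
  refine ⟨Matrix.of fun i e => c.repr (b₁ e, 0) (p i), Matrix.of fun e i => a₁.repr (b (q i)).1 e,
    Matrix.of fun i e => c.repr (0, b₂ e) (p i), Matrix.of fun e i => a₂.repr (b (q i)).2 e, ?_⟩
  ext i i'
  have h1 (y : M₁) : c.repr (f y, 0) (p i) = ∑ e, c.repr (b₁ e, 0) (p i) *
      ((LinearMap.toMatrix a₁ b₁ f).mulVec (a₁.repr y)) e := by
    rw [LinearMap.toMatrix_mulVec_repr]
    have h2 := congrArg (fun x => c.repr (LinearMap.inl R N₁ N₂ x) (p i)) (b₁.sum_repr (f y))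
    simp only [map_sum, map_smul, Finsupp.coe_finsetSum, Finset.sum_apply, Finsupp.smul_apply,
      smul_eq_mul, LinearMap.inl_apply] at h2
    rw [← h2]
    exact Finset.sum_congr rfl fun e _ => mul_comm _ _
  have h1' (y : M₂) : c.repr (0, g y) (p i) = ∑ e, c.repr (0, b₂ e) (p i) *
      ((LinearMap.toMatrix a₂ b₂ g).mulVec (a₂.repr y)) e := by
    rw [LinearMap.toMatrix_mulVec_repr]
    have h2 := congrArg (fun x => c.repr (LinearMap.inr R N₁ N₂ x) (p i)) (b₂.sum_repr (g y))
    simp only [map_sum, map_smul, Finsupp.coe_finsetSum, Finset.sum_apply, Finsupp.smul_apply,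
      smul_eq_mul, LinearMap.inr_apply] at h2
    rw [← h2]
    exact Finset.sum_congr rfl fun e _ => mul_comm _ _
  rw [Matrix.submatrix_apply, LinearMap.toMatrix_apply, LinearMap.prodMap_apply,
    show ((f (b (q i')).1, g (b (q i')).2) : N₁ × N₂) = (f (b (q i')).1, 0) + (0, g (b (q i')).2) by
      simp, map_add, Finsupp.add_apply, h1, h1', Matrix.mul_assoc, Matrix.mul_assoc]
  rfl

/-- By `exists_minor_eq`, minors in any bases have the shape det(W₁AU₁ + W₂BU₂). This shape survives
`Φ`, and `det_mem_radical` applies to the image complex. -/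
theorem jumpIdeal_le_comap_radical_annihilator [Nontrivial R] {R' : Type w} [CommRing R']
    (K' : ChainComplex (ModuleCat.{z} R') ℕ) (Φ : R →+* R') {j : ℕ} {ι r s : Type*} [Fintype ι]
    [Fintype r] [Fintype s] [DecidableEq ι] [DecidableEq r]
    (b₂ : Module.Basis r R (K.X (j + 1))) (b₁ : Module.Basis ι R (K.X j))
    (b₀ : Module.Basis s R (K.X (j - 1))) (b₂' : Module.Basis r R' (K'.X (j + 1)))
    (b₁' : Module.Basis ι R' (K'.X j)) (b₀' : Module.Basis s R' (K'.X (j - 1)))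
    (h₂ : LinearMap.toMatrix b₂' b₁' (K'.d (j + 1) j).hom =
      (LinearMap.toMatrix b₂ b₁ (K.d (j + 1) j).hom).map Φ)
    (h₁ : LinearMap.toMatrix b₁' b₀' (K'.d j (j - 1)).hom =
      (LinearMap.toMatrix b₁ b₀ (K.d j (j - 1)).hom).map Φ) :
    jumpIdeal K j ≤ (Module.annihilator R' (K'.homology j)).radical.comap Φ := by
  rw [jumpIdeal, minorsIdeal, Ideal.span_le]
  rintro _ ⟨m, n, b, c, p, q, rfl⟩
  obtain ⟨W₁, U₁, W₂, U₂, h⟩ := exists_minor_eq b₂ b₁ b₁ b₀ (K.d (j + 1) j).hom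
    (K.d j (j - 1)).hom b c p q
  have hBA : LinearMap.toMatrix b₁' b₀' (K'.d j (j - 1)).hom *
      LinearMap.toMatrix b₂' b₁' (K'.d (j + 1) j).hom = 0 := by
    rw [← LinearMap.toMatrix_comp, ← ModuleCat.hom_comp, K'.d_comp_d, ModuleCat.hom_zero, map_zero]
  rw [SetLike.mem_coe, Ideal.mem_comap, h, RingHom.map_det, RingHom.mapMatrix_apply,
    Matrix.map_add _ (map_add Φ), Matrix.map_mul, Matrix.map_mul, Matrix.map_mul, Matrix.map_mul,
    ← h₁, ← h₂]
  exact det_mem_radical hBA (det_mem_annihilator_homology K' b₂' b₁' b₀')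
    (Module.finrank_eq_card_basis b₁) _ _ _ _

end Complexes

/-! ### Finiteness of the homology of abelian covers -/

theorem filtrationComplex_d (H : Type w) [CommGroup H] {Y : Type v} [TopologicalSpace Y]
    [MulAction H Y] [ContinuousConstSMul H Y] (F : ℕ → Set Y) (n : ℕ) :
    (filtrationComplex H F).d (n + 1) n =
      ModuleCat.ofHom (relBdry H (F (n + 2)) (F (n + 1)) (F n) n) :=
  ChainComplex.of_d (fun n => ModuleCat.of (MonoidAlgebra ℤ H) (RelHomology H (F (n + 1)) (F n) n))
    (fun n => ModuleCat.ofHom (relBdry H (F (n + 2)) (F (n + 1)) (F n) n)) n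

section Main

variable {X : Type u} [TopologicalSpace X] [T2Space X] [CWComplex (univ : Set X)]
  [CWComplex.Finite (univ : Set X)] {x₀ : X} {H : Type w} [CommGroup H]
  {ν : FundamentalGroup X x₀ →* H} {Y : Type v} [TopologicalSpace Y] [MulAction H Y]
  [ContinuousConstSMul H Y] (cY : AbelianCover x₀ ν Y)

namespace AbelianCover

include cY in
omit [ContinuousConstSMul H Y] in
theorem group_fg : Group.FG H :=
  have := cY.pathConnected
  fg_of_cover cY.isCover

include cY in
omit [ContinuousConstSMul H Y] in
theorem isNoetherianRing : IsNoetherianRing (MonoidAlgebra ℤ H) :=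
  have := cY.group_fg
  Algebra.FiniteType.isNoetherianRing ℤ _

/-- The basis of the cellular complex given by lifts of the cells. -/
def basisOfLifts {n : ℕ} {ψ : RelCWComplex.cell (univ : Set X) n → C(Simp n, Y)}
    (hψ : ∀ e x, cY.proj (ψ e x) = charMap e x) :
    Module.Basis (RelCWComplex.cell (univ : Set X) n) (MonoidAlgebra ℤ H)
      (cY.cellularComplex.X n) :=
  cY.cellBasis hψ

omit [CWComplex.Finite (univ : Set X)] in
theorem cellularComplex_d (n : ℕ) : cY.cellularComplex.d (n + 1) n = ModuleCat.ofHom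
    (relBdry H (cY.proj ⁻¹' (CWComplex.skeletonLT (univ : Set X) ((n + 2 : ℕ) : ℕ∞)))
      (cY.proj ⁻¹' (CWComplex.skeletonLT (univ : Set X) ((n + 1 : ℕ) : ℕ∞)))
      (cY.proj ⁻¹' (CWComplex.skeletonLT (univ : Set X) (n : ℕ∞))) n) :=
  filtrationComplex_d H _ n

theorem finite_cellularComplex (n : ℕ) :
    Module.Finite (MonoidAlgebra ℤ H) (cY.cellularComplex.X n) := by
  have : Finite (RelCWComplex.cell (univ : Set X) n) := RelCWComplex.FiniteType.finite_cell n
  choose ψ hψ using exists_lift_charMap (X := X) (n := n) cY.isCover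
  exact Module.Finite.of_basis (cY.basisOfLifts hψ)

theorem finite_homology (i : ℕ) : Module.Finite (MonoidAlgebra ℤ H) (cY.homology i) :=
  have := cY.isNoetherianRing
  have := cY.finite_cellularComplex i
  AbCover.finite_homology _ i

theorem finite_int_homology_iff (i : ℕ) : Module.Finite ℤ (cY.homology i) ↔
    tropVariety (Module.annihilator (MonoidAlgebra ℤ H) (cY.homology i)) ⊆ {0} := by
  have := cY.group_fg
  have := cY.finite_homology i
  exact ⟨fun _ => tropVariety_annihilator_of_finite, finite_of_tropVariety_annihilator⟩

variable {A : Type*} [CommGroup A] {μ : FundamentalGroup X x₀ →* A} {Z : Type z}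
  [TopologicalSpace Z] [MulAction A Z] [ContinuousConstSMul A Z] (cZ : AbelianCover x₀ μ Z)
  {φ : A →* H} (hφ : ∀ γ, φ (μ γ) = ν γ) (hμ : Function.Surjective μ)
include hφ hμ

/-- Lifts are chosen in the first cover and pushed to the second, so that the differentials of the
two complexes correspond entry by entry. -/
theorem jumpIdeal_le (j : ℕ) : jumpIdeal cZ.cellularComplex j ≤
    (Module.annihilator (MonoidAlgebra ℤ H) (cY.homology j)).radical.comap
      (MonoidAlgebra.mapDomainRingHom ℤ φ) := by
  classical
  have hfin (n : ℕ) : Finite (RelCWComplex.cell (univ : Set X) n) :=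
    RelCWComplex.FiniteType.finite_cell n
  have (n : ℕ) : Fintype (RelCWComplex.cell (univ : Set X) n) := Fintype.ofFinite _
  choose ψ hψ using fun n => exists_lift_charMap (X := X) (n := n) cZ.isCover
  have hψ' (n) := proj_push cZ cY hφ (hψ n)
  have hmat (n : ℕ) : LinearMap.toMatrix (cY.basisOfLifts (hψ' (n + 1))) (cY.basisOfLifts (hψ' n))
      (cY.cellularComplex.d (n + 1) n).hom =
      (LinearMap.toMatrix (cZ.basisOfLifts (hψ (n + 1))) (cZ.basisOfLifts (hψ n))
        (cZ.cellularComplex.d (n + 1) n).hom).map (MonoidAlgebra.mapDomainRingHom ℤ φ) := by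
    ext1 e' e
    rw [Matrix.map_apply, LinearMap.toMatrix_apply, LinearMap.toMatrix_apply, cellularComplex_d,
      cellularComplex_d]
    exact repr_push cZ cY hφ (hψ n) hμ (hψ (n + 1)) e e'
  refine jumpIdeal_le_comap_radical_annihilator _ _ _ (cZ.basisOfLifts (hψ (j + 1)))
    (cZ.basisOfLifts (hψ j)) (cZ.basisOfLifts (hψ (j - 1))) (cY.basisOfLifts (hψ' (j + 1)))
    (cY.basisOfLifts (hψ' j)) (cY.basisOfLifts (hψ' (j - 1))) (hmat j) ?_
  cases j with
  | zero =>
    -- Truncated subtraction makes the lower differential `d 0 0`, which vanishes in both complexes.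
    rw [cY.cellularComplex.shape 0 0 (by simp), cZ.cellularComplex.shape 0 0 (by simp),
      ModuleCat.hom_zero, ModuleCat.hom_zero, map_zero, map_zero, Matrix.map_zero _ (map_zero _)]
  | succ j => exact hmat j

/-- Surjectivity of `φ` keeps the pulled-back character nonzero, so the jump ideal contains some 1 +
g. Its image lies in the radical of the annihilator, and a power of that image has the form required
by the finiteness criterion. -/
theorem finite_homology_of_jumpIdealLE (hν : Function.Surjective ν) {k : ℕ}
    (hk : tropVariety (jumpIdealLE cZ.cellularComplex k) ⊆ {0}) {i : ℕ} (hi : i ≤ k) :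
    Module.Finite ℤ (cY.homology i) := by
  rw [finite_int_homology_iff, tropVariety_subset_iff]
  intro χ' hχ'
  have hφs : Function.Surjective φ := fun h => by
    obtain ⟨γ, rfl⟩ := hν h
    exact ⟨μ γ, hφ γ⟩
  have hχ : χ'.comp φ.toAdditive ≠ 0 := by
    intro h0
    refine hχ' (AddMonoidHom.ext fun h => ?_)
    obtain ⟨a, ha⟩ := hφs h.toMul
    have := DFunLike.congr_fun h0 (Additive.ofMul a)
    simp only [AddMonoidHom.comp_apply, MonoidHom.toAdditive_apply_apply, toMul_ofMul, ha,
      ofMul_toMul] at this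
    exact this
  obtain ⟨g, hg, hgI⟩ := tropVariety_subset_iff.1 hk _ hχ
  have hgJ : 1 + g ∈ jumpIdeal cZ.cellularComplex i :=
    (iInf₂_le i hi : jumpIdealLE cZ.cellularComplex k ≤ _) hgI
  obtain ⟨N, hN⟩ := jumpIdeal_le cY cZ hφ hμ i hgJ
  rw [map_add, map_one] at hN
  obtain ⟨g', hg', h⟩ := (hg.map (χ' := χ') φ fun _ => rfl).exists_pow N
  exact ⟨g', hg', h ▸ hN⟩

end AbelianCover

end Main

end AbCover
end

theorem mainTheorem8 {X : Type u} [TopologicalSpace X] [T2Space X]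
    [CWComplex (Set.univ : Set X)] [CWComplex.Finite (Set.univ : Set X)] [ConnectedSpace X]
    (x₀ : X) :
    (∀ (H' : Type w) [CommGroup H'] (ν : FundamentalGroup X x₀ →* H'),
      Function.Surjective ν → 1 ≤ Module.finrank ℤ (Additive H') →
      ∀ (Y : Type v) [TopologicalSpace Y] [MulAction H' Y] [ContinuousConstSMul H' Y]
        (c : AbelianCover x₀ ν Y) (i : ℕ),
        Module.Finite (MonoidAlgebra ℤ H') (c.homology i) ∧
        (Module.Finite ℤ (c.homology i) ↔
          tropVariety (Module.annihilator (MonoidAlgebra ℤ H') (c.homology i)) ⊆ {0})) ∧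
    (∀ (Z : Type z) [TopologicalSpace Z] [MulAction (Abelianization (FundamentalGroup X x₀)) Z]
        [ContinuousConstSMul (Abelianization (FundamentalGroup X x₀)) Z]
        (cmax : AbelianCover x₀ (Abelianization.of (G := FundamentalGroup X x₀)) Z) (k : ℕ),
      tropVariety (jumpIdealLE cmax.cellularComplex k) ⊆ {0} →
      ∀ (H' : Type w) [CommGroup H'] (ν : FundamentalGroup X x₀ →* H'),
        Function.Surjective ν → 1 ≤ Module.finrank ℤ (Additive H') →
        ∀ (Y : Type v) [TopologicalSpace Y] [MulAction H' Y] [ContinuousConstSMul H' Y]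
          (c : AbelianCover x₀ ν Y) (i : ℕ), i ≤ k → Module.Finite ℤ (c.homology i)) := by
  refine ⟨fun H' _ ν _ _ Y _ _ _ c i => ⟨c.finite_homology i, c.finite_int_homology_iff i⟩,
    fun Z _ _ _ cmax k hk H' _ ν hν _ Y _ _ _ c i hi => ?_⟩
  -- Since the target is abelian, `ν` factors through the abelianization; this factor is the `φ`
  -- comparing the two covers.
  exact AbelianCover.finite_homology_of_jumpIdealLE c cmax (φ := Abelianization.lift ν)
    (fun γ => Abelianization.lift_apply_of ν γ) (QuotientGroup.mk_surjective) hν hk hi
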